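/- An infinite binary image is a colouring $I$ of $\mathbb{Z}^2$ with the colours black and white. Its white pixel density is $$\rho(I)=\liminf_{j\to\infty,\ j\text{ odd}}\frac{\#\{\text{white pixels of } I \text{ in the } j\times j \text{ box centred at the origin}\}}{j^2}.$$ Two pixels are 4-adjacent if their $\ell_1$ distance is $1$, and 8-adjacent if their $\ell_\infty$ distance is $1$. For $\alpha\in\{4,8\}$, a white $\alpha$-connected component is a connected component of the graph whose vertices are the white pixels and whose edges join $\alpha$-adjacent white pixels. Let $\mathrm{maxCC}_\alpha(I)$ be the maximum size of a white $\alpha$-connected component of $I$ ($+\infty$ if there is no finite maximum; $0$ if $I$ has no white pixel), and for $d\in(0,1)$ let $$\mathcal{C}_\alpha(d)=\min\{\mathrm{maxCC}_\alpha(I): \rho(I)\ge d\},$$ the minimum being over all infinite binary images $I$. With $\mathbb{N}=\{1,2,3,\dots\}$ put, for $k\in\mathbb{N}$, $$F_8(k)=\max_{1\le j\le k}\frac{j}{j+\lceil 2\sqrt{j}\rceil+1},\qquad F_4(k)=\max_{1\le j\le k}\frac{j}{j+\frac12\lceil 2\sqrt{2j-1}\rceil},$$ and $F_\alpha^{-1}(d)=\min\{k\in\mathbb{N}:F_\alpha(k)\ge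 d\}$. For all $d\in(0,1)$ the minima defining $F_8^{-1}(d)$ and $F_4^{-1}(d)$ exist, and $$\mathcal{C}_8(d)=F_8^{-1}(d)\ge\frac{4}{(1-d)^2}-\frac{6}{1-d},\qquad \mathcal{C}_4(d)\ge F_4^{-1}(d)\ge\frac{2}{(1-d)^2}-\frac{4}{1-d}.$$ Moreover, $\mathcal{C}_4(d)$ has the following exact values: - $\mathcal{C}_4(d)=1$ for $d\in(0,\frac12]$; - $\mathcal{C}_4(d)=3$ for $d\in(\frac12,\frac{13}{24}]$; - $\mathcal{C}_4(d)=4$ for $d\in(\frac{13}{24},\frac47]$; - $\mathcal{C}_4(d)=5$ for $d\in(\frac47,\frac58]$; - $\mathcal{C}_4(d)=7$ for $d\in(\frac58,\frac7{11}]$; - $\mathcal{C}_4(d)=8$ for $d\in(\frac7{11},\frac23]$; - $\mathcal{C}_4(d)=10$ for $d\in(\frac23,\frac{61}{90}]$; - for every integer $n\ge2$, $\mathcal{C}_4(d)=F_4^{-1}(d)$ for $d\in\Big(\frac{4n^2-6n+2}{4n^2-2n-1},\frac{(n-1)^2+n^2}{2n^2}\Big]$; - for every integer $n\ge2$, $\mathcal{C}_4(d)=F_4^{-1}(d)$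 for $d\in\Big(\frac{4n^2-2n}{4n^2+2n-1},\frac{n}{n+1}\Big]$. -/

import Mathlib

/-!
An infinite binary image is a colouring of `ℤ × ℤ` by black and white; it is represented by
the set of its white pixels.
-/

namespace BinaryImage

/-- 4-adjacency: the `ℓ₁` distance is `1`. -/
def adj4 : SimpleGraph (ℤ × ℤ) where
  Adj x y := |x.1 - y.1| + |x.2 - y.2| = 1
  symm := ⟨fun x y h => by rw [abs_sub_comm y.1, abs_sub_comm y.2]; exact h⟩
  loopless := ⟨fun x h => by simp at h⟩

/-- 8-adjacency: the `ℓ∞` distance is `1`. -/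
def adj8 : SimpleGraph (ℤ × ℤ) where
  Adj x y := max |x.1 - y.1| |x.2 - y.2| = 1
  symm := ⟨fun x y h => by rw [abs_sub_comm y.1, abs_sub_comm y.2]; exact h⟩
  loopless := ⟨fun x h => by simp at h⟩

/-- The `(2n+1) × (2n+1)` box of pixels centred at the origin. -/
def box (n : ℕ) : Set (ℤ × ℤ) :=
  Set.Icc (-(n : ℤ)) n ×ˢ Set.Icc (-(n : ℤ)) n

/-- White pixel density of the image with white pixel set `W`: the lower limit, over odd
`j = 2n + 1`, of the proportion of white pixels in the centred `j × j` box. -/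
noncomputable def density (W : Set (ℤ × ℤ)) : ℝ :=
  Filter.liminf (fun n : ℕ => ((W ∩ box n).ncard : ℝ) / (2 * (n : ℝ) + 1) ^ 2) Filter.atTop

/-- The largest size of a white connected component, with respect to the adjacency `G`, of the
image with white pixel set `W`. It is `⊤` when there is no largest (finite) size, and `0` for
the all-black image. -/
noncomputable def maxCC (G : SimpleGraph (ℤ × ℤ)) (W : Set (ℤ × ℤ)) : ℕ∞ :=
  ⨆ c : (G.induce W).ConnectedComponent, c.supp.encard

/-- Maximum guaranteed component size: the minimum of `maxCC G W` over all infinite images of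
white pixel density at least `d`. (An infimum in `ℕ∞` over a nonempty set is a minimum.) -/
noncomputable def mgcs (G : SimpleGraph (ℤ × ℤ)) (d : ℝ) : ℕ∞ :=
  sInf {m : ℕ∞ | ∃ W : Set (ℤ × ℤ), d ≤ density W ∧ m = maxCC G W}

/-- `C₄(d)`. -/
noncomputable def C4 (d : ℝ) : ℕ∞ := mgcs adj4 d

/-- `C₈(d)`. -/
noncomputable def C8 (d : ℝ) : ℕ∞ := mgcs adj8 d

/-- `F₈(k) = max_{1 ≤ j ≤ k} j / (j + ⌈2√j⌉ + 1)`. -/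
noncomputable def F8 (k : ℕ) : ℝ :=
  sSup ((fun j : ℕ => (j : ℝ) / ((j : ℝ) + (⌈2 * Real.sqrt (j : ℝ)⌉ : ℝ) + 1)) '' Set.Icc 1 k)

/-- `F₄(k) = max_{1 ≤ j ≤ k} j / (j + ⌈2√(2j-1)⌉ / 2)`. -/
noncomputable def F4 (k : ℕ) : ℝ :=
  sSup ((fun j : ℕ =>
    (j : ℝ) / ((j : ℝ) + (⌈2 * Real.sqrt (2 * (j : ℝ) - 1)⌉ : ℝ) / 2)) '' Set.Icc 1 k)

/-- `F₈⁻¹(d) = min {k ≥ 1 : F₈(k) ≥ d}`. -/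
noncomputable def F8inv (d : ℝ) : ℕ := sInf {k : ℕ | 1 ≤ k ∧ d ≤ F8 k}

/-- `F₄⁻¹(d) = min {k ≥ 1 : F₄(k) ≥ d}`. -/
noncomputable def F4inv (d : ℝ) : ℕ := sInf {k : ℕ | 1 ≤ k ∧ d ≤ F4 k}

end BinaryImage

namespace BinaryImage

/-! All density estimates are comparisons of averages over large boxes. `AvgNonpos h` says that the
sums of `h` over centred boxes are at most of the order of the side length. Translating a bounded
function, or grouping its values by components of bounded size, only costs boundary terms. So
pointwise inequalities and inequalities per component can be added up, and `density_le` and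
`le_density` read off the density.

Lower bounds on component sizes are upper bounds on densities, obtained by looking at all 2 × 2
blocks. For 8-adjacency the white pixels of a block lie in one component. A component of `j` pixels
in `r` rows and `c` columns meets at least `j + r + c + 1` blocks (`card_nb_ge`), and `j ≤ r * c`
gives `r + c ≥ ⌈2√j⌉`; this is the bound `f8` (`density_le_of_comps8`). For 4-adjacency write the
number of white pixels of a block as `2 + exc - slk`; its average is four times the density. A block
with positive excess is 4-connected, so it belongs to one component. If the component occupies `m`
and `n` diagonals of the two slopes, its total excess is at most `2j - m - n` (`sum_exc_le`), while
`2j ≤ m * n + 1` (`two_mul_card_le`); this is the bound `f4` (`density_le_of_comps4`).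

For component sizes at most 3 and at most 6 the bound `f4` is too weak. There the shapes with the
largest excess (L-trominoes, and full 3 × 4 diagonal rectangles) are shown to force a single-pixel
component, a slack block or, for size 6, a less efficient hook-shaped neighbour close by. A
discharging argument then gives 13/24 and 5/8 (`density_le_of_comps_three`,
`density_le_of_comps_six`).

The matching images are periodic: colourings of the residues of a linear form (`exists_rect8`,
`exists_rect4`, two explicit tables) and a grid of black diagonals (`exists_diamond`). What remains
is arithmetic with `f8` and `f4`, in particular `f4_le_of_le`, which places `F4inv d` in the range
where a diagonal rectangle or a diamond attains the bound. -/

/-! ### Functions with nonpositive average over large boxes -/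

/-- The box `box n` as a finset. -/
noncomputable def boxF (n : ℕ) : Finset (ℤ × ℤ) :=
  Finset.Icc (-(n : ℤ)) n ×ˢ Finset.Icc (-(n : ℤ)) n

theorem mem_boxF {n : ℕ} {x : ℤ × ℤ} : x ∈ boxF n ↔ |x.1| ≤ n ∧ |x.2| ≤ n := by
  simp only [boxF, Finset.mem_product, Finset.mem_Icc, abs_le]

theorem coe_boxF (n : ℕ) : (boxF n : Set (ℤ × ℤ)) = box n := by
  simp [boxF, box]

theorem card_boxF (n : ℕ) : (boxF n).card = (2 * n + 1) ^ 2 := by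
  have : (Finset.Icc (-(n : ℤ)) n).card = 2 * n + 1 := by
    rw [Int.card_Icc]; omega
  rw [boxF, Finset.card_product, this, sq]

/-- The sums of `h` over centred boxes are bounded above by a multiple of the side length. -/
def AvgNonpos (h : ℤ × ℤ → ℝ) : Prop :=
  ∃ C : ℝ, ∀ n : ℕ, ∑ x ∈ boxF n, h x ≤ C * (n + 1)

theorem AvgNonpos.mono {f g : ℤ × ℤ → ℝ} (hg : AvgNonpos g) (h : ∀ x, f x ≤ g x) :
    AvgNonpos f := by
  obtain ⟨C, hC⟩ := hg
  exact ⟨C, fun n => (Finset.sum_le_sum fun x _ => h x).trans (hC n)⟩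

theorem avgNonpos_of_nonpos {f : ℤ × ℤ → ℝ} (h : ∀ x, f x ≤ 0) : AvgNonpos f :=
  ⟨0, fun n => by simpa using Finset.sum_nonpos fun x _ => h x⟩

theorem AvgNonpos.add {f g : ℤ × ℤ → ℝ} (hf : AvgNonpos f) (hg : AvgNonpos g) :
    AvgNonpos (fun x => f x + g x) := by
  obtain ⟨C, hC⟩ := hf
  obtain ⟨D, hD⟩ := hg
  refine ⟨C + D, fun n => ?_⟩
  rw [Finset.sum_add_distrib, add_mul]
  exact add_le_add (hC n) (hD n)

theorem AvgNonpos.const_mul {f : ℤ × ℤ → ℝ} (hf : AvgNonpos f) {c : ℝ} (hc : 0 ≤ c) :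
    AvgNonpos (fun x => c * f x) := by
  obtain ⟨C, hC⟩ := hf
  refine ⟨c * C, fun n => ?_⟩
  rw [← Finset.mul_sum, mul_assoc]
  exact mul_le_mul_of_nonneg_left (hC n) hc

theorem AvgNonpos.sum {ι : Type*} (s : Finset ι) {f : ι → ℤ × ℤ → ℝ}
    (h : ∀ i ∈ s, AvgNonpos (f i)) : AvgNonpos (fun x => ∑ i ∈ s, f i x) := by
  classical
  induction s using Finset.induction_on with
  | empty => exact avgNonpos_of_nonpos (by simp)
  | insert a s ha ih =>
    simp only [Finset.sum_insert ha]
    exact (h a (Finset.mem_insert_self _ _)).add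
      (ih fun i hi => h i (Finset.mem_insert_of_mem hi))

/-- Pixels of a box within distance less than `k` of its boundary. -/
noncomputable def rim (n k : ℕ) : Finset (ℤ × ℤ) :=
  (boxF n).filter fun x => (n : ℤ) < |x.1| + k ∨ (n : ℤ) < |x.2| + k

theorem card_rim_le (n k : ℕ) : ((rim n k).card : ℝ) ≤ 8 * k * (n + 1) := by
  have h1 : ((Finset.Icc (-(n : ℤ)) n).filter fun t => (n : ℤ) < |t| + k).card ≤ 2 * k := by
    have : ((Finset.Icc (-(n : ℤ)) n).filter fun t => (n : ℤ) < |t| + k) ⊆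
        Finset.Ioc ((n : ℤ) - k) n ∪ Finset.Ico (-(n : ℤ)) (-n + k) := by
      intro t ht
      simp only [Finset.mem_filter, Finset.mem_Icc] at ht
      simp only [Finset.mem_union, Finset.mem_Ioc, Finset.mem_Ico]
      rcases abs_cases t with h | h <;> omega
    refine (Finset.card_le_card this).trans ((Finset.card_union_le _ _).trans ?_)
    rw [Int.card_Ioc, Int.card_Ico]
    omega
  have h2 : (Finset.Icc (-(n : ℤ)) n).card = 2 * n + 1 := by
    rw [Int.card_Icc]; omega
  have h3 : rim n k ⊆
      (((Finset.Icc (-(n : ℤ)) n).filter fun t => (n : ℤ) < |t| + k) ×ˢ Finset.Icc (-(n : ℤ)) n) ∪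
      (Finset.Icc (-(n : ℤ)) n ×ˢ
        ((Finset.Icc (-(n : ℤ)) n).filter fun t => (n : ℤ) < |t| + k)) := by
    intro x hx
    simp only [rim, boxF, Finset.mem_filter, Finset.mem_product] at hx
    simp only [Finset.mem_union, Finset.mem_product, Finset.mem_filter]
    tauto
  have h4 := (Finset.card_le_card h3).trans (Finset.card_union_le _ _)
  rw [Finset.card_product, Finset.card_product, h2] at h4
  have h5 : (rim n k).card ≤ 8 * k * (n + 1) := by nlinarith
  exact_mod_cast h5

/-- Translating a bounded function does not change its averages. -/
theorem avgNonpos_shift {f : ℤ × ℤ → ℝ} {B : ℝ} (hB : ∀ x, |f x| ≤ B) (v : ℤ × ℤ) :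
    AvgNonpos (fun x => f (x + v) - f x) := by
  classical
  set k : ℕ := max v.1.natAbs v.2.natAbs with hk
  have hB0 : 0 ≤ B := (abs_nonneg _).trans (hB 0)
  refine ⟨2 * (B * (8 * k)), fun n => ?_⟩
  set A := boxF n
  set I := A.filter fun x => x + v ∈ A
  set J := A.filter fun x => ¬ (x + v ∈ A)
  -- Only pixels within `k` of the boundary can leave the box when translated by `v`. Equally many
  -- pixels of the box are not hit by the translate, so both errors are bounded by `J.card * B`.
  have hJ : J ⊆ rim n k := by
    intro x hx
    simp only [J, Finset.mem_filter] at hx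
    simp only [rim, Finset.mem_filter]
    refine ⟨hx.1, ?_⟩
    by_contra hcon
    apply hx.2
    rw [not_or] at hcon
    have h1 := abs_add_le x.1 v.1
    have h2 := abs_add_le x.2 v.2
    have h3 : |v.1| = v.1.natAbs := Int.abs_eq_natAbs _
    have h4 : |v.2| = v.2.natAbs := Int.abs_eq_natAbs _
    simp only [A, mem_boxF, Prod.fst_add, Prod.snd_add]
    omega
  have hJc : (J.card : ℝ) ≤ 8 * k * (n + 1) :=
    le_trans (by exact_mod_cast Finset.card_le_card hJ) (card_rim_le n k)
  set I' := I.image fun x => x + v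
  have hI' : I' ⊆ A := by
    intro y hy
    obtain ⟨x, hx, rfl⟩ := Finset.mem_image.1 hy
    exact (Finset.mem_filter.1 hx).2
  have hcI : I'.card = I.card := Finset.card_image_of_injective _ (add_left_injective v)
  have hsplit : I.card + J.card = A.card := Finset.card_filter_add_card_filter_not _
  have hcard : (A \ I').card = J.card := by
    rw [Finset.card_sdiff_of_subset hI']; omega
  have e1 : ∑ x ∈ A, f (x + v) = ∑ x ∈ I, f (x + v) + ∑ x ∈ J, f (x + v) :=
    (Finset.sum_filter_add_sum_filter_not _ _ _).symm
  have e2 : ∑ x ∈ I, f (x + v) = ∑ x ∈ I', f x :=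
    (Finset.sum_image fun a _ b _ h => add_left_injective v h).symm
  have e3 : ∑ x ∈ A \ I', f x + ∑ x ∈ I', f x = ∑ x ∈ A, f x := Finset.sum_sdiff hI'
  have b1 : ∑ x ∈ J, f (x + v) ≤ J.card * B := by
    rw [← nsmul_eq_mul]
    exact Finset.sum_le_card_nsmul _ _ _ fun x _ => (le_abs_self _).trans (hB _)
  have b2 : -(J.card * B) ≤ ∑ x ∈ A \ I', f x := by
    rw [neg_le, ← Finset.sum_neg_distrib, ← hcard, ← nsmul_eq_mul]
    exact Finset.sum_le_card_nsmul _ _ _ fun x _ => (neg_le_abs _).trans (hB _)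
  rw [Finset.sum_sub_distrib]
  have := mul_le_mul_of_nonneg_right hJc hB0
  linarith

/-- The reverse of `avgNonpos_shift`. -/
theorem avgNonpos_sub_shift {f : ℤ × ℤ → ℝ} {B : ℝ} (hB : ∀ x, |f x| ≤ B) (v : ℤ × ℤ) :
    AvgNonpos (fun x => f x - f (x + v)) := by
  refine (avgNonpos_shift (f := fun x => -f x) (B := B) (fun x => by simpa using hB x) v).mono ?_
  intro x
  linarith

/-! ### Density as an average of the indicator of the white pixels. -/

open Classical in
/-- Indicator function of a set of pixels. -/
noncomputable def ind (W : Set (ℤ × ℤ)) (x : ℤ × ℤ) : ℝ := if x ∈ W then 1 else 0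

theorem ind_nonneg (W : Set (ℤ × ℤ)) (x : ℤ × ℤ) : 0 ≤ ind W x := by
  unfold ind; split_ifs <;> norm_num

theorem ind_le_one (W : Set (ℤ × ℤ)) (x : ℤ × ℤ) : ind W x ≤ 1 := by
  unfold ind; split_ifs <;> norm_num

theorem abs_ind_le (W : Set (ℤ × ℤ)) (x : ℤ × ℤ) : |ind W x| ≤ 1 := by
  rw [abs_of_nonneg (ind_nonneg W x)]; exact ind_le_one W x

theorem ind_of_mem {W : Set (ℤ × ℤ)} {x : ℤ × ℤ} (h : x ∈ W) : ind W x = 1 := if_pos h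

theorem ind_of_notMem {W : Set (ℤ × ℤ)} {x : ℤ × ℤ} (h : x ∉ W) : ind W x = 0 := if_neg h

theorem sum_ind (W : Set (ℤ × ℤ)) (n : ℕ) :
    ∑ x ∈ boxF n, ind W x = ((W ∩ box n).ncard : ℝ) := by
  classical
  have : W ∩ box n = ((boxF n).filter fun x => x ∈ W : Finset _) := by
    ext x
    rw [Finset.coe_filter, Set.mem_inter_iff, ← coe_boxF, Finset.mem_coe, Set.mem_ofPred_eq,
      and_comm]
  rw [this, Set.ncard_coe_finset]
  simp [ind]

-- A box sum error of order `n + 1`, divided by the area of the box, vanishes in the limit. This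
-- converts `AvgNonpos` into a statement on the lower limit.
open Filter Topology in
theorem tendsto_error (ρ C : ℝ) :
    Tendsto (fun n : ℕ => ρ + C * ((n : ℝ) + 1) / (2 * (n : ℝ) + 1) ^ 2) atTop (𝓝 ρ) := by
  have h1 : Tendsto (fun n : ℕ => (1 : ℝ) / ((n : ℝ) + 1)) atTop (𝓝 0) :=
    tendsto_one_div_add_atTop_nhds_zero_nat
  have h2 : Tendsto (fun n : ℕ => |C| * ((1 : ℝ) / ((n : ℝ) + 1))) atTop (𝓝 0) := by
    simpa using h1.const_mul |C|
  have h3 : Tendsto (fun n : ℕ => C * ((n : ℝ) + 1) / (2 * (n : ℝ) + 1) ^ 2) atTop (𝓝 0) := by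
    refine squeeze_zero_norm (fun n => ?_) h2
    have hn : (0 : ℝ) ≤ n := n.cast_nonneg
    rw [Real.norm_eq_abs, abs_div, abs_mul, abs_of_nonneg (by positivity : (0 : ℝ) ≤ n + 1),
      abs_of_nonneg (by positivity : (0 : ℝ) ≤ (2 * (n : ℝ) + 1) ^ 2), mul_div_assoc]
    refine mul_le_mul_of_nonneg_left ?_ (abs_nonneg C)
    rw [div_le_div_iff₀ (by positivity) (by positivity)]
    nlinarith
  simpa using h3.const_add ρ

theorem ratio_nonneg (W : Set (ℤ × ℤ)) (n : ℕ) :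
    0 ≤ ((W ∩ box n).ncard : ℝ) / (2 * (n : ℝ) + 1) ^ 2 := by positivity

theorem ratio_le_one (W : Set (ℤ × ℤ)) (n : ℕ) :
    ((W ∩ box n).ncard : ℝ) / (2 * (n : ℝ) + 1) ^ 2 ≤ 1 := by
  rw [div_le_one (by positivity), ← sum_ind]
  calc ∑ x ∈ boxF n, ind W x ≤ (boxF n).card • (1 : ℝ) :=
        Finset.sum_le_card_nsmul _ _ _ fun x _ => ind_le_one W x
    _ = (2 * (n : ℝ) + 1) ^ 2 := by rw [card_boxF]; simp

open Filter Topology in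
theorem density_le {W : Set (ℤ × ℤ)} {ρ : ℝ} (h : AvgNonpos fun x => ind W x - ρ) :
    density W ≤ ρ := by
  obtain ⟨C, hC⟩ := h
  rw [density, ← (tendsto_error ρ C).liminf_eq]
  refine liminf_le_liminf (Eventually.of_forall fun n => ?_)
    (isBoundedUnder_of ⟨0, fun n => ratio_nonneg W n⟩)
    (tendsto_error ρ C).isCoboundedUnder_ge
  have := hC n
  rw [Finset.sum_sub_distrib, sum_ind, Finset.sum_const, card_boxF, nsmul_eq_mul] at this
  push_cast at this
  have hp : (0 : ℝ) < (2 * (n : ℝ) + 1) ^ 2 := by positivity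
  rw [div_le_iff₀ hp, add_mul, div_mul_cancel₀ _ hp.ne']
  linarith

open Filter Topology in
theorem le_density {W : Set (ℤ × ℤ)} {ρ : ℝ} (h : AvgNonpos fun x => ρ - ind W x) :
    ρ ≤ density W := by
  obtain ⟨C, hC⟩ := h
  rw [density, ← (tendsto_error ρ (-C)).liminf_eq]
  refine liminf_le_liminf (Eventually.of_forall fun n => ?_)
    (tendsto_error ρ (-C)).isBoundedUnder_ge
    (isBoundedUnder_of ⟨1, fun n => ratio_le_one W n⟩).isCoboundedUnder_ge
  have := hC n
  rw [Finset.sum_sub_distrib, sum_ind, Finset.sum_const, card_boxF, nsmul_eq_mul] at this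
  push_cast at this
  have hp : (0 : ℝ) < (2 * (n : ℝ) + 1) ^ 2 := by positivity
  rw [le_div_iff₀ hp, add_mul, div_mul_cancel₀ _ hp.ne']
  linarith


/-! ### Connected components of bounded size -/

/-- The white components of an image, all of size at most `k`, as finsets. -/
structure Comps (G : SimpleGraph (ℤ × ℤ)) (W : Set (ℤ × ℤ)) (k : ℕ) where
  comp : ℤ × ℤ → Finset (ℤ × ℤ)
  mem_self : ∀ {x}, x ∈ W → x ∈ comp x
  subset : ∀ {x y}, y ∈ comp x → y ∈ W
  comp_eq : ∀ {x y}, y ∈ comp x → comp y = comp x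
  adj_mem : ∀ {x y z}, y ∈ comp x → z ∈ W → G.Adj y z → z ∈ comp x
  card_le : ∀ x, (comp x).card ≤ k
  induct : ∀ {x} (P : ℤ × ℤ → Prop), P x →
    (∀ a ∈ comp x, ∀ b ∈ comp x, G.Adj a b → P a → P b) → ∀ y ∈ comp x, P y

theorem encard_supp_le_maxCC (G : SimpleGraph (ℤ × ℤ)) (W : Set (ℤ × ℤ))
    (c : (G.induce W).ConnectedComponent) : c.supp.encard ≤ maxCC G W :=
  le_iSup (fun c : (G.induce W).ConnectedComponent => c.supp.encard) c

theorem nonempty_comps {G : SimpleGraph (ℤ × ℤ)} {W : Set (ℤ × ℤ)} {k : ℕ}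
    (h : maxCC G W ≤ k) : Nonempty (Comps G W k) := by
  classical
  have hfin : ∀ c : (G.induce W).ConnectedComponent, c.supp.encard ≤ k := fun c =>
    (encard_supp_le_maxCC G W c).trans h
  have hf : ∀ c : (G.induce W).ConnectedComponent, (Subtype.val '' c.supp).Finite := fun c =>
    (Set.finite_of_encard_le_coe (hfin c)).image _
  -- A black pixel gets the empty set, so that `y ∈ cm x` already entails that `x` is white.
  let cm : ℤ × ℤ → Finset (ℤ × ℤ) := fun x =>
    if hx : x ∈ W then (hf ((G.induce W).connectedComponentMk ⟨x, hx⟩)).toFinset else ∅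
  have key : ∀ x y, y ∈ cm x ↔
      ∃ (hx : x ∈ W) (hy : y ∈ W), (G.induce W).Reachable ⟨y, hy⟩ ⟨x, hx⟩ := by
    intro x y
    by_cases hx : x ∈ W
    · simp only [cm, dif_pos hx, Set.Finite.mem_toFinset, Set.mem_image,
        SimpleGraph.ConnectedComponent.mem_supp_iff, SimpleGraph.ConnectedComponent.eq]
      constructor
      · rintro ⟨⟨z, hz⟩, hr, rfl⟩
        exact ⟨hx, hz, hr⟩
      · rintro ⟨_, hy, hr⟩
        exact ⟨⟨y, hy⟩, hr, rfl⟩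
    · simp [cm, hx]
  refine ⟨⟨cm, ?_, ?_, ?_, ?_, ?_, ?_⟩⟩
  · intro x hx
    exact (key x x).2 ⟨hx, hx, SimpleGraph.Reachable.refl _⟩
  · intro x y hy
    obtain ⟨_, hy, _⟩ := (key x y).1 hy
    exact hy
  · intro x y hy
    obtain ⟨hx, hy, hr⟩ := (key x y).1 hy
    ext z
    rw [key, key]
    constructor
    · rintro ⟨_, hz, hr'⟩
      exact ⟨hx, hz, hr'.trans hr⟩
    · rintro ⟨_, hz, hr'⟩
      exact ⟨hy, hz, hr'.trans hr.symm⟩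
  · intro x y z hy hz hadj
    obtain ⟨hx, hy, hr⟩ := (key x y).1 hy
    refine (key x z).2 ⟨hx, hz, SimpleGraph.Reachable.trans (SimpleGraph.Adj.reachable ?_) hr⟩
    exact hadj.symm
  · intro x
    by_cases hx : x ∈ W
    · have := hfin ((G.induce W).connectedComponentMk ⟨x, hx⟩)
      rw [← (Subtype.val_injective).encard_image] at this
      simp only [cm, dif_pos hx]
      rw [(hf _).encard_eq_coe_toFinset_card] at this
      exact_mod_cast this
    · simp [cm, hx]
  · intro x P hP hstep y hy
    obtain ⟨hx, hy, hr⟩ := (key x y).1 hy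
    have hr' := (SimpleGraph.reachable_iff_reflTransGen _ _).1 hr.symm
    have : ∀ z : W, Relation.ReflTransGen (G.induce W).Adj ⟨x, hx⟩ z → P z.1 := by
      intro z hz
      induction hz with
      | refl => exact hP
      | @tail b c hab hbc ih =>
        have hb := ((SimpleGraph.reachable_iff_reflTransGen _ _).2 hab).symm
        have hc := ((SimpleGraph.reachable_iff_reflTransGen _ _).2 (hab.tail hbc)).symm
        exact hstep b.1 ((key _ _).2 ⟨hx, b.2, hb⟩) c.1 ((key _ _).2 ⟨hx, c.2, hc⟩) hbc ih
    exact this ⟨y, hy⟩ hr'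

namespace Comps

variable {G : SimpleGraph (ℤ × ℤ)} {W : Set (ℤ × ℤ)} {k : ℕ} (K : Comps G W k)

/-- The induction predicate is tautological at `x`, and its hypothesis at any member `a` already
yields the claim, so no path has to be followed. -/
theorem mem_of_mem {x y : ℤ × ℤ} (h : y ∈ K.comp x) : x ∈ K.comp x := by
  have := K.mem_self (K.subset h)
  rw [K.comp_eq h] at this
  by_contra hx
  exact hx (K.induct (fun z => z ∈ K.comp x → x ∈ K.comp x) id
    (fun a ha _ _ _ hPa _ => hPa ha) y h h)

theorem pos_of_mem {x : ℤ × ℤ} (hx : x ∈ W) : 0 < (K.comp x).card :=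
  Finset.card_pos.2 ⟨x, K.mem_self hx⟩

/-- A function changing by at most `1` along edges takes an interval of values on a component. -/
theorem image_eq_Icc {x : ℤ × ℤ} (hx : x ∈ W) (f : ℤ × ℤ → ℤ)
    (hf : ∀ a b, G.Adj a b → |f a - f b| ≤ 1) :
    ∃ a b : ℤ, a ≤ b ∧ (K.comp x).image f = Finset.Icc a b := by
  have hne : ((K.comp x).image f).Nonempty := ⟨f x, Finset.mem_image_of_mem f (K.mem_self hx)⟩
  refine ⟨((K.comp x).image f).min' hne, ((K.comp x).image f).max' hne,
    Finset.min'_le_max' _ _, ?_⟩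
  ext t
  rw [Finset.mem_Icc]
  refine ⟨fun ht => ⟨Finset.min'_le _ _ ht, Finset.le_max' _ _ ht⟩, ?_⟩
  rintro ⟨h1, h2⟩
  by_contra hnot
  obtain ⟨p, hp, hpe⟩ := Finset.mem_image.1 (Finset.min'_mem _ hne)
  obtain ⟨q, hq, hqe⟩ := Finset.mem_image.1 (Finset.max'_mem _ hne)
  rw [← hpe] at h1
  rw [← hqe] at h2
  -- Discrete intermediate values: a step of size at most one cannot jump over the missing value
  -- `t`.
  have hstep : ∀ a ∈ K.comp x, ∀ b ∈ K.comp x, G.Adj a b → f a < t → f b < t := by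
    intro a _ b hb hab hat
    have h3 := hf a b hab
    have h4 : f b ≠ t := fun h => hnot (Finset.mem_image.2 ⟨b, hb, h⟩)
    rw [abs_le] at h3
    omega
  have hpt : f p < t := lt_of_le_of_ne h1 fun h => hnot (Finset.mem_image.2 ⟨p, hp, h⟩)
  have hpx := K.comp_eq hp
  have := K.induct (x := p) (fun z => f z < t) hpt (by rw [hpx]; exact hstep) q (by rwa [hpx])
  omega

/-- The values of `f` on the component form an interval of at most `k` integers. Applied to the
coordinates, this keeps the component of a pixel away from the rim inside the box. -/
theorem abs_sub_lt {x y : ℤ × ℤ} (hy : y ∈ K.comp x) (f : ℤ × ℤ → ℤ)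
    (hf : ∀ a b, G.Adj a b → |f a - f b| ≤ 1) : |f y - f x| < k := by
  have hxc := K.mem_of_mem hy
  obtain ⟨a, b, hab, h⟩ := K.image_eq_Icc (K.subset hxc) f hf
  have h1 : f y ∈ Finset.Icc a b := h ▸ Finset.mem_image_of_mem f hy
  have h2 : f x ∈ Finset.Icc a b := h ▸ Finset.mem_image_of_mem f hxc
  have h3 : (Finset.Icc a b).card ≤ k := h ▸ Finset.card_image_le.trans (K.card_le x)
  rw [Int.card_Icc] at h3
  rw [Finset.mem_Icc] at h1 h2
  rw [abs_lt]
  omega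

/-- A bounded function whose sum over each component is nonpositive has nonpositive averages. -/
theorem avgNonpos (hG : ∀ a b, G.Adj a b → |a.1 - b.1| ≤ 1 ∧ |a.2 - b.2| ≤ 1)
    {f : ℤ × ℤ → ℝ} {B : ℝ} (hB : ∀ x, f x ≤ B) (hoff : ∀ x ∉ W, f x ≤ 0)
    (hsum : ∀ x ∈ W, ∑ y ∈ K.comp x, f y ≤ 0) : AvgNonpos f := by
  classical
  wlog hB0 : 0 ≤ B generalizing B
  · exact this (B := 0) (fun x => (hB x).trans (not_le.1 hB0).le) le_rfl
  refine ⟨B * (8 * k), fun n => ?_⟩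
  -- `I` is a union of whole components, on each of which the sum is nonpositive. The white pixels
  -- of `J` have components crossing the boundary, so they lie in the rim of width `k`.
  set I := (boxF n).filter fun x => x ∈ W ∧ K.comp x ⊆ boxF n
  set J := (boxF n).filter fun x => ¬ (x ∈ W ∧ K.comp x ⊆ boxF n)
  have e : ∑ x ∈ boxF n, f x = ∑ x ∈ I, f x + ∑ x ∈ J, f x :=
    (Finset.sum_filter_add_sum_filter_not _ _ _).symm
  have hI : ∑ x ∈ I, f x ≤ 0 := by
    rw [← Finset.sum_fiberwise_of_maps_to (g := K.comp) (t := I.image K.comp)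
      (fun x hx => Finset.mem_image_of_mem _ hx)]
    refine Finset.sum_nonpos fun c hc => ?_
    obtain ⟨x, hx, rfl⟩ := Finset.mem_image.1 hc
    obtain ⟨-, hxW, hxs⟩ := Finset.mem_filter.1 hx
    have : I.filter (fun y => K.comp y = K.comp x) = K.comp x := by
      ext y
      simp only [I, Finset.mem_filter]
      constructor
      · rintro ⟨⟨_, hy, _⟩, h⟩
        exact h ▸ K.mem_self hy
      · intro hy
        have := K.comp_eq hy
        exact ⟨⟨hxs hy, K.subset hy, this ▸ hxs⟩, this⟩
    rw [this]
    exact hsum x hxW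
  have hJ : ∑ x ∈ J, f x ≤ (rim n k).card * B := by
    have h1 : ∑ x ∈ J, f x ≤ ∑ x ∈ J.filter (fun x => x ∈ W), f x := by
      rw [← Finset.sum_filter_add_sum_filter_not J (fun x => x ∈ W)]
      have : ∑ x ∈ J.filter (fun x => ¬ x ∈ W), f x ≤ 0 :=
        Finset.sum_nonpos fun x hx => hoff x (Finset.mem_filter.1 hx).2
      linarith
    have h2 : J.filter (fun x => x ∈ W) ⊆ rim n k := by
      intro x hx
      simp only [J, Finset.mem_filter] at hx
      obtain ⟨⟨hxb, hx⟩, hxW⟩ := hx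
      simp only [rim, Finset.mem_filter]
      refine ⟨hxb, ?_⟩
      by_contra hcon
      rw [not_or] at hcon
      refine hx ⟨hxW, fun y hy => ?_⟩
      have a1 := K.abs_sub_lt hy (fun z => z.1) fun a b h => (hG a b h).1
      have a2 := K.abs_sub_lt hy (fun z => z.2) fun a b h => (hG a b h).2
      have b1 := abs_add_le x.1 (y.1 - x.1)
      have b2 := abs_add_le x.2 (y.2 - x.2)
      rw [add_sub_cancel] at b1 b2
      rw [mem_boxF]
      omega
    refine h1.trans ((Finset.sum_le_card_nsmul _ _ B fun x _ => hB x).trans ?_)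
    rw [nsmul_eq_mul]
    refine mul_le_mul_of_nonneg_right ?_ hB0
    exact_mod_cast Finset.card_le_card h2
  have := mul_le_mul_of_nonneg_right (card_rim_le n k) hB0
  linarith

end Comps

theorem adj4_close (a b : ℤ × ℤ) (h : adj4.Adj a b) : |a.1 - b.1| ≤ 1 ∧ |a.2 - b.2| ≤ 1 := by
  have h : |a.1 - b.1| + |a.2 - b.2| = 1 := h
  have := abs_nonneg (a.1 - b.1)
  have := abs_nonneg (a.2 - b.2)
  omega

theorem adj8_close (a b : ℤ × ℤ) (h : adj8.Adj a b) : |a.1 - b.1| ≤ 1 ∧ |a.2 - b.2| ≤ 1 :=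
  max_le_iff.1 (le_of_eq h)

/-! ### Blocks of four pixels -/

/-- Offsets of the pixels of a `2 × 2` block from its lower left pixel. -/
def corners : Finset (ℤ × ℤ) := {(0, 0), (1, 0), (0, 1), (1, 1)}

open Classical in
/-- Number of pixels of `W` in the `2 × 2` block with lower left pixel `v`. -/
noncomputable def cnt (W : Set (ℤ × ℤ)) (v : ℤ × ℤ) : ℕ :=
  (corners.filter fun d => v + d ∈ W).card

theorem cnt_le_four (W : Set (ℤ × ℤ)) (v : ℤ × ℤ) : cnt W v ≤ 4 := by
  classical
  exact (Finset.card_filter_le _ _).trans (by decide)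

open Classical in
theorem cnt_eq (W : Set (ℤ × ℤ)) (v : ℤ × ℤ) :
    cnt W v = (if v ∈ W then 1 else 0) + (if v + (1, 0) ∈ W then 1 else 0)
      + (if v + (0, 1) ∈ W then 1 else 0) + (if v + (1, 1) ∈ W then 1 else 0) := by
  have h0 : v + (0, 0) = v := add_zero v
  rw [cnt, Finset.card_filter, corners, Finset.sum_insert (by decide),
    Finset.sum_insert (by decide), Finset.sum_insert (by decide), Finset.sum_singleton, h0]
  ring

theorem cast_cnt (W : Set (ℤ × ℤ)) (v : ℤ × ℤ) : (cnt W v : ℝ) = ∑ d ∈ corners, ind W (v + d) := by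
  classical
  simp only [cnt, ind, Finset.card_filter]
  push_cast
  rfl

/-- The blocks meeting `C`. -/
def nb (C : Finset (ℤ × ℤ)) : Finset (ℤ × ℤ) :=
  (C ×ˢ corners).image fun p => p.1 - p.2

theorem mem_nb {C : Finset (ℤ × ℤ)} {v : ℤ × ℤ} : v ∈ nb C ↔ ∃ d ∈ corners, v + d ∈ C := by
  simp only [nb, Finset.mem_image, Finset.mem_product]
  constructor
  · rintro ⟨p, ⟨h1, h2⟩, rfl⟩
    exact ⟨p.2, h2, by simpa using h1⟩
  · rintro ⟨d, hd, h⟩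
    exact ⟨(v + d, d), ⟨h, hd⟩, by simp⟩

/-- Double counting of the pairs formed by a pixel of `C` and a block containing it: the block in
which `x` is the corner `d` is `x - d`. -/
theorem sum_corners_eq (C : Finset (ℤ × ℤ)) (H : ℤ × ℤ → ℝ) :
    ∑ x ∈ C, ∑ d ∈ corners, H (x - d) = ∑ v ∈ nb C, (cnt (C : Set (ℤ × ℤ)) v : ℝ) * H v := by
  classical
  rw [← Finset.sum_product', ← Finset.sum_fiberwise_of_maps_to (g := fun p => p.1 - p.2)
    (t := nb C) (fun p hp => Finset.mem_image_of_mem _ hp)]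
  refine Finset.sum_congr rfl fun v _ => ?_
  rw [Finset.sum_congr rfl (g := fun _ => H v) (by
    intro p hp; rw [(Finset.mem_filter.1 hp).2]), Finset.sum_const, nsmul_eq_mul]
  congr 2
  refine Finset.card_bij' (fun p _ => p.2) (fun d _ => (v + d, d)) ?_ ?_ ?_ ?_
  · intro p hp
    obtain ⟨hp, hv⟩ := Finset.mem_filter.1 hp
    rw [Finset.mem_product] at hp
    simp only [Finset.mem_filter, Finset.mem_coe]
    rw [← hv, sub_add_cancel]
    exact ⟨hp.2, hp.1⟩
  · intro d hd
    simp only [Finset.mem_filter, Finset.mem_coe] at hd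
    rw [Finset.mem_filter, Finset.mem_product]
    exact ⟨⟨hd.2, hd.1⟩, add_sub_cancel_right _ _⟩
  · intro p hp
    obtain ⟨-, hv⟩ := Finset.mem_filter.1 hp
    rw [← hv, sub_add_cancel]
  · intro d hd
    rfl

/-- The function on pixels obtained by dividing the value of each block equally among its white
pixels. -/
noncomputable def push (W : Set (ℤ × ℤ)) (F : ℤ × ℤ → ℝ) (x : ℤ × ℤ) : ℝ :=
  ind W x * ∑ d ∈ corners, F (x - d) / cnt W (x - d)

theorem abs_push_le (W : Set (ℤ × ℤ)) {F : ℤ × ℤ → ℝ} {B : ℝ} (hB : ∀ x, |F x| ≤ B)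
    (x : ℤ × ℤ) : |push W F x| ≤ 4 * B := by
  have hB0 : 0 ≤ B := (abs_nonneg _).trans (hB 0)
  have h1 : ∀ v, |F v / cnt W v| ≤ B := by
    intro v
    rw [abs_div, Nat.abs_cast]
    rcases Nat.eq_zero_or_pos (cnt W v) with h | h
    · simp [h, hB0]
    · exact (div_le_self (abs_nonneg _) (by exact_mod_cast h)).trans (hB v)
  rw [push, abs_mul]
  calc _ ≤ 1 * ∑ d ∈ corners, |F (x - d) / cnt W (x - d)| :=
        mul_le_mul (abs_ind_le W x) (Finset.abs_sum_le_sum_abs _ _) (abs_nonneg _) zero_le_one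
    _ ≤ 1 * (corners.card • B) := by
        gcongr
        exact Finset.sum_le_card_nsmul _ _ _ fun d _ => h1 _
    _ = 4 * B := by
        have : corners.card = 4 := by decide
        rw [this]; simp

/-- The shares of the white pixels add up to the value of the block. On an empty block the shares
are zero, which is why `F` must vanish there. -/
theorem push_aux (W : Set (ℤ × ℤ)) {F : ℤ × ℤ → ℝ}
    (hF : ∀ v, cnt W v = 0 → F v = 0) (v : ℤ × ℤ) :
    F v = ∑ d ∈ corners, ind W (v + d) * (F v / cnt W v) := by
  rw [← Finset.sum_mul, ← cast_cnt]
  rcases Nat.eq_zero_or_pos (cnt W v) with h | h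
  · simp [h, hF v h]
  · have : (cnt W v : ℝ) ≠ 0 := by exact_mod_cast h.ne'
    field_simp

theorem abs_push_term_le (W : Set (ℤ × ℤ)) {F : ℤ × ℤ → ℝ} {B : ℝ} (hB : ∀ x, |F x| ≤ B)
    (d v : ℤ × ℤ) : |ind W (v + d) * (F v / cnt W v)| ≤ B := by
  rw [abs_mul, abs_div, Nat.abs_cast]
  have h2 : |F v| / cnt W v ≤ B := by
    rcases Nat.eq_zero_or_pos (cnt W v) with h | h
    · simp [h, (abs_nonneg _).trans (hB 0)]
    · exact (div_le_self (abs_nonneg _) (by exact_mod_cast h)).trans (hB v)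
  calc _ ≤ 1 * (|F v| / cnt W v) := by
        gcongr
        exact abs_ind_le W _
    _ ≤ B := by rwa [one_mul]

/-- `push` arises from `F` by translating each of the four shares of a block by a corner offset, so
averages do not change. -/
theorem avgNonpos_sub_push (W : Set (ℤ × ℤ)) {F : ℤ × ℤ → ℝ} {B : ℝ} (hB : ∀ x, |F x| ≤ B)
    (hF : ∀ v, cnt W v = 0 → F v = 0) : AvgNonpos fun x => F x - push W F x := by
  refine (AvgNonpos.sum corners fun d _ =>
    avgNonpos_sub_shift (abs_push_term_le W hB d) (-d)).mono fun x => ?_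
  rw [Finset.sum_sub_distrib, ← push_aux W hF, push, Finset.mul_sum]
  simp [sub_eq_add_neg]

theorem avgNonpos_push_sub (W : Set (ℤ × ℤ)) {F : ℤ × ℤ → ℝ} {B : ℝ} (hB : ∀ x, |F x| ≤ B)
    (hF : ∀ v, cnt W v = 0 → F v = 0) : AvgNonpos fun x => push W F x - F x := by
  refine (AvgNonpos.sum corners fun d _ =>
    avgNonpos_shift (abs_push_term_le W hB d) (-d)).mono fun x => ?_
  rw [Finset.sum_sub_distrib, ← push_aux W hF, push, Finset.mul_sum]
  simp [sub_eq_add_neg]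

/-- If the relevant blocks have all their white pixels in `C`, then `push` preserves totals. -/
theorem sum_push (W : Set (ℤ × ℤ)) (F : ℤ × ℤ → ℝ) (C : Finset (ℤ × ℤ)) (hC : ↑C ⊆ W)
    (h : ∀ v, F v ≠ 0 → ∀ d ∈ corners, v + d ∈ C → ∀ e ∈ corners, v + e ∈ W → v + e ∈ C) :
    ∑ x ∈ C, push W F x = ∑ v ∈ nb C, F v := by
  classical
  have h1 : ∑ x ∈ C, push W F x = ∑ x ∈ C, ∑ d ∈ corners, F (x - d) / cnt W (x - d) := by
    refine Finset.sum_congr rfl fun x hx => ?_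
    rw [push, ind_of_mem (hC hx), one_mul]
  rw [h1, sum_corners_eq C fun v => F v / cnt W v]
  refine Finset.sum_congr rfl fun v hv => ?_
  by_cases hFv : F v = 0
  · simp [hFv]
  obtain ⟨d, hd, hvd⟩ := mem_nb.1 hv
  have h2 : cnt (C : Set (ℤ × ℤ)) v = cnt W v := by
    unfold cnt
    congr 1
    ext e
    simp only [Finset.mem_filter, Finset.mem_coe]
    exact ⟨fun ⟨a, b⟩ => ⟨a, hC b⟩, fun ⟨a, b⟩ => ⟨a, h v hFv d hd hvd e a b⟩⟩
  have h3 : (cnt W v : ℝ) ≠ 0 := by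
    have : 0 < cnt W v := Finset.card_pos.2 ⟨d, Finset.mem_filter.2 ⟨hd, hC hvd⟩⟩
    exact_mod_cast this.ne'
  rw [h2]
  field_simp


/-! ### Isoperimetric inequalities -/

/-- Adding to `S` its translate by `-e` gains at least one element on each line along `e`. -/
theorem card_add_card_image_le (S : Finset (ℤ × ℤ)) (e : ℤ × ℤ) (f g : ℤ × ℤ → ℤ)
    (hf : ∀ x, f (x - e) = f x) (hg : ∀ x, g (x - e) < g x) :
    S.card + (S.image f).card ≤ (S ∪ S.image fun x => x - e).card := by
  classical
  have hex : ∀ t ∈ S.image f, ∃ x ∈ S, f x = t ∧ x - e ∉ S := by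
    intro t ht
    obtain ⟨z, hz, hzt⟩ := Finset.mem_image.1 ht
    -- On the line `f = t` the pixel of `S` with smallest `g` has its translate by `-e` outside `S`.
    -- These translates are distinct for distinct lines.
    obtain ⟨x, hx, hmin⟩ := Finset.exists_min_image (S.filter fun x => f x = t) g
      ⟨z, Finset.mem_filter.2 ⟨hz, hzt⟩⟩
    obtain ⟨hxS, hxt⟩ := Finset.mem_filter.1 hx
    refine ⟨x, hxS, hxt, fun hcon => ?_⟩
    have := hmin (x - e) (Finset.mem_filter.2 ⟨hcon, by rw [hf, hxt]⟩)
    exact absurd this (not_le.2 (hg x))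
  choose! m hmS hmt hmn using hex
  have hinj : ((S.image f).image fun t => m t - e).card = (S.image f).card := by
    refine Finset.card_image_of_injOn fun a ha b hb hab => ?_
    have h := congrArg f hab
    simp only [hf] at h
    rwa [hmt a ha, hmt b hb] at h
  have hdisj : Disjoint S ((S.image f).image fun t => m t - e) := by
    rw [Finset.disjoint_right]
    intro y hy
    obtain ⟨t, ht, rfl⟩ := Finset.mem_image.1 hy
    exact hmn t ht
  rw [← hinj, ← Finset.card_union_of_disjoint hdisj]
  refine Finset.card_le_card (Finset.union_subset_union_right ?_)
  intro y hy
  obtain ⟨t, ht, rfl⟩ := Finset.mem_image.1 hy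
  exact Finset.mem_image_of_mem _ (hmS t ht)

/-- `nb C` contains what results from adding to `C` its left translate and then the downward
translate of the outcome. The first gains a pixel per row, the second a pixel per column, and the
leftward extension has created one more column. -/
theorem card_nb_ge {C : Finset (ℤ × ℤ)} (hC : C.Nonempty) :
    ∃ r c : ℕ, C.card ≤ r * c ∧ C.card + r + c + 1 ≤ (nb C).card := by
  classical
  refine ⟨(C.image Prod.snd).card, (C.image Prod.fst).card, ?_, ?_⟩
  · rw [mul_comm, ← Finset.card_product]
    refine Finset.card_le_card fun x hx => ?_
    exact Finset.mem_product.2 ⟨Finset.mem_image_of_mem _ hx, Finset.mem_image_of_mem _ hx⟩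
  set C1 := C ∪ C.image fun x => x - (1, 0)
  have h1 : C.card + (C.image Prod.snd).card ≤ C1.card :=
    card_add_card_image_le C (1, 0) Prod.snd Prod.fst (by simp) (by simp)
  have h2 : C1.card + (C1.image Prod.fst).card ≤ (C1 ∪ C1.image fun x => x - (0, 1)).card :=
    card_add_card_image_le C1 (0, 1) Prod.fst Prod.snd (by simp) (by simp)
  have h3 : (C.image Prod.fst).card + 1 ≤ (C1.image Prod.fst).card := by
    have hne : (C.image Prod.fst).Nonempty := hC.image _
    set m := (C.image Prod.fst).min' hne with hm
    have hnot : m - 1 ∉ C.image Prod.fst := fun h => by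
      have := Finset.min'_le _ _ h
      omega
    rw [← Finset.card_insert_of_notMem hnot]
    refine Finset.card_le_card (Finset.insert_subset ?_ ?_)
    · obtain ⟨p, hp, hpm⟩ := Finset.mem_image.1 (Finset.min'_mem _ hne)
      refine Finset.mem_image.2 ⟨p - (1, 0), ?_, ?_⟩
      · exact Finset.mem_union_right _ (Finset.mem_image_of_mem _ hp)
      · simp [hpm, hm]
    · exact Finset.image_subset_image Finset.subset_union_left
  have h4 : (C1 ∪ C1.image fun x => x - (0, 1)) ⊆ nb C := by
    have hC1 : ∀ y ∈ C1, y ∈ C ∨ y + (1, 0) ∈ C := by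
      intro y hy
      rcases Finset.mem_union.1 hy with hy | hy
      · exact Or.inl hy
      · obtain ⟨x, hx, rfl⟩ := Finset.mem_image.1 hy
        exact Or.inr (by simpa using hx)
    intro y hy
    rw [mem_nb]
    rcases Finset.mem_union.1 hy with hy | hy
    · rcases hC1 y hy with h | h
      · exact ⟨(0, 0), by decide, by rwa [show y + (0, 0) = y from add_zero y]⟩
      · exact ⟨(1, 0), by decide, h⟩
    · obtain ⟨x, hx, rfl⟩ := Finset.mem_image.1 hy
      rcases hC1 x hx with h | h
      · exact ⟨(0, 1), by decide, by simpa using h⟩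
      · refine ⟨(1, 1), by decide, ?_⟩
        have : x - (0, 1) + (1, 1) = x + (1, 0) := by ext <;> simp
        rwa [this]
  have h5 := Finset.card_le_card h4
  omega

/-! ### Diagonals, and blocks with more or fewer than two white pixels. -/

/-- Index of the diagonal of slope `-1` through a pixel. -/
def du (p : ℤ × ℤ) : ℤ := p.1 + p.2

/-- Index of the diagonal of slope `1` through a pixel. -/
def dw (p : ℤ × ℤ) : ℤ := p.1 - p.2

/-- The number of pixels of `W` in excess of two in a block. -/
noncomputable def exc (W : Set (ℤ × ℤ)) (v : ℤ × ℤ) : ℝ := ((cnt W v - 2 : ℕ) : ℝ)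

/-- The number of pixels missing to have two pixels of `W` in a block. -/
noncomputable def slk (W : Set (ℤ × ℤ)) (v : ℤ × ℤ) : ℝ := ((2 - cnt W v : ℕ) : ℝ)

theorem exc_nonneg (W : Set (ℤ × ℤ)) (v : ℤ × ℤ) : 0 ≤ exc W v := Nat.cast_nonneg _

theorem slk_nonneg (W : Set (ℤ × ℤ)) (v : ℤ × ℤ) : 0 ≤ slk W v := Nat.cast_nonneg _

theorem exc_le_two (W : Set (ℤ × ℤ)) (v : ℤ × ℤ) : exc W v ≤ 2 := by
  have := cnt_le_four W v
  have h : cnt W v - 2 ≤ 2 := by omega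
  unfold exc
  exact_mod_cast h

theorem slk_le_two (W : Set (ℤ × ℤ)) (v : ℤ × ℤ) : slk W v ≤ 2 := by
  have h : 2 - cnt W v ≤ 2 := by omega
  unfold slk
  exact_mod_cast h

theorem abs_exc_le (W : Set (ℤ × ℤ)) (v : ℤ × ℤ) : |exc W v| ≤ 2 := by
  rw [abs_of_nonneg (exc_nonneg W v)]; exact exc_le_two W v

theorem abs_slk_le (W : Set (ℤ × ℤ)) (v : ℤ × ℤ) : |slk W v| ≤ 2 := by
  rw [abs_of_nonneg (slk_nonneg W v)]; exact slk_le_two W v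

theorem exc_eq_zero (W : Set (ℤ × ℤ)) (v : ℤ × ℤ) (h : cnt W v = 0) : exc W v = 0 := by
  simp [exc, h]

theorem cast_cnt_eq (W : Set (ℤ × ℤ)) (v : ℤ × ℤ) : (cnt W v : ℝ) = 2 + exc W v - slk W v := by
  have h : cnt W v + (2 - cnt W v) = 2 + (cnt W v - 2) := by omega
  unfold exc slk
  have h' : (cnt W v : ℝ) + ((2 - cnt W v : ℕ) : ℝ) = 2 + ((cnt W v - 2 : ℕ) : ℝ) := by
    exact_mod_cast h
  linarith

/-- `T1` and `T2` are the blocks in which `C` meets the main diagonal and the antidiagonal. In each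
block the excess is at most the count minus one for each of the two diagonals that is met. The
counts add up to `4 * C.card`, while `T1` and `T2` exceed `C` by at least one block per diagonal of
the corresponding slope. -/
theorem sum_exc_le (C : Finset (ℤ × ℤ)) :
    ∑ v ∈ nb C, exc C v + (C.image du).card + (C.image dw).card ≤ 2 * C.card := by
  classical
  set T1 := C ∪ C.image fun x => x - (1, 1)
  set C' := C.image fun x => x - (1, 0)
  set T2 := C' ∪ C'.image fun x => x - (-1, 1)
  have hT1 : C.card + (C.image dw).card ≤ T1.card :=
    card_add_card_image_le C (1, 1) dw Prod.fst (by simp [dw]) (by simp)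
  have hC'c : C'.card = C.card := Finset.card_image_of_injective _ (sub_left_injective)
  have hC'u : (C'.image du).card = (C.image du).card := by
    have : C'.image du = (C.image du).image fun t => t - 1 := by
      rw [Finset.image_image, Finset.image_image]
      refine Finset.image_congr fun x _ => ?_
      simp only [Function.comp, du, Prod.fst_sub, Prod.snd_sub]
      ring
    rw [this, Finset.card_image_of_injective _ (sub_left_injective)]
  have hT2 : C'.card + (C'.image du).card ≤ T2.card :=
    card_add_card_image_le C' (-1, 1) du Prod.snd (by simp [du]) (by simp)
  have hcnt4 : ∑ v ∈ nb C, cnt (C : Set (ℤ × ℤ)) v = 4 * C.card := by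
    have := sum_corners_eq C fun _ => 1
    have h4 : corners.card = 4 := by decide
    simp only [Finset.sum_const, h4, nsmul_eq_mul, mul_one] at this
    have h5 : ((C.card * 4 : ℕ) : ℝ) = ((∑ v ∈ nb C, cnt (C : Set (ℤ × ℤ)) v : ℕ) : ℝ) := by
      push_cast
      exact this
    have h6 := Nat.cast_injective h5
    omega
  have hm1 : ∀ v, v ∈ T1 ↔ v ∈ C ∨ v + (1, 1) ∈ C := by
    intro v
    simp only [T1, Finset.mem_union, Finset.mem_image]
    refine or_congr Iff.rfl ⟨?_, fun h => ⟨_, h, by simp⟩⟩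
    rintro ⟨x, hx, rfl⟩
    simpa using hx
  have hm2 : ∀ v, v ∈ T2 ↔ v + (1, 0) ∈ C ∨ v + (0, 1) ∈ C := by
    intro v
    simp only [T2, C', Finset.mem_union, Finset.mem_image]
    refine or_congr ⟨?_, fun h => ⟨_, h, by simp⟩⟩ ⟨?_, fun h => ⟨_, ⟨_, h, rfl⟩, ?_⟩⟩
    · rintro ⟨x, hx, rfl⟩
      simpa using hx
    · rintro ⟨_, ⟨x, hx, rfl⟩, rfl⟩
      have : x - (1, 0) - (-1, 1) + (0, 1) = x := by ext <;> simp
      rwa [this]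
    · ext <;> simp
  have hs1 : T1 ⊆ nb C := by
    intro v hv
    rw [mem_nb]
    rcases (hm1 v).1 hv with h | h
    · exact ⟨(0, 0), by decide, by rwa [show v + (0, 0) = v from add_zero v]⟩
    · exact ⟨(1, 1), by decide, h⟩
  have hs2 : T2 ⊆ nb C := by
    intro v hv
    rw [mem_nb]
    rcases (hm2 v).1 hv with h | h
    · exact ⟨(1, 0), by decide, h⟩
    · exact ⟨(0, 1), by decide, h⟩
  have hpt : ∀ v, (cnt (C : Set (ℤ × ℤ)) v - 2) + (if v ∈ T1 then 1 else 0)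
      + (if v ∈ T2 then 1 else 0) ≤ cnt (C : Set (ℤ × ℤ)) v := by
    intro v
    simp only [cnt_eq, hm1, hm2, Finset.mem_coe]
    by_cases a : v ∈ C <;> by_cases b : v + (1, 0) ∈ C <;> by_cases c : v + (0, 1) ∈ C <;>
      by_cases d : v + (1, 1) ∈ C <;> simp [a, b, c, d]
  have hsum := Finset.sum_le_sum fun v (_ : v ∈ nb C) => hpt v
  rw [Finset.sum_add_distrib, Finset.sum_add_distrib, hcnt4, Finset.sum_ite_mem,
    Finset.sum_ite_mem, Finset.inter_eq_right.2 hs1, Finset.inter_eq_right.2 hs2,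
    Finset.sum_const, Finset.sum_const] at hsum
  simp only [smul_eq_mul, mul_one] at hsum
  have hfin : ∑ v ∈ nb C, (cnt (C : Set (ℤ × ℤ)) v - 2) + (C.image du).card + (C.image dw).card
      ≤ 2 * C.card := by omega
  unfold exc
  exact_mod_cast hfin

/-- A set of pixels in a rectangle with diagonal sides has at most half of its lattice points,
rounded up. -/
theorem two_mul_card_le {C : Finset (ℤ × ℤ)} {a b a' b' : ℤ} (hab : a ≤ b) (hab' : a' ≤ b')
    (h : ∀ p ∈ C, (a ≤ du p ∧ du p ≤ b) ∧ (a' ≤ dw p ∧ dw p ≤ b')) :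
    2 * (C.card : ℤ) ≤ (b - a + 1) * (b' - a' + 1) + 1 := by
  set m := b - a + 1 with hm
  set n := b' - a' + 1 with hn
  -- Number the `m * n` integer pairs of the rectangle row by row and halve the index. Pixels
  -- correspond to pairs with even sum, and these turn out to have distinct halves.
  have hcard : C.card ≤ (Finset.Ico (0 : ℤ) ((m * n + 1) / 2)).card := by
    refine Finset.card_le_card_of_injOn (fun p => ((du p - a) * n + (dw p - a')) / 2) ?_ ?_
    · intro p hp
      obtain ⟨⟨h1, h2⟩, h3, h4⟩ := h p hp
      simp only [Finset.coe_Ico, Set.mem_Ico]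
      have e1 : 0 ≤ (du p - a) * n := mul_nonneg (by omega) (by omega)
      have e2 : (du p - a) * n ≤ (m - 1) * n := mul_le_mul_of_nonneg_right (by omega) (by omega)
      have e3 : (m - 1) * n = m * n - n := by ring
      omega
    · intro p hp q hq hpq
      obtain ⟨⟨h1, h2⟩, h3, h4⟩ := h p hp
      obtain ⟨⟨k1, k2⟩, k3, k4⟩ := h q hq
      have par : ∀ z : ℤ × ℤ, (du z + dw z) % 2 = 0 := by
        intro z
        simp only [du, dw]
        omega
      have pp := par p
      have pq := par q
      simp only at hpq
      have fin : du p = du q → dw p = dw q → p = q := by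
        intro e1 e2
        simp only [du, dw] at e1 e2
        ext <;> omega
      generalize du p = U at *
      generalize du q = U' at *
      generalize dw p = V at *
      generalize dw q = V' at *
      -- If an even index belongs to a pixel, the next index does not. Within a row the parity of
      -- the sum changes. Passing to the next row with equal parity would need `n` even, but then
      -- the last index of a row is odd.
      have aux : ∀ A A' B B' : ℤ, a' ≤ B → B ≤ b' → a' ≤ B' → B' ≤ b' →
          (A + B) % 2 = 0 → (A' + B') % 2 = 0 →
          ((A - a) * n + (B - a')) % 2 = 0 →
          (A' - a) * n + (B' - a') ≠ (A - a) * n + (B - a') + 1 := by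
        intro A A' B B' q1 q2 q3 q4 q5 q6 q7 q8
        have hδ : (A' - A) * n = B - B' + 1 := by linear_combination q8
        have hn0 : 0 < n := by omega
        have d1 : A' - A < 2 := by
          by_contra hc
          have : 2 * n ≤ (A' - A) * n := mul_le_mul_of_nonneg_right (by omega) hn0.le
          omega
        have d2 : -1 < A' - A := by
          by_contra hc
          have : (A' - A) * n ≤ (-1) * n := mul_le_mul_of_nonneg_right (by omega) hn0.le
          omega
        rcases (by omega : A' - A = 0 ∨ A' - A = 1) with hd | hd
        · rw [hd] at hδ; omega
        · rw [hd] at hδ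
          have hne : n % 2 = 0 := by omega
          obtain ⟨t, ht⟩ : ∃ t, n = 2 * t := ⟨n / 2, by omega⟩
          have : (A - a) * n = 2 * ((A - a) * t) := by rw [ht]; ring
          omega
      have x1 := aux U U' V V' h3 h4 k3 k4 pp pq
      have x2 := aux U' U V' V k3 k4 h3 h4 pq pp
      have heq : (U - a) * n + (V - a') = (U' - a) * n + (V' - a') := by omega
      have hδ : (U' - U) * n = V - V' := by linear_combination -heq
      have hn0 : 0 < n := by omega
      have d1 : U' - U < 1 := by
        by_contra hc
        have : 1 * n ≤ (U' - U) * n := mul_le_mul_of_nonneg_right (by omega) hn0.le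
        omega
      have d2 : -1 < U' - U := by
        by_contra hc
        have : (U' - U) * n ≤ (-1) * n := mul_le_mul_of_nonneg_right (by omega) hn0.le
        omega
      have hd : U' - U = 0 := by omega
      rw [hd] at hδ
      exact fin (by omega) (by omega)
  rw [Int.card_Ico] at hcard
  have : 0 < m * n := mul_pos (by omega) (by omega)
  omega


/-! ### Density bounds for components of bounded size -/

/-- The density attainable with 8-components of `j` pixels. -/
noncomputable def f8 (j : ℕ) : ℝ := (j : ℝ) / ((j : ℝ) + (⌈2 * Real.sqrt (j : ℝ)⌉ : ℝ) + 1)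

/-- The upper bound for the density of images with 4-components of `j` pixels. -/
noncomputable def f4 (j : ℕ) : ℝ :=
  (j : ℝ) / ((j : ℝ) + (⌈2 * Real.sqrt (2 * (j : ℝ) - 1)⌉ : ℝ) / 2)

/-- Arithmetic-geometric mean; the ceiling is free because `p + q` is an integer. -/
theorem ceil_two_sqrt_le {x : ℝ} {p q : ℕ} (h : x ≤ p * q) :
    ⌈2 * Real.sqrt x⌉ ≤ (p : ℤ) + q := by
  rw [Int.ceil_le]
  push_cast
  have h1 : Real.sqrt x ≤ ((p : ℝ) + q) / 2 := by
    rw [Real.sqrt_le_left (by positivity)]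
    nlinarith [sq_nonneg ((p : ℝ) - q)]
  linarith

theorem ceil8_nonneg (j : ℕ) : (0 : ℝ) ≤ (⌈2 * Real.sqrt (j : ℝ)⌉ : ℝ) := by
  have : (0 : ℤ) ≤ ⌈2 * Real.sqrt (j : ℝ)⌉ := Int.ceil_nonneg (by positivity)
  exact_mod_cast this

theorem ceil4_nonneg (j : ℕ) : (0 : ℝ) ≤ (⌈2 * Real.sqrt (2 * (j : ℝ) - 1)⌉ : ℝ) := by
  have : (0 : ℤ) ≤ ⌈2 * Real.sqrt (2 * (j : ℝ) - 1)⌉ := Int.ceil_nonneg (by positivity)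
  exact_mod_cast this

theorem block_connected8 {v d e : ℤ × ℤ} (hd : d ∈ corners) (he : e ∈ corners) :
    v + d = v + e ∨ adj8.Adj (v + d) (v + e) := by
  have key : ∀ d ∈ corners, ∀ e ∈ corners, d = e ∨ max |d.1 - e.1| |d.2 - e.2| = 1 := by decide
  rcases key d hd e he with h | h
  · exact Or.inl (by rw [h])
  · refine Or.inr ?_
    change max |(v + d).1 - (v + e).1| |(v + d).2 - (v + e).2| = 1
    simpa using h

theorem adj4_add_iff {v d e : ℤ × ℤ} :
    adj4.Adj (v + d) (v + e) ↔ |d.1 - e.1| + |d.2 - e.2| = 1 := by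
  change |(v + d).1 - (v + e).1| + |(v + d).2 - (v + e).2| = 1 ↔ _
  simp

/-- Two opposite corners of a block have both other corners as common neighbours, and among at least
three white pixels one of those is white. -/
theorem block_connected4 {W : Set (ℤ × ℤ)} {v d e : ℤ × ℤ} (hv : exc W v ≠ 0)
    (hd : d ∈ corners) (he : e ∈ corners) :
    v + d = v + e ∨ adj4.Adj (v + d) (v + e) ∨
      ∃ f, v + f ∈ W ∧ adj4.Adj (v + d) (v + f) ∧ adj4.Adj (v + f) (v + e) := by
  classical
  simp only [adj4_add_iff]
  have key : ∀ d ∈ corners, ∀ e ∈ corners, d = e ∨ |d.1 - e.1| + |d.2 - e.2| = 1 ∨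
      (∀ f ∈ corners, f ≠ d → f ≠ e →
        |d.1 - f.1| + |d.2 - f.2| = 1 ∧ |f.1 - e.1| + |f.2 - e.2| = 1) := by decide
  rcases key d hd e he with h | h | h
  · exact Or.inl (by rw [h])
  · exact Or.inr (Or.inl h)
  · refine Or.inr (Or.inr ?_)
    have h3 : 2 < cnt W v := by
      by_contra hc
      exact hv (by simp [exc, Nat.sub_eq_zero_of_le (not_lt.1 hc)])
    unfold cnt at h3
    obtain ⟨f, hf, hf'⟩ : ∃ f ∈ corners.filter (fun d => v + d ∈ W), f ∉ ({d, e} : Finset _) := by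
      by_contra hcon
      push Not at hcon
      have := Finset.card_le_card (show corners.filter (fun d => v + d ∈ W) ⊆ {d, e} from hcon)
      have := (Finset.card_le_two (a := d) (b := e))
      omega
    simp only [Finset.mem_filter] at hf
    simp only [Finset.mem_insert, Finset.mem_singleton, not_or] at hf'
    exact ⟨f, hf.2, h f hf.1 hf'.1 hf'.2⟩

/-- Each component has at most `ρ` times as many pixels as blocks that it meets. No block meets two
components, and there is one block per pixel on average. -/
theorem density_le_of_comps8 {W : Set (ℤ × ℤ)} {k : ℕ} (K : Comps adj8 W k) {ρ : ℝ}
    (h0 : 0 ≤ ρ) (hρ : ∀ j, 1 ≤ j → j ≤ k → f8 j ≤ ρ) : density W ≤ ρ := by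
  classical
  apply density_le
  set F : ℤ × ℤ → ℝ := fun v => if cnt W v = 0 then 0 else 1
  have hF1 : ∀ v, |F v| ≤ 1 := fun v => by simp only [F]; split_ifs <;> simp
  have hF0 : ∀ v, cnt W v = 0 → F v = 0 := fun v h => by simp [F, h]
  have hcomp : AvgNonpos fun x => ind W x - ρ * push W F x := by
    refine K.avgNonpos adj8_close (B := 1 + ρ * 4) ?_ ?_ ?_
    · intro x
      have h1 := ind_le_one W x
      have h2 := neg_le_of_abs_le (abs_push_le W hF1 x)
      nlinarith
    · intro x hx
      simp [push, ind_of_notMem hx]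
    · intro x hx
      have hpush := sum_push W F (K.comp x) (fun y hy => K.subset hy) (by
        intro v _ d hd hvd e he hve
        rcases block_connected8 (v := v) hd he with h | h
        · rwa [← h]
        · exact K.adj_mem hvd hve h)
      have hone : ∑ v ∈ nb (K.comp x), F v = (nb (K.comp x)).card := by
        rw [Finset.sum_congr rfl (g := fun _ => (1 : ℝ)) ?_]
        · simp
        · intro v hv
          obtain ⟨d, hd, hvd⟩ := mem_nb.1 hv
          have : 0 < cnt W v := Finset.card_pos.2 ⟨d, Finset.mem_filter.2 ⟨hd, K.subset hvd⟩⟩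
          simp [F, this.ne']
      have hind : ∑ y ∈ K.comp x, ind W y = (K.comp x).card := by
        rw [Finset.sum_congr rfl (g := fun _ => (1 : ℝ)) fun y hy => ind_of_mem (K.subset hy)]
        simp
      rw [Finset.sum_sub_distrib, ← Finset.mul_sum, hpush, hone, hind]
      obtain ⟨r, c, hrc, hnb⟩ := card_nb_ge ⟨x, K.mem_self hx⟩
      have hpos := K.pos_of_mem hx
      have hf := hρ _ hpos (K.card_le x)
      have hceil : ⌈2 * Real.sqrt ((K.comp x).card : ℝ)⌉ ≤ (r : ℤ) + c :=
        ceil_two_sqrt_le (by exact_mod_cast hrc)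
      have hceil' : (⌈2 * Real.sqrt ((K.comp x).card : ℝ)⌉ : ℝ) ≤ (r : ℝ) + c := by
        exact_mod_cast hceil
      have hnb' : ((K.comp x).card : ℝ) + r + c + 1 ≤ (nb (K.comp x)).card := by
        exact_mod_cast hnb
      have hc0 := ceil8_nonneg (K.comp x).card
      rw [f8, div_le_iff₀ (by positivity)] at hf
      have : ρ * ((K.comp x).card + (⌈2 * Real.sqrt ((K.comp x).card : ℝ)⌉ : ℝ) + 1) ≤
          ρ * (nb (K.comp x)).card := mul_le_mul_of_nonneg_left (by linarith) h0
      linarith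
  refine (hcomp.add ((avgNonpos_push_sub W hF1 hF0).const_mul h0)).mono fun x => ?_
  have : ρ * F x ≤ ρ * 1 := mul_le_mul_of_nonneg_left ((le_abs_self _).trans (hF1 x)) h0
  linarith

/-- Counting pixels by blocks. -/
theorem avgNonpos_block (W : Set (ℤ × ℤ)) :
    AvgNonpos fun x => 4 * ind W x - 2 - exc W x + slk W x := by
  refine (AvgNonpos.sum corners fun d _ => avgNonpos_sub_shift (abs_ind_le W) d).mono fun x => ?_
  have h4 : corners.card = 4 := by decide
  rw [Finset.sum_sub_distrib, ← cast_cnt, cast_cnt_eq, Finset.sum_const, h4, nsmul_eq_mul]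
  push_cast
  linarith

theorem avgNonpos_exc_sub_push (W : Set (ℤ × ℤ)) :
    AvgNonpos fun x => exc W x - push W (exc W) x :=
  avgNonpos_sub_push W (abs_exc_le W) (exc_eq_zero W)

/-- On a block that has an excess, all white pixels are in the same component. -/
theorem Comps.block_mem {W : Set (ℤ × ℤ)} {k : ℕ} (K : Comps adj4 W k) {x v d e : ℤ × ℤ}
    (hv : exc W v ≠ 0) (hd : d ∈ corners) (hvd : v + d ∈ K.comp x) (he : e ∈ corners)
    (hve : v + e ∈ W) : v + e ∈ K.comp x := by
  rcases block_connected4 hv hd he with h | h | ⟨f, hf, h1, h2⟩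
  · rwa [← h]
  · exact K.adj_mem hvd hve h
  · exact K.adj_mem (K.adj_mem hvd hf h1) hve h2

theorem Comps.exc_le {W : Set (ℤ × ℤ)} {k : ℕ} (K : Comps adj4 W k) {x v : ℤ × ℤ}
    (hv : v ∈ nb (K.comp x)) : exc W v ≤ exc (K.comp x) v := by
  classical
  by_cases h0 : exc W v = 0
  · rw [h0]; exact exc_nonneg _ _
  obtain ⟨d, hd, hvd⟩ := mem_nb.1 hv
  have : cnt W v ≤ cnt (K.comp x : Set (ℤ × ℤ)) v := by
    unfold cnt
    refine Finset.card_le_card fun e he => ?_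
    simp only [Finset.mem_filter, Finset.mem_coe] at he ⊢
    exact ⟨he.1, K.block_mem h0 hd hvd he.1 he.2⟩
  unfold exc
  exact_mod_cast Nat.sub_le_sub_right this 2

theorem du_adj (a b : ℤ × ℤ) (h : adj4.Adj a b) : |du a - du b| ≤ 1 := by
  have h : |a.1 - b.1| + |a.2 - b.2| = 1 := h
  have := abs_add_le (a.1 - b.1) (a.2 - b.2)
  rw [show du a - du b = (a.1 - b.1) + (a.2 - b.2) by simp only [du]; ring]
  omega

theorem dw_adj (a b : ℤ × ℤ) (h : adj4.Adj a b) : |dw a - dw b| ≤ 1 := by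
  have h : |a.1 - b.1| + |a.2 - b.2| = 1 := h
  have := abs_sub (a.1 - b.1) (a.2 - b.2)
  rw [show dw a - dw b = (a.1 - b.1) - (a.2 - b.2) by simp only [dw]; ring]
  omega

/-- The excess of a component in terms of its smallest diagonal bounding rectangle. -/
theorem Comps.exists_rect {W : Set (ℤ × ℤ)} {k : ℕ} (K : Comps adj4 W k) {x : ℤ × ℤ} (hx : x ∈ W) :
    ∃ (a a' : ℤ) (m n : ℕ), 1 ≤ m ∧ 1 ≤ n ∧
      (∀ p ∈ K.comp x, (a ≤ du p ∧ du p < a + m) ∧ (a' ≤ dw p ∧ dw p < a' + n)) ∧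
      2 * (K.comp x).card ≤ m * n + 1 ∧
      ∑ v ∈ nb (K.comp x), exc W v + m + n ≤ 2 * (K.comp x).card := by
  obtain ⟨a, b, hab, h1⟩ := K.image_eq_Icc hx du du_adj
  obtain ⟨a', b', hab', h2⟩ := K.image_eq_Icc hx dw dw_adj
  have hmem : ∀ p ∈ K.comp x, (a ≤ du p ∧ du p ≤ b) ∧ (a' ≤ dw p ∧ dw p ≤ b') := by
    intro p hp
    have e1 : du p ∈ Finset.Icc a b := h1 ▸ Finset.mem_image_of_mem _ hp
    have e2 : dw p ∈ Finset.Icc a' b' := h2 ▸ Finset.mem_image_of_mem _ hp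
    exact ⟨Finset.mem_Icc.1 e1, Finset.mem_Icc.1 e2⟩
  refine ⟨a, a', (b - a + 1).toNat, (b' - a' + 1).toNat, by omega, by omega, ?_, ?_, ?_⟩
  · intro p hp
    have := hmem p hp
    omega
  · have := two_mul_card_le hab hab' hmem
    zify
    rw [Int.toNat_of_nonneg (by omega), Int.toNat_of_nonneg (by omega)]
    exact this
  · have h3 := sum_exc_le (K.comp x)
    rw [h1, h2, Int.card_Icc, Int.card_Icc] at h3
    have h4 := Finset.sum_le_sum fun v (hv : v ∈ nb (K.comp x)) => K.exc_le hv
    rw [show b - a + 1 = b + 1 - a by ring, show b' - a' + 1 = b' + 1 - a' by ring]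
    linarith

theorem Comps.sum_push_exc {W : Set (ℤ × ℤ)} {k : ℕ} (K : Comps adj4 W k) (x : ℤ × ℤ)
    {F : ℤ × ℤ → ℝ} (hF : ∀ v, F v ≠ 0 → exc W v ≠ 0) :
    ∑ y ∈ K.comp x, push W F y = ∑ v ∈ nb (K.comp x), F v :=
  sum_push W _ _ (fun _ hy => K.subset hy)
    fun v hv _ hd hvd _ he hve => K.block_mem (hF v hv) hd hvd he hve

theorem Comps.sum_ind {G : SimpleGraph (ℤ × ℤ)} {W : Set (ℤ × ℤ)} {k : ℕ} (K : Comps G W k)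
    (x : ℤ × ℤ) : ∑ y ∈ K.comp x, ind W y = (K.comp x).card := by
  rw [Finset.sum_congr rfl (g := fun _ => (1 : ℝ)) fun y hy => ind_of_mem (K.subset hy)]
  simp

theorem density_le_of_comps4 {W : Set (ℤ × ℤ)} {k : ℕ} (K : Comps adj4 W k) {ρ : ℝ}
    (h0 : 0 < ρ) (hρ : ∀ j, 1 ≤ j → j ≤ k → f4 j ≤ ρ) : density W ≤ ρ := by
  apply density_le
  -- The bound `f4 j ≤ ρ` gives `2 * j / ρ ≤ 2 * j + m + n`, so the excess of a component is at most
  -- `(4 - 2 / ρ) * j`. Inserted into `4 * ind ≤ 2 + exc` on average, this leaves the density at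
  -- most `ρ`.
  have hcomp : AvgNonpos fun x => push W (exc W) x - (4 - 2 / ρ) * ind W x := by
    refine K.avgNonpos adj4_close (B := 4 * 2 + |4 - 2 / ρ|) ?_ ?_ ?_
    · intro x
      have h1 := (le_abs_self _).trans (abs_push_le W (abs_exc_le W) x)
      have h2 : |(4 - 2 / ρ) * ind W x| ≤ |4 - 2 / ρ| := by
        rw [abs_mul]
        exact mul_le_of_le_one_right (abs_nonneg _) (abs_ind_le W x)
      have h3 := neg_le_of_abs_le h2
      linarith
    · intro x hx
      simp [push, ind_of_notMem hx]
    · intro x hx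
      obtain ⟨a, a', m, n, hm, hn, -, hmn, hexc⟩ := K.exists_rect hx
      rw [Finset.sum_sub_distrib, ← Finset.mul_sum, K.sum_push_exc x fun _ h => h, K.sum_ind]
      set j := (K.comp x).card
      have hpos : 1 ≤ j := K.pos_of_mem hx
      have hf := hρ j hpos (K.card_le x)
      have hceil : (⌈2 * Real.sqrt (2 * (j : ℝ) - 1)⌉ : ℝ) ≤ (m : ℝ) + n := by
        have : 2 * (j : ℝ) - 1 ≤ m * n := by
          have : 2 * (j : ℝ) ≤ m * n + 1 := by exact_mod_cast hmn
          linarith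
        exact_mod_cast ceil_two_sqrt_le this
      have hj : (0 : ℝ) < j := by exact_mod_cast hpos
      have hc0 := ceil4_nonneg j
      rw [f4, div_le_iff₀ (by positivity)] at hf
      have h5 : 2 / ρ * j ≤ 2 * j + (m + n) := by
        rw [div_mul_eq_mul_div, div_le_iff₀ h0]
        have : ρ * (j + (⌈2 * Real.sqrt (2 * (j : ℝ) - 1)⌉ : ℝ) / 2) ≤ ρ * (j + (m + n) / 2) :=
          mul_le_mul_of_nonneg_left (by linarith) h0.le
        linarith
      linarith
  refine ((((avgNonpos_block W).add (avgNonpos_exc_sub_push W)).add hcomp).const_mul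
    (by positivity : 0 ≤ ρ / 2)).mono fun x => ?_
  have h1 : ρ / 2 * (2 / ρ) = 1 := by field_simp
  have h2 := mul_nonneg (by positivity : 0 ≤ ρ / 2) (slk_nonneg W x)
  have h3 : ρ / 2 * (2 / ρ) * ind W x = ind W x := by rw [h1, one_mul]
  linarith


/-! ### Local structure of images with small 4-components -/

theorem add_mk_zero (v : ℤ × ℤ) : v + (0, 0) = v := add_zero v

/-- A list of pixels in which each pixel is 4-adjacent to a later one, and no pixel is repeated. -/
def IsChain4 : List (ℤ × ℤ) → Prop
  | [] => True
  | d :: t => (t = [] ∨ ∃ e ∈ t, |d.1 - e.1| + |d.2 - e.2| = 1) ∧ d ∉ t ∧ IsChain4 t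

instance decidableIsChain4 : (l : List (ℤ × ℤ)) → Decidable (IsChain4 l)
  | [] => isTrue trivial
  | d :: t =>
    have := decidableIsChain4 t
    inferInstanceAs (Decidable ((t = [] ∨ ∃ e ∈ t, |d.1 - e.1| + |d.2 - e.2| = 1) ∧ d ∉ t ∧ _))

theorem IsChain4.nodup : ∀ {l : List (ℤ × ℤ)}, IsChain4 l → l.Nodup
  | [], _ => List.nodup_nil
  | _ :: _, h => List.nodup_cons.2 ⟨h.2.1, h.2.2.nodup⟩

theorem Comps.exists_of_chain {W : Set (ℤ × ℤ)} {k : ℕ} (K : Comps adj4 W k) (p : ℤ × ℤ) :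
    ∀ l : List (ℤ × ℤ), IsChain4 l → (∀ d ∈ l, p + d ∈ W) → ∃ x, ∀ d ∈ l, p + d ∈ K.comp x
  | [], _, _ => ⟨p, by simp⟩
  | d :: t, h, hW => by
    obtain ⟨x, hx⟩ := K.exists_of_chain p t h.2.2 fun e he => hW e (List.mem_cons_of_mem _ he)
    have hd : p + d ∈ W := hW d List.mem_cons_self
    rcases h.1 with rfl | ⟨e, he, hde⟩
    · exact ⟨p + d, by simpa using K.mem_self hd⟩
    · refine ⟨x, fun z hz => ?_⟩
      rcases List.mem_cons.1 hz with rfl | hz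
      · exact K.adj_mem (hx e he) hd (adj4_add_iff.2 hde).symm
      · exact hx z hz

/-- Used to force pixels to be black: a pixel that would extend a white pattern to a connected one
of `k + 1` pixels cannot be white. The pattern itself is checked by `decide`. -/
theorem Comps.length_le {W : Set (ℤ × ℤ)} {k : ℕ} (K : Comps adj4 W k) (p : ℤ × ℤ)
    (l : List (ℤ × ℤ)) (hl : IsChain4 l) (hW : ∀ d ∈ l, p + d ∈ W) : l.length ≤ k := by
  classical
  obtain ⟨x, hx⟩ := K.exists_of_chain p l hl hW
  rw [← List.toFinset_card_of_nodup hl.nodup,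
    ← Finset.card_image_of_injective _ (add_right_injective p)]
  refine (Finset.card_le_card fun y hy => ?_).trans (K.card_le x)
  obtain ⟨d, hd, rfl⟩ := Finset.mem_image.1 hy
  exact hx d (List.mem_toFinset.1 hd)

theorem mem_of_slk_lt {W : Set (ℤ × ℤ)} {p c d e f : ℤ × ℤ} (h : slk W (p + c) < 1)
    (hd : p + d ∉ W) (he : p + e ∉ W)
    (hc : d - c ∈ corners ∧ e - c ∈ corners ∧ f - c ∈ corners ∧ d ≠ e ∧ f ≠ d ∧ f ≠ e) :
    p + f ∈ W := by
  classical
  obtain ⟨h1, h2, h3, h4, h5, h6⟩ := hc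
  by_contra hf
  have hcnt : 2 ≤ cnt W (p + c) := by
    by_contra hcon
    have : 1 ≤ 2 - cnt W (p + c) := by omega
    have : (1 : ℝ) ≤ slk W (p + c) := by unfold slk; exact_mod_cast this
    linarith
  have hsub : corners.filter (fun z => p + c + z ∈ W) ⊆
      ((corners.erase (d - c)).erase (e - c)).erase (f - c) := by
    intro z hz
    simp only [Finset.mem_filter] at hz
    simp only [Finset.mem_erase]
    refine ⟨?_, ?_, ?_, hz.1⟩
    · rintro rfl
      exact hf (by simpa using hz.2)
    · rintro rfl
      exact he (by simpa using hz.2)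
    · rintro rfl
      exact hd (by simpa using hz.2)
  have hle := Finset.card_le_card hsub
  have h4' : corners.card = 4 := by decide
  rw [Finset.card_erase_of_mem, Finset.card_erase_of_mem, Finset.card_erase_of_mem h1, h4'] at hle
  · unfold cnt at hcnt
    omega
  · simp only [Finset.mem_erase]
    exact ⟨fun h => h4 (sub_left_injective h).symm, h2⟩
  · simp only [Finset.mem_erase]
    exact ⟨fun h => h6 (sub_left_injective h), fun h => h5 (sub_left_injective h), h3⟩

/-! ### Single pixels, L-trominoes and the bound 13/24. -/

open Classical in
/-- Indicator of a proposition. -/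
noncomputable def pind (P : Prop) : ℝ := if P then 1 else 0

theorem pind_nonneg (P : Prop) : 0 ≤ pind P := by unfold pind; split_ifs <;> norm_num

theorem pind_le_one (P : Prop) : pind P ≤ 1 := by unfold pind; split_ifs <;> norm_num

theorem abs_pind_le (P : Prop) : |pind P| ≤ 1 := by
  rw [abs_of_nonneg (pind_nonneg P)]; exact pind_le_one P

theorem pind_of {P : Prop} (h : P) : pind P = 1 := if_pos h

theorem pind_of_not {P : Prop} (h : ¬ P) : pind P = 0 := if_neg h

/-- The pixel `p` is a component of `W`. -/
def IsSing (W : Set (ℤ × ℤ)) (p : ℤ × ℤ) : Prop :=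
  p ∈ W ∧ p + (1, 0) ∉ W ∧ p + (-1, 0) ∉ W ∧ p + (0, 1) ∉ W ∧ p + (0, -1) ∉ W

/-- Indicator of the components of size one. -/
noncomputable def sing (W : Set (ℤ × ℤ)) (p : ℤ × ℤ) : ℝ := pind (IsSing W p)

theorem adj4_iff_exists {a b : ℤ × ℤ} : adj4.Adj a b ↔
    b = a + (1, 0) ∨ b = a + (-1, 0) ∨ b = a + (0, 1) ∨ b = a + (0, -1) := by
  change |a.1 - b.1| + |a.2 - b.2| = 1 ↔ _
  simp only [Prod.ext_iff, Prod.fst_add, Prod.snd_add]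
  constructor
  · intro h
    rcases abs_cases (a.1 - b.1) with h1 | h1 <;> rcases abs_cases (a.2 - b.2) with h2 | h2 <;>
      omega
  · rintro (h | h | h | h) <;> rw [h.1, h.2] <;> simp

theorem Comps.comp_of_isSing {W : Set (ℤ × ℤ)} {k : ℕ} (K : Comps adj4 W k) {p : ℤ × ℤ}
    (h : IsSing W p) : K.comp p = {p} := by
  obtain ⟨h0, h1, h2, h3, h4⟩ := h
  refine Finset.Subset.antisymm (fun y hy => ?_) (by simpa using K.mem_self h0)
  rw [Finset.mem_singleton]
  refine K.induct (fun z => z = p) rfl ?_ y hy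
  rintro a - b hb hab rfl
  exfalso
  have hbW := K.subset hb
  rcases adj4_iff_exists.1 hab with rfl | rfl | rfl | rfl
  exacts [h1 hbW, h2 hbW, h3 hbW, h4 hbW]

theorem Comps.sum_sing_le {W : Set (ℤ × ℤ)} {k : ℕ} (K : Comps adj4 W k) {x : ℤ × ℤ} :
    ∑ y ∈ K.comp x, sing W y ≤ if (K.comp x).card = 1 then 1 else 0 := by
  split_ifs with h
  · calc _ ≤ (K.comp x).card • (1 : ℝ) :=
        Finset.sum_le_card_nsmul _ _ _ fun y _ => pind_le_one _
      _ = 1 := by rw [h]; simp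
  · refine Finset.sum_nonpos fun y hy => le_of_eq (pind_of_not fun hs => h ?_)
    rw [← K.comp_eq hy, K.comp_of_isSing hs, Finset.card_singleton]

/-- The four diagonal directions. -/
def signs : Finset (ℤ × ℤ) := {1, -1} ×ˢ {1, -1}

theorem mem_signs {s : ℤ × ℤ} (h : s ∈ signs) :
    s = (1, 1) ∨ s = (1, -1) ∨ s = (-1, 1) ∨ s = (-1, -1) := by
  revert s
  decide

theorem sum_signs (f : ℤ × ℤ → ℝ) :
    ∑ s ∈ signs, f s = f (1, 1) + f (1, -1) + f (-1, 1) + f (-1, -1) := by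
  have : signs = {(1, 1), (1, -1), (-1, 1), (-1, -1)} := by decide
  rw [this, Finset.sum_insert (by decide), Finset.sum_insert (by decide),
    Finset.sum_insert (by decide), Finset.sum_singleton]
  ring

/-- Coordinate of the lower end of the segment joining `0` to `t = ±1`. -/
def lo (t : ℤ) : ℤ := if t = 1 then 0 else -1

/-- The pixel `p` and its neighbours in the horizontal and vertical directions given by `s` are
white. -/
def IsL (W : Set (ℤ × ℤ)) (s p : ℤ × ℤ) : Prop :=
  p + (0, 0) ∈ W ∧ p + (s.1, 0) ∈ W ∧ p + (0, s.2) ∈ W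

/-- A full block would give four connected pixels, so the excess is at most one. If it is one, the
three white pixels form an L whose bend is the corner from which `s` points into the block. -/
theorem exc_le_sum_isL {W : Set (ℤ × ℤ)} (K : Comps adj4 W 3) (v : ℤ × ℤ) :
    exc W v ≤ ∑ s ∈ signs, pind (IsL W s (v + (-lo s.1, -lo s.2))) := by
  classical
  rw [sum_signs]
  by_cases h0 : exc W v = 0
  · rw [h0]
    have := fun s => pind_nonneg (IsL W s (v + (-lo s.1, -lo s.2)))
    linarith [this (1, 1), this (1, -1), this (-1, 1), this (-1, -1)]
  have h4 : ¬ (v ∈ W ∧ v + (1, 0) ∈ W ∧ v + (0, 1) ∈ W ∧ v + (1, 1) ∈ W) := by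
    rintro ⟨a, b, c, d⟩
    have := K.length_le v [(0, 1), (0, 0), (1, 0), (1, 1)] (by decide) (by
      simp [a, b, c, d, add_mk_zero])
    simp at this
  have hv : 2 < cnt W v := by
    by_contra hc
    exact h0 (by simp [exc, Nat.sub_eq_zero_of_le (not_lt.1 hc)])
  rw [cnt_eq] at hv
  unfold exc
  rw [cnt_eq]
  simp only [pind, IsL, lo, add_assoc, Prod.mk_add_mk]
  by_cases a : v ∈ W <;> by_cases b : v + (1, 0) ∈ W <;> by_cases c : v + (0, 1) ∈ W <;>
      by_cases d : v + (1, 1) ∈ W <;> simp [a, b, c, d, add_mk_zero] at hv h4 ⊢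

/-- The L is a whole component, so its neighbours are black. If the three blocks behind the bend
have no slack, then `p - s` is white, and so are two vertical pixels and two horizontal pixels near
it. Joining `p - s` to either pair would give four connected pixels, hence `p - s` is isolated. -/
theorem one_le_of_isL {W : Set (ℤ × ℤ)} (K : Comps adj4 W 3) {s p : ℤ × ℤ} (hs : s ∈ signs)
    (h : IsL W s p) :
    1 ≤ sing W (p + (-s.1, -s.2)) + slk W (p + (lo (-s.1), lo (-s.2)))
      + slk W (p + (-s.1 + lo (-s.1), lo s.2)) + slk W (p + (lo s.1, -s.2 + lo (-s.2))) := by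
  by_contra hcon
  have n1 := slk_nonneg W (p + (lo (-s.1), lo (-s.2)))
  have n2 := slk_nonneg W (p + (-s.1 + lo (-s.1), lo s.2))
  have n3 := slk_nonneg W (p + (lo s.1, -s.2 + lo (-s.2)))
  have n4 := pind_nonneg (IsSing W (p + (-s.1, -s.2)))
  have n5 : sing W (p + (-s.1, -s.2)) = pind (IsSing W (p + (-s.1, -s.2))) := rfl
  have l1 : slk W (p + (lo (-s.1), lo (-s.2))) < 1 := by linarith
  have l2 : slk W (p + (-s.1 + lo (-s.1), lo s.2)) < 1 := by linarith
  have l3 : slk W (p + (lo s.1, -s.2 + lo (-s.2))) < 1 := by linarith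
  obtain ⟨h1, h2, h3⟩ := h
  have hb : ∀ d, IsChain4 [d, (s.1, 0), (0, 0), (0, s.2)] → p + d ∉ W := by
    intro d hd hdW
    have := K.length_le p _ hd (by
      intro e he
      simp only [List.mem_cons, List.not_mem_nil, or_false] at he
      rcases he with rfl | rfl | rfl | rfl <;> assumption)
    simp at this
  have b1 : p + (-s.1, 0) ∉ W := hb _ (by clear * - hs; revert s; decide)
  have b2 : p + (-s.1, s.2) ∉ W := hb _ (by clear * - hs; revert s; decide)
  have b3 : p + (0, -s.2) ∉ W := hb _ (by clear * - hs; revert s; decide)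
  have b4 : p + (s.1, -s.2) ∉ W := hb _ (by clear * - hs; revert s; decide)
  have w1 : p + (-s.1, -s.2) ∈ W := mem_of_slk_lt l1 b1 b3 (by clear * - hs; revert s; decide)
  have w2 : p + (-2 * s.1, 0) ∈ W := mem_of_slk_lt l2 b1 b2 (by clear * - hs; revert s; decide)
  have w3 : p + (-2 * s.1, s.2) ∈ W := mem_of_slk_lt l2 b1 b2 (by clear * - hs; revert s; decide)
  have w4 : p + (0, -2 * s.2) ∈ W := mem_of_slk_lt l3 b3 b4 (by clear * - hs; revert s; decide)
  have w5 : p + (s.1, -2 * s.2) ∈ W := mem_of_slk_lt l3 b3 b4 (by clear * - hs; revert s; decide)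
  have b5 : p + (-2 * s.1, -s.2) ∉ W := by
    intro hW
    have := K.length_le p [(-s.1, -s.2), (-2 * s.1, -s.2), (-2 * s.1, 0), (-2 * s.1, s.2)]
      (by clear * - hs; revert s; decide) (by
      intro e he
      simp only [List.mem_cons, List.not_mem_nil, or_false] at he
      rcases he with rfl | rfl | rfl | rfl <;> assumption)
    simp at this
  have b6 : p + (-s.1, -2 * s.2) ∉ W := by
    intro hW
    have := K.length_le p [(-s.1, -s.2), (-s.1, -2 * s.2), (0, -2 * s.2), (s.1, -2 * s.2)]
      (by clear * - hs; revert s; decide) (by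
      intro e he
      simp only [List.mem_cons, List.not_mem_nil, or_false] at he
      rcases he with rfl | rfl | rfl | rfl <;> assumption)
    simp at this
  have hsing : IsSing W (p + (-s.1, -s.2)) := by
    unfold IsSing
    simp only [add_assoc, Prod.mk_add_mk]
    rcases mem_signs hs with rfl | rfl | rfl | rfl <;> norm_num at * <;> tauto
  rw [n5, pind_of hsing] at hcon
  linarith

/-- Each L charges a single pixel or one of three blocks. Over the four orientations, a single pixel
is charged at most 4 times and a unit of slack at most 12 times. Per component, three times the
excess plus the number of single pixels is at most the size. -/
theorem density_le_of_comps_three {W : Set (ℤ × ℤ)} (K : Comps adj4 W 3) :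
    density W ≤ 13 / 24 := by
  apply density_le
  have hsing : ∀ x, |sing W x| ≤ 1 := fun x => abs_pind_le _
  have hcharge : AvgNonpos fun x => exc W x - 4 * sing W x - 12 * slk W x := by
    have hs : ∀ s ∈ signs, AvgNonpos fun x =>
        (pind (IsL W s (x + (-lo s.1, -lo s.2))) - pind (IsL W s x))
        + (sing W (x + (-s.1, -s.2)) - sing W x)
        + (slk W (x + (lo (-s.1), lo (-s.2))) - slk W x)
        + (slk W (x + (-s.1 + lo (-s.1), lo s.2)) - slk W x)
        + (slk W (x + (lo s.1, -s.2 + lo (-s.2))) - slk W x) := fun s _ =>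
      ((((avgNonpos_shift (f := fun x => pind (IsL W s x)) (fun x => abs_pind_le _) _).add
        (avgNonpos_shift hsing _)).add (avgNonpos_shift (abs_slk_le W) _)).add
        (avgNonpos_shift (abs_slk_le W) _)).add (avgNonpos_shift (abs_slk_le W) _)
    refine (AvgNonpos.sum signs hs).mono fun x => ?_
    have hpt : ∀ s ∈ signs, pind (IsL W s (x + (-lo s.1, -lo s.2))) - sing W x - 3 * slk W x ≤
        (pind (IsL W s (x + (-lo s.1, -lo s.2))) - pind (IsL W s x))
        + (sing W (x + (-s.1, -s.2)) - sing W x)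
        + (slk W (x + (lo (-s.1), lo (-s.2))) - slk W x)
        + (slk W (x + (-s.1 + lo (-s.1), lo s.2)) - slk W x)
        + (slk W (x + (lo s.1, -s.2 + lo (-s.2))) - slk W x) := by
      intro s hs
      have : pind (IsL W s x) ≤ sing W (x + (-s.1, -s.2)) + slk W (x + (lo (-s.1), lo (-s.2)))
          + slk W (x + (-s.1 + lo (-s.1), lo s.2)) + slk W (x + (lo s.1, -s.2 + lo (-s.2))) := by
        by_cases h : IsL W s x
        · rw [pind_of h]; exact one_le_of_isL K hs h
        · rw [pind_of_not h]
          have n4 : 0 ≤ sing W (x + (-s.1, -s.2)) := pind_nonneg _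
          linarith [slk_nonneg W (x + (lo (-s.1), lo (-s.2))),
            slk_nonneg W (x + (-s.1 + lo (-s.1), lo s.2)),
            slk_nonneg W (x + (lo s.1, -s.2 + lo (-s.2)))]
      linarith
    refine le_trans ?_ (Finset.sum_le_sum hpt)
    have h1 := exc_le_sum_isL K x
    have h2 : signs.card = 4 := by decide
    rw [Finset.sum_sub_distrib, Finset.sum_sub_distrib, Finset.sum_const, Finset.sum_const, h2]
    simp only [nsmul_eq_mul]
    push_cast
    linarith
  have hcomp : AvgNonpos fun x => 3 * push W (exc W) x + sing W x - ind W x := by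
    refine K.avgNonpos adj4_close (B := 3 * (4 * 2) + 1) ?_ ?_ ?_
    · intro x
      have h1 := (le_abs_self _).trans (abs_push_le W (abs_exc_le W) x)
      have h2 := pind_le_one (IsSing W x)
      have h3 := ind_nonneg W x
      change 3 * push W (exc W) x + pind (IsSing W x) - ind W x ≤ _
      linarith
    · intro x hx
      have : sing W x = 0 := pind_of_not fun h => hx h.1
      simp [push, ind_of_notMem hx, this]
    · intro x hx
      obtain ⟨a, a', m, n, hm, hn, -, hmn, hexc⟩ := K.exists_rect hx
      rw [Finset.sum_sub_distrib, Finset.sum_add_distrib, ← Finset.mul_sum,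
        K.sum_push_exc x fun _ h => h, K.sum_ind]
      have hsing := K.sum_sing_le (x := x)
      have hj3 := K.card_le x
      have hj1 : 1 ≤ (K.comp x).card := K.pos_of_mem hx
      generalize (K.comp x).card = j at *
      interval_cases j
      · have : (2 : ℝ) ≤ m + n := by exact_mod_cast (by omega : 2 ≤ m + n)
        norm_num at *
        linarith
      · have : (4 : ℝ) ≤ m + n := by
          exact_mod_cast (by nlinarith [sq_nonneg ((m : ℤ) - n)] : 4 ≤ m + n)
        norm_num at *
        linarith
      · have : (5 : ℝ) ≤ m + n := by
          have : 5 ≤ m + n := by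
            by_contra hc
            have h1 : m ≤ 3 := by omega
            have h2 : n ≤ 3 := by omega
            interval_cases m <;> interval_cases n <;> omega
          exact_mod_cast this
        norm_num at *
        linarith
  -- The weights 13, 12, 1, 4 (over 48) make the terms in `exc`, `push` and `sing` cancel. What is
  -- left is `ind - 13/24` plus a nonnegative multiple of the slack.
  refine (((((avgNonpos_block W).const_mul (c := 13 / 48) (by norm_num)).add
    ((avgNonpos_exc_sub_push W).const_mul (c := 12 / 48) (by norm_num))).add
    (hcharge.const_mul (c := 1 / 48) (by norm_num))).add
    (hcomp.const_mul (c := 4 / 48) (by norm_num))).mono fun x => ?_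
  have := slk_nonneg W x
  linarith


/-! ### Images whose 4-components have at most six pixels -/

/-- The plus centred at `c` together with the diagonal neighbour `c + s` is white. -/
def IsQ (W : Set (ℤ × ℤ)) (s c : ℤ × ℤ) : Prop :=
  c + (0, 0) ∈ W ∧ c + (1, 0) ∈ W ∧ c + (-1, 0) ∈ W ∧ c + (0, 1) ∈ W ∧ c + (0, -1) ∈ W ∧
    c + (s.1, s.2) ∈ W

/-- The block `v` contains the bend of a white hook with foot `o` and a vertical shaft of three
pixels; here `o = v + (-lo s.1, -lo (-s.2))`. -/
def IsHookV (W : Set (ℤ × ℤ)) (s v : ℤ × ℤ) : Prop :=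
  v + (-lo s.1, -lo (-s.2)) ∈ W ∧ v + (-lo s.1 + s.1, -lo (-s.2)) ∈ W ∧
    v + (-lo s.1 + s.1, -lo (-s.2) - s.2) ∈ W ∧ v + (-lo s.1 + s.1, -lo (-s.2) - 2 * s.2) ∈ W ∧
    v + (-lo s.1, -lo (-s.2) - s.2) ∉ W ∧ v + (-lo s.1 - s.1, -lo (-s.2)) ∉ W

/-- The block `v` contains the bend of a white hook with foot `o` and a horizontal shaft of three
pixels; here `o = v + (-lo (-s.1), -lo s.2)`. -/
def IsHookH (W : Set (ℤ × ℤ)) (s v : ℤ × ℤ) : Prop :=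
  v + (-lo (-s.1), -lo s.2) ∈ W ∧ v + (-lo (-s.1), -lo s.2 + s.2) ∈ W ∧
    v + (-lo (-s.1) - s.1, -lo s.2 + s.2) ∈ W ∧ v + (-lo (-s.1) - 2 * s.1, -lo s.2 + s.2) ∈ W ∧
    v + (-lo (-s.1) - s.1, -lo s.2) ∉ W ∧ v + (-lo (-s.1), -lo s.2 - s.2) ∉ W

/-- Number of hooks with their bend in the block `v`. -/
noncomputable def hk (W : Set (ℤ × ℤ)) (v : ℤ × ℤ) : ℝ :=
  ∑ s ∈ signs, (pind (IsHookV W s v) + pind (IsHookH W s v))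

/-- The block `v` has its only white pixel at the corner in direction `-s`. -/
def IsSlackA (W : Set (ℤ × ℤ)) (s v : ℤ × ℤ) : Prop :=
  cnt W v ≤ 1 ∧ v + (-lo s.1, -lo s.2) ∈ W

/-- The block `v` has at most one white pixel, and none in the column on the side `-s.1`. -/
def IsSlackV (W : Set (ℤ × ℤ)) (s v : ℤ × ℤ) : Prop :=
  cnt W v ≤ 1 ∧ v + (-lo s.1, 0) ∉ W ∧ v + (-lo s.1, 1) ∉ W

/-- The block `v` has at most one white pixel, and none in the row on the side `-s.2`. -/
def IsSlackH (W : Set (ℤ × ℤ)) (s v : ℤ × ℤ) : Prop :=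
  cnt W v ≤ 1 ∧ v + (0, -lo s.2) ∉ W ∧ v + (1, -lo s.2) ∉ W

theorem hk_nonneg (W : Set (ℤ × ℤ)) (v : ℤ × ℤ) : 0 ≤ hk W v :=
  Finset.sum_nonneg fun _ _ => add_nonneg (pind_nonneg _) (pind_nonneg _)

/-- A hook needs a block with exactly three white pixels, and the black corner determines `s`. The
two hooks with the same bend exclude each other: the last pixel of the horizontal shaft is the one
required to be black in `IsHookV`. -/
theorem hk_le_exc (W : Set (ℤ × ℤ)) (v : ℤ × ℤ) : hk W v ≤ exc W v := by
  classical
  unfold hk exc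
  rw [sum_signs, cnt_eq]
  simp only [pind, IsHookV, IsHookH, lo]
  by_cases a : v ∈ W <;> by_cases b : v + (1, 0) ∈ W <;> by_cases c : v + (0, 1) ∈ W <;>
      by_cases d : v + (1, 1) ∈ W <;> simp [a, b, c, d, add_mk_zero] <;>
      split_ifs <;> first | tauto | norm_num

/-- A block with one white pixel is counted 1 + 2 + 2 times and has slack 1. An empty block is
counted 0 + 4 + 4 times and has slack 2. -/
theorem sum_slack_le (W : Set (ℤ × ℤ)) (v : ℤ × ℤ) :
    ∑ s ∈ signs, (pind (IsSlackA W s v) + pind (IsSlackV W s v) + pind (IsSlackH W s v)) ≤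
      5 * slk W v := by
  classical
  unfold slk
  rw [sum_signs]
  simp only [pind, IsSlackA, IsSlackV, IsSlackH, lo, cnt_eq]
  by_cases a : v ∈ W <;> by_cases b : v + (1, 0) ∈ W <;> by_cases c : v + (0, 1) ∈ W <;>
      by_cases d : v + (1, 1) ∈ W <;> simp [a, b, c, d, add_mk_zero] <;> norm_num

theorem mem_of_two_le_cnt {W : Set (ℤ × ℤ)} {p c d e f : ℤ × ℤ} (h : ¬ cnt W (p + c) ≤ 1)
    (hd : p + d ∉ W) (he : p + e ∉ W)
    (hc : d - c ∈ corners ∧ e - c ∈ corners ∧ f - c ∈ corners ∧ d ≠ e ∧ f ≠ d ∧ f ≠ e) :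
    p + f ∈ W := by
  refine mem_of_slk_lt (c := c) ?_ hd he hc
  have : 2 - cnt W (p + c) = 0 := by omega
  rw [slk, this]
  norm_num

/-- The six pixels are a whole component, so the neighbours of its corner `c + s` are black. If the
three blocks around that corner are not slack, `c + 2s` is white and there is a white domino on each
side of it. Either `c + 2s` is isolated or it is the foot of a hook whose shaft contains one of the
dominoes. -/
theorem one_le_of_isQ {W : Set (ℤ × ℤ)} (K : Comps adj4 W 6) {s c : ℤ × ℤ} (hs : s ∈ signs)
    (h : IsQ W s c) :
    IsSing W (c + (2 * s.1, 2 * s.2)) ∨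
    IsHookV W s (c + (2 * s.1 + lo s.1, 2 * s.2 + lo (-s.2))) ∨
    IsHookH W s (c + (2 * s.1 + lo (-s.1), 2 * s.2 + lo s.2)) ∨
    IsSlackA W s (c + (s.1 + lo s.1, s.2 + lo s.2)) ∨
    IsSlackV W s (c + (2 * s.1 + lo s.1, lo s.2)) ∨
    IsSlackH W s (c + (lo s.1, 2 * s.2 + lo s.2)) := by
  obtain ⟨h0, h1, h2, h3, h4, h5⟩ := h
  have hb : ∀ d, IsChain4 [d, (s.1, s.2), (1, 0), (-1, 0), (0, 1), (0, -1), (0, 0)] ∨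
      IsChain4 [d, (s.1, s.2), (0, 1), (1, 0), (-1, 0), (0, -1), (0, 0)] → c + d ∉ W := by
    intro d hd hdW
    rcases hd with hd | hd
    all_goals
      have := K.length_le c _ hd (by
        intro e he
        simp only [List.mem_cons, List.not_mem_nil, or_false] at he
        rcases he with rfl | rfl | rfl | rfl | rfl | rfl | rfl <;> assumption)
      simp at this
  have b1 : c + (2 * s.1, 0) ∉ W := hb _ (by clear * - hs; revert s; decide)
  have b2 : c + (2 * s.1, s.2) ∉ W := hb _ (by clear * - hs; revert s; decide)
  have b3 : c + (0, 2 * s.2) ∉ W := hb _ (by clear * - hs; revert s; decide)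
  have b4 : c + (s.1, 2 * s.2) ∉ W := hb _ (by clear * - hs; revert s; decide)
  by_cases q1 : cnt W (c + (s.1 + lo s.1, s.2 + lo s.2)) ≤ 1
  · refine Or.inr (Or.inr (Or.inr (Or.inl ⟨q1, ?_⟩)))
    simpa [add_assoc] using h5
  by_cases q2 : cnt W (c + (2 * s.1 + lo s.1, lo s.2)) ≤ 1
  · refine Or.inr (Or.inr (Or.inr (Or.inr (Or.inl ⟨q2, ?_⟩))))
    simp only [add_assoc, Prod.mk_add_mk]
    rcases mem_signs hs with rfl | rfl | rfl | rfl <;> simp [lo] at * <;> tauto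
  by_cases q3 : cnt W (c + (lo s.1, 2 * s.2 + lo s.2)) ≤ 1
  · refine Or.inr (Or.inr (Or.inr (Or.inr (Or.inr ⟨q3, ?_⟩))))
    simp only [add_assoc, Prod.mk_add_mk]
    rcases mem_signs hs with rfl | rfl | rfl | rfl <;> simp [lo] at * <;> tauto
  have w1 : c + (2 * s.1, 2 * s.2) ∈ W :=
    mem_of_two_le_cnt q1 b2 b4 (by clear * - hs; revert s; decide)
  have w2 : c + (3 * s.1, 0) ∈ W :=
    mem_of_two_le_cnt q2 b1 b2 (by clear * - hs; revert s; decide)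
  have w3 : c + (3 * s.1, s.2) ∈ W :=
    mem_of_two_le_cnt q2 b1 b2 (by clear * - hs; revert s; decide)
  have w4 : c + (0, 3 * s.2) ∈ W :=
    mem_of_two_le_cnt q3 b3 b4 (by clear * - hs; revert s; decide)
  have w5 : c + (s.1, 3 * s.2) ∈ W :=
    mem_of_two_le_cnt q3 b3 b4 (by clear * - hs; revert s; decide)
  by_cases r1 : c + (3 * s.1, 2 * s.2) ∈ W
  · refine Or.inr (Or.inl ?_)
    unfold IsHookV
    simp only [add_assoc, Prod.mk_add_mk]
    clear q1 q2 q3 hb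
    rcases mem_signs hs with rfl | rfl | rfl | rfl <;> norm_num [lo] at * <;> tauto
  by_cases r2 : c + (2 * s.1, 3 * s.2) ∈ W
  · refine Or.inr (Or.inr (Or.inl ?_))
    unfold IsHookH
    simp only [add_assoc, Prod.mk_add_mk]
    clear q1 q2 q3 hb
    rcases mem_signs hs with rfl | rfl | rfl | rfl <;> norm_num [lo] at * <;> tauto
  · refine Or.inl ?_
    unfold IsSing
    simp only [add_assoc, Prod.mk_add_mk]
    clear q1 q2 q3 hb
    rcases mem_signs hs with rfl | rfl | rfl | rfl <;> norm_num at * <;> tauto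

/-- A set with as many pixels as possible in a diagonal rectangle fills it. -/
theorem mem_of_rect_full {C : Finset (ℤ × ℤ)} {a a' : ℤ} {m n : ℕ}
    (h : ∀ p ∈ C, (a ≤ du p ∧ du p < a + m) ∧ (a' ≤ dw p ∧ dw p < a' + n))
    (hfull : m * n ≤ 2 * C.card) {p : ℤ × ℤ}
    (hp : (a ≤ du p ∧ du p < a + m) ∧ (a' ≤ dw p ∧ dw p < a' + n)) : p ∈ C := by
  classical
  by_contra hpC
  have h1 := two_mul_card_le (C := insert p C) (a := a) (b := a + m - 1) (a' := a')
    (b' := a' + n - 1) (by omega) (by omega) (by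
      intro q hq
      rcases Finset.mem_insert.1 hq with rfl | hq
      · omega
      · have := h q hq
        omega)
  rw [Finset.card_insert_of_notMem hpC] at h1
  have e1 : a + (m : ℤ) - 1 - a + 1 = m := by ring
  have e2 : a' + (n : ℤ) - 1 - a' + 1 = n := by ring
  rw [e1, e2] at h1
  have : (m : ℤ) * n ≤ 2 * C.card := by exact_mod_cast hfull
  push_cast at h1
  omega

/-- The four pixels of a hook occupy three diagonals of one slope and four of the other, and the
black corner of the block lies on diagonals within both ranges. So the bounding rectangle is not
filled. -/
theorem Comps.hook_rect {W : Set (ℤ × ℤ)} {k : ℕ} (K : Comps adj4 W k) {x v s : ℤ × ℤ}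
    (hs : s ∈ signs) (hv : v ∈ nb (K.comp x)) (hexc : exc W v ≠ 0)
    (h : IsHookV W s v ∨ IsHookH W s v) {a a' : ℤ} {m n : ℕ}
    (hrect : ∀ p ∈ K.comp x, (a ≤ du p ∧ du p < a + m) ∧ (a' ≤ dw p ∧ dw p < a' + n)) :
    7 ≤ m + n ∧ ∃ p ∉ W, (a ≤ du p ∧ du p < a + m) ∧ (a' ≤ dw p ∧ dw p < a' + n) := by
  obtain ⟨d, hd, hvd⟩ := mem_nb.1 hv
  have hblock : ∀ e ∈ corners, v + e ∈ W → v + e ∈ K.comp x := fun e he hve =>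
    K.block_mem hexc hd hvd he hve
  rcases h with ⟨h1, h2, h3, h4, h5, -⟩ | ⟨h1, h2, h3, h4, h5, -⟩
  · have c1 := hblock _ (by clear * - hs; revert s; decide) h1
    have c2 := hblock _ (by clear * - hs; revert s; decide) h2
    have c3 := hblock _ (by clear * - hs; revert s; decide) h3
    have c4 := K.adj_mem c3 h4 (adj4_add_iff.2 (by clear * - hs; revert s; decide))
    have r1 := hrect _ c1
    have r2 := hrect _ c2
    have r3 := hrect _ c3
    have r4 := hrect _ c4
    rw [and_comm]
    refine ⟨⟨_, h5, ?_⟩, ?_⟩ <;> simp only [du, dw, Prod.fst_add, Prod.snd_add] at * <;>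
      rcases mem_signs hs with rfl | rfl | rfl | rfl <;> simp [lo] at * <;> omega
  · have c1 := hblock _ (by clear * - hs; revert s; decide) h1
    have c2 := hblock _ (by clear * - hs; revert s; decide) h2
    have c3 := hblock _ (by clear * - hs; revert s; decide) h3
    have c4 := K.adj_mem c3 h4 (adj4_add_iff.2 (by clear * - hs; revert s; decide))
    have r1 := hrect _ c1
    have r2 := hrect _ c2
    have r3 := hrect _ c3
    have r4 := hrect _ c4
    rw [and_comm]
    refine ⟨⟨_, h5, ?_⟩, ?_⟩ <;> simp only [du, dw, Prod.fst_add, Prod.snd_add] at * <;>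
      rcases mem_signs hs with rfl | rfl | rfl | rfl <;> simp [lo] at * <;> omega

/-- A full 3 × 4 diagonal rectangle is a plus with one diagonal neighbour of its centre. The
direction of that neighbour depends on which side is longer and on the parity of `a + a'`. -/
theorem exists_isQ {W : Set (ℤ × ℤ)} {C : Finset (ℤ × ℤ)} (hC : ↑C ⊆ W) {a a' : ℤ} {m n : ℕ}
    (hmn : m = 3 ∧ n = 4 ∨ m = 4 ∧ n = 3)
    (h : ∀ p : ℤ × ℤ, (a ≤ du p ∧ du p < a + m) ∧ (a' ≤ dw p ∧ dw p < a' + n) → p ∈ C) :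
    ∃ c ∈ C, ∃ s ∈ signs, IsQ W s c := by
  have key : ∀ c s : ℤ × ℤ, s ∈ signs →
      (∀ d ∈ [((0, 0) : ℤ × ℤ), (1, 0), (-1, 0), (0, 1), (0, -1), (s.1, s.2)], c + d ∈ C) →
      ∃ c ∈ C, ∃ s ∈ signs, IsQ W s c := by
    intro c s hs hd
    refine ⟨c, by simpa [add_mk_zero] using hd (0, 0) (by simp), s, hs, ?_⟩
    refine ⟨?_, ?_, ?_, ?_, ?_, ?_⟩ <;> exact hC (hd _ (by simp))
  have hparity : (a + a') % 2 = 0 ∨ (a + a') % 2 = 1 := by omega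
  rcases hmn with ⟨rfl, rfl⟩ | ⟨rfl, rfl⟩ <;> rcases hparity with hp | hp
  · obtain ⟨t, ht⟩ : ∃ t, a + a' = 2 * t := ⟨(a + a') / 2, by omega⟩
    refine key (t + 1, a - t) (1, -1) (by decide) fun d hd => h _ ?_
    simp only [List.mem_cons, List.not_mem_nil, or_false] at hd
    rcases hd with rfl | rfl | rfl | rfl | rfl | rfl <;> simp [du, dw] <;> omega
  · obtain ⟨t, ht⟩ : ∃ t, a + a' = 2 * t + 1 := ⟨(a + a') / 2, by omega⟩
    refine key (t + 2, a - t - 1) (-1, 1) (by decide) fun d hd => h _ ?_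
    simp only [List.mem_cons, List.not_mem_nil, or_false] at hd
    rcases hd with rfl | rfl | rfl | rfl | rfl | rfl <;> simp [du, dw] <;> omega
  · obtain ⟨t, ht⟩ : ∃ t, a + a' = 2 * t := ⟨(a + a') / 2, by omega⟩
    refine key (t + 1, a - t) (1, 1) (by decide) fun d hd => h _ ?_
    simp only [List.mem_cons, List.not_mem_nil, or_false] at hd
    rcases hd with rfl | rfl | rfl | rfl | rfl | rfl <;> simp [du, dw] <;> omega
  · obtain ⟨t, ht⟩ : ∃ t, a + a' = 2 * t + 1 := ⟨(a + a') / 2, by omega⟩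
    refine key (t + 2, a - t) (-1, -1) (by decide) fun d hd => h _ ?_
    simp only [List.mem_cons, List.not_mem_nil, or_false] at hd
    rcases hd with rfl | rfl | rfl | rfl | rfl | rfl <;> simp [du, dw] <;> omega

/-- Excess 4/5 per pixel is what density 5/8 allows. Only six pixels with `m + n = 7` exceed it, by
1/5; they fill their rectangle and contain an `IsQ` that pays. A component with a hook does not fill
its rectangle and has `m + n ≥ 7`, hence `m + n ≥ 8` for six pixels. It therefore has room for the
additional 1/5 per hook. -/
theorem Comps.exc_six {W : Set (ℤ × ℤ)} (K : Comps adj4 W 6) {x : ℤ × ℤ} (hx : x ∈ W) :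
    ∑ v ∈ nb (K.comp x), (exc W v + 1 / 5 * hk W v) + 4 / 5 * ∑ y ∈ K.comp x, sing W y ≤
      4 / 5 * (K.comp x).card + 1 / 5 * ∑ y ∈ K.comp x, ∑ s ∈ signs, pind (IsQ W s y) := by
  obtain ⟨a, a', m, n, hm, hn, hrect, hmn, hexc⟩ := K.exists_rect hx
  have hsing := K.sum_sing_le (x := x)
  have hQ : 0 ≤ ∑ y ∈ K.comp x, ∑ s ∈ signs, pind (IsQ W s y) :=
    Finset.sum_nonneg fun _ _ => Finset.sum_nonneg fun _ _ => pind_nonneg _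
  rw [Finset.sum_add_distrib, ← Finset.mul_sum]
  have hhk : ∑ v ∈ nb (K.comp x), hk W v ≤ ∑ v ∈ nb (K.comp x), exc W v :=
    Finset.sum_le_sum fun v _ => hk_le_exc W v
  have hj6 := K.card_le x
  have hj1 : 1 ≤ (K.comp x).card := K.pos_of_mem hx
  have hfill : m * n ≤ 2 * (K.comp x).card → ∀ p : ℤ × ℤ,
      (a ≤ du p ∧ du p < a + m) ∧ (a' ≤ dw p ∧ dw p < a' + n) → p ∈ K.comp x :=
    fun hf p hp => mem_of_rect_full hrect hf hp
  by_cases hhook : ∃ v ∈ nb (K.comp x), hk W v ≠ 0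
  · obtain ⟨v, hv, hvk⟩ := hhook
    have hve : exc W v ≠ 0 := by
      have h1 := hk_le_exc W v
      have h2 := hk_nonneg W v
      intro h3
      exact hvk (by linarith)
    obtain ⟨s, hs, hs'⟩ : ∃ s ∈ signs, IsHookV W s v ∨ IsHookH W s v := by
      by_contra hcon
      push Not at hcon
      refine hvk (Finset.sum_eq_zero fun s hs => ?_)
      rw [pind_of_not (hcon s hs).1, pind_of_not (hcon s hs).2, add_zero]
    obtain ⟨h7, p, hpW, hp⟩ := K.hook_rect hs hv hve hs' hrect
    have hne : ¬ m * n ≤ 2 * (K.comp x).card := fun hf => hpW (K.subset (hfill hf p hp))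
    generalize (K.comp x).card = j at *
    have h7' : (7 : ℝ) ≤ m + n := by exact_mod_cast h7
    have hj1' : j ≠ 1 := by
      rintro rfl
      have := Finset.sum_nonneg fun v (_ : v ∈ nb (K.comp x)) => exc_nonneg W v
      norm_num at hexc
      linarith
    rw [if_neg hj1'] at hsing
    rcases Nat.lt_or_ge j 6 with hj | hj
    · have hj5 : (j : ℝ) ≤ 5 := by exact_mod_cast (by omega : j ≤ 5)
      linarith
    · have hj : j = 6 := by omega
      have h8 : 8 ≤ m + n := by
        by_contra hc
        have h1 : m ≤ 6 := by omega
        have h2 : n = 7 - m := by omega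
        subst hj
        subst h2
        interval_cases m <;> omega
      have h8' : (8 : ℝ) ≤ m + n := by exact_mod_cast h8
      subst hj
      norm_num at hexc hsing ⊢
      linarith
  · push Not at hhook
    have hhk0 : ∑ v ∈ nb (K.comp x), hk W v = 0 := Finset.sum_eq_zero hhook
    rw [hhk0]
    have hQ' : (K.comp x).card = 6 → m + n = 7 →
        1 ≤ ∑ y ∈ K.comp x, ∑ s ∈ signs, pind (IsQ W s y) := by
      intro hj h7
      have hmn' : m = 3 ∧ n = 4 ∨ m = 4 ∧ n = 3 := by
        have h1 : m ≤ 6 := by omega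
        have h2 : n = 7 - m := by omega
        rw [hj] at hmn
        subst h2
        interval_cases m <;> omega
      have hf : m * n ≤ 2 * (K.comp x).card := by
        rw [hj]
        rcases hmn' with ⟨rfl, rfl⟩ | ⟨rfl, rfl⟩ <;> norm_num
      obtain ⟨c, hc, s, hs, hq⟩ := exists_isQ (W := W) (fun y hy => K.subset hy) hmn' (hfill hf)
      calc (1 : ℝ) = pind (IsQ W s c) := (pind_of hq).symm
        _ ≤ ∑ s ∈ signs, pind (IsQ W s c) :=
          Finset.single_le_sum (f := fun s => pind (IsQ W s c)) (fun _ _ => pind_nonneg _) hs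
        _ ≤ _ := Finset.single_le_sum (f := fun y => ∑ s ∈ signs, pind (IsQ W s y))
          (fun _ _ => Finset.sum_nonneg fun _ _ => pind_nonneg _) hc
    have hmin : ∀ t, (∀ m n : ℕ, 1 ≤ m → 1 ≤ n → 2 * (K.comp x).card ≤ m * n + 1 →
        m + n < t → False) → (t : ℝ) ≤ m + n := by
      intro t ht
      have : t ≤ m + n := by
        by_contra hc
        exact ht m n hm hn hmn (by omega)
      exact_mod_cast this
    have hsmall : ∀ j t : ℕ, (K.comp x).card = j → t ≤ 8 →
        (∀ m < 8, ∀ n < 8, 1 ≤ m → 1 ≤ n → 2 * j ≤ m * n + 1 → ¬ m + n < t) →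
        (t : ℝ) ≤ m + n := by
      intro j t hj ht8 ht
      refine hmin t fun m n hm hn h1 h2 => ?_
      rw [hj] at h1
      exact ht m (by omega) n (by omega) hm hn h1 h2
    have hcases : (K.comp x).card = 1 ∨ (K.comp x).card = 2 ∨ (K.comp x).card = 3 ∨
        (K.comp x).card = 4 ∨ (K.comp x).card = 5 ∨ (K.comp x).card = 6 := by omega
    rcases hcases with hj | hj | hj | hj | hj | hj
    · have := hsmall 1 2 hj (by norm_num) (by decide)
      rw [hj] at hexc hsing ⊢
      norm_num at hexc hsing this ⊢
      linarith
    · have := hsmall 2 4 hj (by norm_num) (by decide)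
      rw [hj] at hexc hsing ⊢
      norm_num at hexc hsing this ⊢
      linarith
    · have := hsmall 3 5 hj (by norm_num) (by decide)
      rw [hj] at hexc hsing ⊢
      norm_num at hexc hsing this ⊢
      linarith
    · have := hsmall 4 6 hj (by norm_num) (by decide)
      rw [hj] at hexc hsing ⊢
      norm_num at hexc hsing this ⊢
      linarith
    · have := hsmall 5 6 hj (by norm_num) (by decide)
      rw [hj] at hexc hsing ⊢
      norm_num at hexc hsing this ⊢
      linarith
    · have h7 := hsmall 6 7 hj (by norm_num) (by decide)
      rcases Nat.lt_or_ge (m + n) 8 with h8 | h8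
      · have h7n : 7 ≤ m + n := by exact_mod_cast h7
        have h9 := hQ' hj (by omega)
        push_cast at h7
        rw [hj] at hexc hsing ⊢
        norm_num at hexc hsing ⊢
        linarith
      · have h8' : (8 : ℝ) ≤ m + n := by exact_mod_cast h8
        rw [hj] at hexc hsing ⊢
        norm_num at hexc hsing ⊢
        linarith

theorem density_le_of_comps_six {W : Set (ℤ × ℤ)} (K : Comps adj4 W 6) : density W ≤ 5 / 8 := by
  apply density_le
  have hsing : ∀ x, |sing W x| ≤ 1 := fun x => abs_pind_le _
  have hhk : ∀ x, |hk W x| ≤ 2 := fun x => by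
    rw [abs_of_nonneg (hk_nonneg W x)]
    exact (hk_le_exc W x).trans (exc_le_two W x)
  set F : ℤ × ℤ → ℝ := fun v => exc W v + 1 / 5 * hk W v
  have hFexc : ∀ v, exc W v = 0 → F v = 0 := by
    intro v hv
    have h1 := hk_le_exc W v
    have h2 := hk_nonneg W v
    simp only [F]
    linarith
  have hFb : ∀ v, |F v| ≤ 3 := by
    intro v
    have h1 := hk_le_exc W v
    have h2 := hk_nonneg W v
    have h3 := exc_le_two W v
    simp only [F]
    rw [abs_le]
    constructor <;> linarith
  have hpush : AvgNonpos fun x => F x - push W F x :=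
    avgNonpos_sub_push W hFb fun v hv => hFexc v (exc_eq_zero W v hv)
  -- Each `IsQ` charges one of six nearby features. A single pixel is charged from at most four
  -- directions, a hook once, and a slack block at most five times per unit of slack by
  -- `sum_slack_le`.
  have hcharge : AvgNonpos fun x =>
      ∑ s ∈ signs, pind (IsQ W s x) - 4 * sing W x - hk W x - 5 * slk W x := by
    have hsh : ∀ s ∈ signs, AvgNonpos fun x =>
        (sing W (x + (2 * s.1, 2 * s.2)) - sing W x)
        + (pind (IsHookV W s (x + (2 * s.1 + lo s.1, 2 * s.2 + lo (-s.2))))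
          - pind (IsHookV W s x))
        + (pind (IsHookH W s (x + (2 * s.1 + lo (-s.1), 2 * s.2 + lo s.2)))
          - pind (IsHookH W s x))
        + (pind (IsSlackA W s (x + (s.1 + lo s.1, s.2 + lo s.2))) - pind (IsSlackA W s x))
        + (pind (IsSlackV W s (x + (2 * s.1 + lo s.1, lo s.2))) - pind (IsSlackV W s x))
        + (pind (IsSlackH W s (x + (lo s.1, 2 * s.2 + lo s.2))) - pind (IsSlackH W s x)) :=
      fun s _ => (((((avgNonpos_shift hsing _).add
        (avgNonpos_shift (f := fun x => pind (IsHookV W s x)) (fun x => abs_pind_le _) _)).add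
        (avgNonpos_shift (f := fun x => pind (IsHookH W s x)) (fun x => abs_pind_le _) _)).add
        (avgNonpos_shift (f := fun x => pind (IsSlackA W s x)) (fun x => abs_pind_le _) _)).add
        (avgNonpos_shift (f := fun x => pind (IsSlackV W s x)) (fun x => abs_pind_le _) _)).add
        (avgNonpos_shift (f := fun x => pind (IsSlackH W s x)) (fun x => abs_pind_le _) _)
    refine (AvgNonpos.sum signs hsh).mono fun x => ?_
    have hpt : ∀ s ∈ signs, pind (IsQ W s x) - sing W x
        - (pind (IsHookV W s x) + pind (IsHookH W s x))
        - (pind (IsSlackA W s x) + pind (IsSlackV W s x) + pind (IsSlackH W s x)) ≤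
        (sing W (x + (2 * s.1, 2 * s.2)) - sing W x)
        + (pind (IsHookV W s (x + (2 * s.1 + lo s.1, 2 * s.2 + lo (-s.2))))
          - pind (IsHookV W s x))
        + (pind (IsHookH W s (x + (2 * s.1 + lo (-s.1), 2 * s.2 + lo s.2)))
          - pind (IsHookH W s x))
        + (pind (IsSlackA W s (x + (s.1 + lo s.1, s.2 + lo s.2))) - pind (IsSlackA W s x))
        + (pind (IsSlackV W s (x + (2 * s.1 + lo s.1, lo s.2))) - pind (IsSlackV W s x))
        + (pind (IsSlackH W s (x + (lo s.1, 2 * s.2 + lo s.2))) - pind (IsSlackH W s x)) := by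
      intro s hs
      have n1 : 0 ≤ sing W (x + (2 * s.1, 2 * s.2)) := pind_nonneg _
      have n2 := pind_nonneg (IsHookV W s (x + (2 * s.1 + lo s.1, 2 * s.2 + lo (-s.2))))
      have n3 := pind_nonneg (IsHookH W s (x + (2 * s.1 + lo (-s.1), 2 * s.2 + lo s.2)))
      have n4 := pind_nonneg (IsSlackA W s (x + (s.1 + lo s.1, s.2 + lo s.2)))
      have n5 := pind_nonneg (IsSlackV W s (x + (2 * s.1 + lo s.1, lo s.2)))
      have n6 := pind_nonneg (IsSlackH W s (x + (lo s.1, 2 * s.2 + lo s.2)))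
      by_cases h : IsQ W s x
      · rw [pind_of h]
        rcases one_le_of_isQ K hs h with h' | h' | h' | h' | h' | h'
        · have : sing W (x + (2 * s.1, 2 * s.2)) = 1 := pind_of h'
          linarith
        all_goals
          have := pind_of h'
          linarith
      · rw [pind_of_not h]
        linarith
    refine le_trans ?_ (Finset.sum_le_sum hpt)
    have h1 := sum_slack_le W x
    have h2 : signs.card = 4 := by decide
    have h3 : hk W x = ∑ s ∈ signs, (pind (IsHookV W s x) + pind (IsHookH W s x)) := rfl
    rw [Finset.sum_sub_distrib, Finset.sum_sub_distrib, Finset.sum_sub_distrib, Finset.sum_const,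
      h2, ← h3]
    simp only [nsmul_eq_mul]
    push_cast
    linarith
  have hcomp : AvgNonpos fun x => push W F x + 4 / 5 * sing W x - 4 / 5 * ind W x
      - 1 / 5 * ∑ s ∈ signs, pind (IsQ W s x) := by
    have hQ0 : ∀ x, 0 ≤ ∑ s ∈ signs, pind (IsQ W s x) := fun x =>
      Finset.sum_nonneg fun _ _ => pind_nonneg _
    refine K.avgNonpos adj4_close (B := 4 * 3 + 1) ?_ ?_ ?_
    · intro x
      have h1 := (le_abs_self _).trans (abs_push_le W hFb x)
      have h2 := (le_abs_self _).trans (hsing x)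
      have h3 := ind_nonneg W x
      have h4 := hQ0 x
      linarith
    · intro x hx
      have h1 : sing W x = 0 := pind_of_not fun h => hx h.1
      have h2 := hQ0 x
      rw [push, ind_of_notMem hx, h1]
      linarith
    · intro x hx
      have h := K.exc_six hx
      rw [Finset.sum_sub_distrib, Finset.sum_sub_distrib, Finset.sum_add_distrib,
        ← Finset.mul_sum, ← Finset.mul_sum, ← Finset.mul_sum,
        K.sum_push_exc x fun v hv hv0 => hv (hFexc v hv0), K.sum_ind]
      linarith
  refine ((((avgNonpos_block W).add hpush).add
    (hcharge.const_mul (c := 1 / 5) (by norm_num))).add hcomp).const_mul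
    (c := 5 / 16) (by norm_num) |>.mono fun x => ?_
  simp only [F]
  linarith


/-! ### Periodic images -/

/-- A labelling that is constant along edges bounds the size of the components. -/
theorem maxCC_le_of_label {G : SimpleGraph (ℤ × ℤ)} {W : Set (ℤ × ℤ)} {k : ℕ} {α : Type*}
    (lab : ℤ × ℤ → α) (hlab : ∀ x ∈ W, ∀ y ∈ W, G.Adj x y → lab x = lab y)
    (T : α → Finset (ℤ × ℤ)) (hT : ∀ x ∈ W, x ∈ T (lab x)) (hcard : ∀ x ∈ W, (T (lab x)).card ≤ k) :
    maxCC G W ≤ k := by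
  refine iSup_le fun c => ?_
  induction c using SimpleGraph.ConnectedComponent.ind with
  | _ x =>
    have hsub : Subtype.val '' ((G.induce W).connectedComponentMk x).supp ⊆ (T (lab x) : Set _) := by
      rintro _ ⟨y, hy, rfl⟩
      have hr : (G.induce W).Reachable y x := SimpleGraph.ConnectedComponent.eq.1 hy
      have : ∀ z : W, Relation.ReflTransGen (G.induce W).Adj x z → lab z = lab x := by
        intro z hz
        induction hz with
        | refl => rfl
        | @tail b c _ hbc ih => rw [← ih]; exact (hlab b b.2 c c.2 hbc).symm
      rw [← this y ((SimpleGraph.reachable_iff_reflTransGen _ _).1 hr.symm)]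
      exact hT y y.2
    rw [← (Subtype.val_injective).encard_image]
    refine (Set.encard_le_encard hsub).trans ?_
    rw [Set.encard_coe_eq_coe_finsetCard]
    exact_mod_cast hcard x x.2

-- If every translate of the window `V` has at least `j` white pixels, average this over all
-- translates: the mean of `ind W (x + v)` over `v ∈ V` has the same box averages as `ind W`.
open Classical in
theorem le_density_of_shifts {W : Set (ℤ × ℤ)} (V : Finset (ℤ × ℤ)) (hV : V.Nonempty) {j : ℕ}
    (h : ∀ x, j ≤ (V.filter fun v => x + v ∈ W).card) : (j : ℝ) / V.card ≤ density W := by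
  apply le_density
  have hV0 : (0 : ℝ) < V.card := by exact_mod_cast hV.card_pos
  refine ((AvgNonpos.sum V fun v _ => avgNonpos_shift (abs_ind_le W) v).const_mul
    (c := 1 / V.card) (by positivity)).mono fun x => ?_
  have h1 : (j : ℝ) ≤ ∑ v ∈ V, ind W (x + v) := by
    have : ∑ v ∈ V, ind W (x + v) = ((V.filter fun v => x + v ∈ W).card : ℝ) := by
      simp [ind]
    rw [this]
    exact_mod_cast h x
  rw [Finset.sum_sub_distrib, Finset.sum_const, nsmul_eq_mul, mul_sub]
  have h2 : 1 / (V.card : ℝ) * (V.card * ind W x) = ind W x := by field_simp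
  rw [h2, div_eq_mul_one_div, mul_comm]
  have := mul_le_mul_of_nonneg_left h1 (by positivity : 0 ≤ 1 / (V.card : ℝ))
  linarith

/-- Images given by a colouring of the residues of a linear form. The residue `r` has the colour
`cid r`, with `0` for black, and `off` records the position of a pixel in its component. -/
theorem exists_of_residues {G : SimpleGraph (ℤ × ℤ)} (dirs : Finset (ℤ × ℤ))
    (hG : ∀ a b, G.Adj a b → ∃ d ∈ dirs, b = a + d ∨ a = b + d)
    (α β N : ℤ) (hN : 0 < N) (cid : ℤ → ℕ) (off : ℤ → ℤ × ℤ) (e : ℤ × ℤ)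
    (he : (α * e.1 + β * e.2) % N = 1 % N) {j k : ℕ}
    (hadj : ∀ d ∈ dirs, ∀ r, 0 ≤ r → r < N → cid r ≠ 0 →
      cid ((r + (α * d.1 + β * d.2)) % N) ≠ 0 →
      cid ((r + (α * d.1 + β * d.2)) % N) = cid r ∧
        off ((r + (α * d.1 + β * d.2)) % N) = off r + d)
    (hk : ∀ c ≠ 0, ((Finset.Ico 0 N).filter fun r => cid r = c).card ≤ k)
    (hj : j ≤ ((Finset.Ico 0 N).filter fun r => cid r ≠ 0).card) :
    ∃ W, maxCC G W ≤ k ∧ (j : ℝ) / N ≤ density W := by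
  classical
  set φ : ℤ × ℤ → ℤ := fun p => (α * p.1 + β * p.2) % N with hφ
  have hφ0 : ∀ p, 0 ≤ φ p ∧ φ p < N := fun p =>
    ⟨Int.emod_nonneg _ hN.ne', Int.emod_lt_of_pos _ hN⟩
  have hφadd : ∀ p d, φ (p + d) = (φ p + (α * d.1 + β * d.2)) % N := by
    intro p d
    simp only [hφ, Prod.fst_add, Prod.snd_add, Int.emod_add_emod]
    congr 1
    ring
  refine ⟨{p | cid (φ p) ≠ 0}, ?_, ?_⟩
  -- The label is the origin of the copy of the component together with its colour; both are
  -- preserved by an edge between white pixels.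
  · refine maxCC_le_of_label (fun p => (p - off (φ p), cid (φ p))) ?_
      (fun l => ((Finset.Ico 0 N).filter fun r => cid r = l.2).image fun r => l.1 + off r) ?_ ?_
    · have step : ∀ x ∈ {p | cid (φ p) ≠ 0}, ∀ d ∈ dirs, x + d ∈ {p | cid (φ p) ≠ 0} →
          (x - off (φ x), cid (φ x)) = ((x + d) - off (φ (x + d)), cid (φ (x + d))) := by
        intro x hx d hd hxd
        simp only [Set.mem_ofPred_eq] at hx hxd
        rw [hφadd] at hxd
        obtain ⟨h1, h2⟩ := hadj d hd (φ x) (hφ0 x).1 (hφ0 x).2 hx hxd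
        rw [hφadd, h1, h2, add_sub_add_right_eq_sub]
      intro x hx y hy hxy
      obtain ⟨d, hd, rfl | rfl⟩ := hG x y hxy
      · exact step x hx d hd hy
      · exact (step y hy d hd hx).symm
    · intro x _
      refine Finset.mem_image.2 ⟨φ x, ?_, by simp⟩
      simp [(hφ0 x).1, (hφ0 x).2]
    · intro x hx
      exact Finset.card_image_le.trans (hk _ hx)
  -- Along `e` the form increases by one modulo `N`, so every translate of this window sees each
  -- residue exactly once.
  · set V := (Finset.Ico 0 N).image fun i : ℤ => (i * e.1, i * e.2)
    have hφV : ∀ x, ∀ i : ℤ, φ (x + (i * e.1, i * e.2)) = (φ x + i) % N := by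
      intro x i
      have h1 : α * (i * e.1) + β * (i * e.2) = (α * e.1 + β * e.2) * i := by ring
      have h2 : (α * e.1 + β * e.2) * i ≡ 1 * i [ZMOD N] := Int.ModEq.mul_right i he
      rw [one_mul] at h2
      rw [hφadd, h1]
      exact Int.ModEq.add_left (φ x) h2
    have hinj : Set.InjOn (fun i : ℤ => (i * e.1, i * e.2)) (Finset.Ico 0 N : Finset ℤ) := by
      intro a ha b hb hab
      have h1 := hφV 0 a
      have h2 := hφV 0 b
      simp only at hab
      rw [hab, h2] at h1
      have h3 : φ 0 = 0 := by simp [hφ]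
      rw [Finset.mem_coe, Finset.mem_Ico] at ha hb
      rw [h3, zero_add, zero_add, Int.emod_eq_of_lt ha.1 ha.2, Int.emod_eq_of_lt hb.1 hb.2] at h1
      exact h1.symm
    have hVc : V.card = N.toNat := by
      rw [Finset.card_image_of_injOn hinj, Int.card_Ico, sub_zero]
    have hVN : (V.card : ℝ) = N := by
      rw [hVc]
      exact_mod_cast Int.toNat_of_nonneg hN.le
    rw [← hVN]
    refine le_density_of_shifts V (Finset.card_pos.1 (by omega)) fun x => hj.trans ?_
    refine Finset.card_le_card_of_injOn
      (fun r => (((r - φ x) % N) * e.1, ((r - φ x) % N) * e.2)) ?_ ?_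
    · intro r hr
      simp only [Finset.coe_filter, Finset.mem_Ico, Set.mem_ofPred_eq] at hr
      simp only [Finset.coe_filter, Set.mem_ofPred_eq]
      refine ⟨Finset.mem_image.2 ⟨(r - φ x) % N, ?_, rfl⟩, ?_⟩
      · rw [Finset.mem_Ico]
        exact ⟨Int.emod_nonneg _ hN.ne', Int.emod_lt_of_pos _ hN⟩
      · rw [hφV, Int.add_emod_emod, add_sub_cancel, Int.emod_eq_of_lt hr.1.1 hr.1.2]
        exact hr.2
    · intro a ha b hb hab
      simp only [Finset.coe_filter, Finset.mem_Ico, Set.mem_ofPred_eq] at ha hb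
      have hmem : ∀ r, (r - φ x) % N ∈ ((Finset.Ico 0 N : Finset ℤ) : Set ℤ) := by
        intro r
        rw [Finset.mem_coe, Finset.mem_Ico]
        exact ⟨Int.emod_nonneg _ hN.ne', Int.emod_lt_of_pos _ hN⟩
      have h1 : (a - φ x) % N = (b - φ x) % N := hinj (hmem a) (hmem b) hab
      have h2 : a ≡ b [ZMOD N] := by
        have : a - φ x ≡ b - φ x [ZMOD N] := h1
        simpa using this.add_right (φ x)
      have h3 : a % N = b % N := h2
      rwa [Int.emod_eq_of_lt ha.1.1 ha.1.2, Int.emod_eq_of_lt hb.1.1 hb.1.2] at h3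

theorem adj4_dirs (a b : ℤ × ℤ) (h : adj4.Adj a b) :
    ∃ d ∈ ({(1, 0), (0, 1)} : Finset (ℤ × ℤ)), b = a + d ∨ a = b + d := by
  rcases adj4_iff_exists.1 h with rfl | rfl | rfl | rfl
  · exact ⟨(1, 0), by decide, Or.inl rfl⟩
  · exact ⟨(1, 0), by decide, Or.inr (by ext <;> simp)⟩
  · exact ⟨(0, 1), by decide, Or.inl rfl⟩
  · exact ⟨(0, 1), by decide, Or.inr (by ext <;> simp)⟩

theorem adj8_dirs (a b : ℤ × ℤ) (h : adj8.Adj a b) :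
    ∃ d ∈ ({(1, 0), (0, 1), (1, 1), (-1, 1)} : Finset (ℤ × ℤ)), b = a + d ∨ a = b + d := by
  have h : max |a.1 - b.1| |a.2 - b.2| = 1 := h
  have h1 : |a.1 - b.1| ≤ 1 := h ▸ le_max_left _ _
  have h2 : |a.2 - b.2| ≤ 1 := h ▸ le_max_right _ _
  have h3 : a.1 - b.1 ≠ 0 ∨ a.2 - b.2 ≠ 0 := by
    by_contra hc
    push Not at hc
    rw [hc.1, hc.2] at h
    simp at h
  rw [abs_le] at h1 h2
  have h4 : a.1 - b.1 = -1 ∨ a.1 - b.1 = 0 ∨ a.1 - b.1 = 1 := by omega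
  have h5 : a.2 - b.2 = -1 ∨ a.2 - b.2 = 0 ∨ a.2 - b.2 = 1 := by omega
  have key : ∀ d : ℤ × ℤ, (b.1 = a.1 + d.1 ∧ b.2 = a.2 + d.2) ∨ (a.1 = b.1 + d.1 ∧ a.2 = b.2 + d.2) →
      b = a + d ∨ a = b + d := by
    intro d hd
    simpa [Prod.ext_iff] using hd
  rcases h4 with h4 | h4 | h4 <;> rcases h5 with h5 | h5 | h5
  · exact ⟨(1, 1), by decide, key _ (by simp only; omega)⟩
  · exact ⟨(1, 0), by decide, key _ (by simp only; omega)⟩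
  · exact ⟨(-1, 1), by decide, key _ (by simp only; omega)⟩
  · exact ⟨(0, 1), by decide, key _ (by simp only; omega)⟩
  · omega
  · exact ⟨(0, 1), by decide, key _ (by simp only; omega)⟩
  · exact ⟨(-1, 1), by decide, key _ (by simp only; omega)⟩
  · exact ⟨(1, 0), by decide, key _ (by simp only; omega)⟩
  · exact ⟨(1, 1), by decide, key _ (by simp only; omega)⟩

/-! ### Rectangular and diagonal rectangular components from residues. -/

/-- Residues below `M` that are not `-1` modulo `A` get the colour `1`. -/
def stripe (A M r : ℤ) : ℕ := if r < M ∧ r % A ≠ A - 1 then 1 else 0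

theorem stripe_ne_zero {A M r : ℤ} : stripe A M r ≠ 0 ↔ r < M ∧ r % A ≠ A - 1 := by
  unfold stripe; split_ifs with h <;> simp [h]

theorem stripe_eq_of_ne {A M r r' : ℤ} (h : stripe A M r ≠ 0) (h' : stripe A M r' ≠ 0) :
    stripe A M r' = stripe A M r := by
  rw [stripe, stripe, if_pos (stripe_ne_zero.1 h), if_pos (stripe_ne_zero.1 h')]

theorem card_stripe {A b q N : ℤ} (hb : 0 ≤ b) (hq : 0 ≤ q) (hqA : q < A)
    (hN : A * b + q ≤ N) :
    (((Finset.Ico 0 N).filter fun r => stripe A (A * b + q) r ≠ 0).card : ℤ) = (A - 1) * b + q := by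
  have hA : 0 < A := by omega
  have hAb : 0 ≤ A * b := mul_nonneg hA.le hb
  have h1 : (Finset.Ico 0 N).filter (fun r => stripe A (A * b + q) r ≠ 0) =
      Finset.Ico 0 (A * b + q) \ (Finset.Ico 0 b).image fun y => A * y + (A - 1) := by
    ext r
    simp only [stripe_ne_zero, Finset.mem_filter, Finset.mem_Ico, Finset.mem_sdiff,
      Finset.mem_image, not_exists, not_and]
    constructor
    · rintro ⟨⟨h1, _⟩, h2, h3⟩
      refine ⟨⟨h1, h2⟩, fun y _ hy => h3 ?_⟩
      rw [← hy, Int.mul_add_emod_self_left]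
      exact Int.emod_eq_of_lt (by omega) (by omega)
    · rintro ⟨⟨h1, h2⟩, h3⟩
      refine ⟨⟨h1, by omega⟩, h2, fun h4 => ?_⟩
      have h5 := Int.mul_ediv_add_emod r A
      refine h3 (r / A) ⟨Int.ediv_nonneg h1 hA.le, ?_⟩ (by rw [← h4]; exact h5)
      by_contra hc
      have : A * b ≤ A * (r / A) := mul_le_mul_of_nonneg_left (not_lt.1 hc) hA.le
      omega
  have h2 : ((Finset.Ico 0 b).image fun y => A * y + (A - 1)) ⊆ Finset.Ico 0 (A * b + q) := by
    intro r hr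
    obtain ⟨y, hy, rfl⟩ := Finset.mem_image.1 hr
    rw [Finset.mem_Ico] at hy ⊢
    have h3 : 0 ≤ A * y := mul_nonneg hA.le hy.1
    have h4 : A * (y + 1) ≤ A * b := mul_le_mul_of_nonneg_left (by omega) hA.le
    rw [mul_add, mul_one] at h4
    omega
  have h3 : ((Finset.Ico 0 b).image fun y => A * y + (A - 1)).card = b.toNat := by
    rw [Finset.card_image_of_injective, Int.card_Ico, sub_zero]
    intro y z hyz
    simp only at hyz
    exact mul_left_cancel₀ hA.ne' (by linarith)
  rw [h1, Finset.card_sdiff_of_subset h2, h3, Int.card_Ico]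
  have h4 : (A - 1) * b = A * b - b := by ring
  have h5 : b ≤ A * b := le_mul_of_one_le_left hb (by omega)
  omega

theorem divMod_eq {A y x : ℤ} (h0 : 0 ≤ x) (h1 : x < A) :
    (A * y + x) / A = y ∧ (A * y + x) % A = x := by
  constructor
  · rw [Int.mul_add_ediv_left _ _ (by omega), Int.ediv_eq_zero_of_lt h0 h1, add_zero]
  · rw [Int.mul_add_emod_self_left, Int.emod_eq_of_lt h0 h1]

theorem card_stripe_eq_le {A M N : ℤ} {c k : ℕ} (hc : c ≠ 0)
    (h : ((Finset.Ico 0 N).filter fun r => stripe A M r ≠ 0).card ≤ k) :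
    ((Finset.Ico 0 N).filter fun r => stripe A M r = c).card ≤ k := by
  refine le_trans (Finset.card_le_card ?_) h
  intro r hr
  simp only [Finset.mem_filter] at hr ⊢
  exact ⟨hr.1, by rw [hr.2]; exact hc⟩

/-- Images whose 8-components are rectangles of width `a` with `b` full rows and `p` pixels in
the last row. -/
theorem exists_rect8 (a b p : ℕ) (ha : 1 ≤ a) (hp : p ≤ a) :
    ∃ W, maxCC adj8 W ≤ (a * b + p : ℕ) ∧
      ((a * b + p : ℕ) : ℝ) / ((a * b + p : ℕ) + (a + b + 1 : ℕ) + 1) ≤ density W := by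
  set A : ℤ := a + 1 with hA
  set M : ℤ := A * b + p with hM
  have hAb : 0 ≤ A * (b : ℤ) := mul_nonneg (by omega) (by omega)
  -- The final gap `a + 2 = A + 1` is the largest increment of the form along an edge direction, so
  -- no edge from a white residue wraps around.
  set N : ℤ := M + (a + 2) with hN
  have hNe : (N : ℝ) = (a * b + p : ℕ) + (a + b + 1 : ℕ) + 1 := by
    simp only [hN, hM, hA]
    push_cast
    ring
  have hcard := card_stripe (A := A) (b := b) (q := p) (N := N) (by omega) (by omega) (by omega)
    (by omega)
  have hcard' : ((Finset.Ico 0 N).filter fun r => stripe A M r ≠ 0).card = a * b + p := by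
    have : (A - 1) * (b : ℤ) + p = ((a * b + p : ℕ) : ℤ) := by simp only [hA]; push_cast; ring
    rw [this] at hcard
    exact_mod_cast hcard
  rw [← hNe]
  refine exists_of_residues {(1, 0), (0, 1), (1, 1), (-1, 1)} adj8_dirs 1 A N (by omega)
    (stripe A M) (fun r => (r % A, r / A)) (1, 0) (by simp) ?_
    (fun c hc => card_stripe_eq_le hc hcard'.le) hcard'.ge
  intro d hd r hr0 hrN hr hr'
  have hdiv := Int.mul_ediv_add_emod r A
  have hx0 := Int.emod_nonneg r (by omega : A ≠ 0)
  have hxA := Int.emod_lt_of_pos r (by omega : 0 < A)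
  obtain ⟨hrM, hra⟩ := stripe_ne_zero.1 hr
  refine ⟨stripe_eq_of_ne hr hr', ?_⟩
  replace hr' := (stripe_ne_zero.1 hr').2
  generalize r / A = y at *
  generalize r % A = x at *
  subst hdiv
  have hy1 : A * (y + 1) = A * y + A := by ring
  simp only [Finset.mem_insert, Finset.mem_singleton] at hd
  rcases hd with rfl | rfl | rfl | rfl
  · simp only [mul_one, mul_zero, add_zero, Prod.mk_add_mk] at *
    have e : (A * y + x + 1) % N = A * y + (x + 1) := by
      rw [Int.emod_eq_of_lt (by omega) (by omega), add_assoc]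
    obtain ⟨e1, e2⟩ := divMod_eq (A := A) (y := y) (x := x + 1) (by omega) (by omega)
    rw [e, e1, e2]
  · simp only [mul_one, mul_zero, zero_add, add_zero, Prod.mk_add_mk] at *
    have e : (A * y + x + A) % N = A * (y + 1) + x := by
      rw [Int.emod_eq_of_lt (by omega) (by omega), hy1]
      ring
    obtain ⟨e1, e2⟩ := divMod_eq (A := A) (y := y + 1) (x := x) (by omega) (by omega)
    rw [e, e1, e2]
  · simp only [mul_one, Prod.mk_add_mk] at *
    have e : (A * y + x + (1 + A)) % N = A * (y + 1) + (x + 1) := by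
      rw [Int.emod_eq_of_lt (by omega) (by omega), hy1]
      ring
    obtain ⟨e1, e2⟩ := divMod_eq (A := A) (y := y + 1) (x := x + 1) (by omega) (by omega)
    rw [e, e1, e2]
  · simp only [mul_one, one_mul, Prod.mk_add_mk] at *
    -- From the first column the step `(-1, 1)` lands on the separating residue `A - 1`, which is
    -- black.
    rcases eq_or_lt_of_le hx0 with hx | hx
    · exfalso
      have e : (A * y + x + (-1 + A)) % N = A * y + (A - 1) := by
        rw [Int.emod_eq_of_lt (by omega) (by omega)]
        omega
      obtain ⟨e1, e2⟩ := divMod_eq (A := A) (y := y) (x := A - 1) (by omega) (by omega)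
      rw [e] at hr'
      exact hr' e2
    · have e : (A * y + x + (-1 + A)) % N = A * (y + 1) + (x + -1) := by
        rw [Int.emod_eq_of_lt (by omega) (by omega), hy1]
        ring
      obtain ⟨e1, e2⟩ := divMod_eq (A := A) (y := y + 1) (x := x + -1) (by omega) (by omega)
      rw [e, e1, e2]

/-- Images whose 4-components are diagonal rectangles with sides `2 a` and `2 b`, possibly with
some pixels of one side removed. -/
theorem exists_rect4 (a b m : ℕ) (ha : 1 ≤ a) (hb : 1 ≤ b) (hm : m ≤ b) :
    ∃ W, maxCC adj4 W ≤ (2 * a * b - m : ℕ) ∧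
      ((2 * a * b - m : ℕ) : ℝ) / ((2 * a * b - m : ℕ) + (a + b : ℕ)) ≤ density W := by
  set A : ℤ := 2 * b + 1 with hA
  -- There are `a - 1` periods with `2 * b` white residues and a black separator, then one period in
  -- which `m` white residues are omitted.
  set M : ℤ := A * ((a : ℤ) - 1) + (2 * b - m) with hM
  have hAb : 0 ≤ A * ((a : ℤ) - 1) := mul_nonneg (by omega) (by omega)
  have hmle : m ≤ 2 * a * b := by nlinarith
  set N : ℤ := M + (b + 1) with hN
  have hNe : (N : ℝ) = (2 * a * b - m : ℕ) + (a + b : ℕ) := by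
    simp only [hN, hM, hA]
    push_cast [Nat.cast_sub hmle]
    ring
  have hcard := card_stripe (A := A) (b := (a : ℤ) - 1) (q := 2 * b - m) (N := N) (by omega)
    (by omega) (by omega) (by omega)
  have hcard' : ((Finset.Ico 0 N).filter fun r => stripe A M r ≠ 0).card = 2 * a * b - m := by
    have : (A - 1) * ((a : ℤ) - 1) + (2 * b - m) = ((2 * a * b - m : ℕ) : ℤ) := by
      simp only [hA]; push_cast [Nat.cast_sub hmle]; ring
    rw [this] at hcard
    exact Int.ofNat_inj.1 hcard
  rw [← hNe]
  -- The step `(1, 1)` adds `A` and `(-1, 1)` adds `1`. In the period `y`, the first `b` residues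
  -- lie on the diagonal `du = 2 * y` and the next `b` on `du = 2 * y + 1`. The gap `b + 1` above
  -- `M` prevents wrapping around.
  refine exists_of_residues {(1, 0), (0, 1)} adj4_dirs b (b + 1) N (by omega)
    (stripe A M) (fun r => if r % A < b then (r / A + (b - 1 - r % A), r / A - (b - 1 - r % A))
      else (r / A + (2 * b - 1 - r % A) + 1, r / A - (2 * b - 1 - r % A))) (-1, 1)
    (by congr 1; ring) ?_
    (fun c hc => card_stripe_eq_le hc hcard'.le) hcard'.ge
  intro d hd r hr0 hrN hr hr'
  have hdiv := Int.mul_ediv_add_emod r A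
  have hx0 := Int.emod_nonneg r (by omega : A ≠ 0)
  have hxA := Int.emod_lt_of_pos r (by omega : 0 < A)
  obtain ⟨hrM, hra⟩ := stripe_ne_zero.1 hr
  refine ⟨stripe_eq_of_ne hr hr', ?_⟩
  replace hr' := (stripe_ne_zero.1 hr').2
  generalize r / A = y at *
  generalize r % A = x at *
  subst hdiv
  have hy1 : A * (y + 1) = A * y + A := by ring
  simp only [Finset.mem_insert, Finset.mem_singleton] at hd
  rcases hd with rfl | rfl
  · simp only [mul_one, mul_zero, add_zero] at *
    have e0 : (A * y + x + b) % N = A * y + x + b :=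
      Int.emod_eq_of_lt (by omega) (by omega)
    rw [e0] at hr'
    rw [e0]
    rcases lt_or_ge x (b : ℤ) with hx | hx
    · have e : A * y + x + b = A * y + (x + b) := by ring
      obtain ⟨e1, e2⟩ := divMod_eq (A := A) (y := y) (x := x + b) (by omega) (by omega)
      rw [e, e1, e2, if_pos hx, if_neg (by omega)]
      ext <;> simp <;> ring
    · rcases eq_or_lt_of_le hx with hx' | hx'
      · exfalso
        have e : A * y + x + b = A * y + (x + b) := by ring
        obtain ⟨e1, e2⟩ := divMod_eq (A := A) (y := y) (x := x + b) (by omega) (by omega)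
        rw [e, e2] at hr'
        omega
      · have e : A * y + x + b = A * (y + 1) + (x - b - 1) := by rw [hy1]; omega
        obtain ⟨e1, e2⟩ := divMod_eq (A := A) (y := y + 1) (x := x - b - 1) (by omega) (by omega)
        rw [e, e1, e2, if_pos (by omega), if_neg (by omega)]
        ext <;> simp <;> ring
  · simp only [mul_one, mul_zero, zero_add] at *
    have e0 : (A * y + x + (b + 1)) % N = A * y + x + (b + 1) :=
      Int.emod_eq_of_lt (by omega) (by omega)
    rw [e0] at hr'
    rw [e0]
    rcases lt_or_ge x (b : ℤ) with hx | hx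
    · have e : A * y + x + (b + 1) = A * y + (x + b + 1) := by ring
      obtain ⟨e1, e2⟩ := divMod_eq (A := A) (y := y) (x := x + b + 1) (by omega) (by omega)
      rw [e, e2] at hr'
      rw [e, e1, e2, if_pos hx, if_neg (by omega)]
      ext <;> simp <;> ring
    · have e : A * y + x + (b + 1) = A * (y + 1) + (x - b) := by rw [hy1]; omega
      obtain ⟨e1, e2⟩ := divMod_eq (A := A) (y := y + 1) (x := x - b) (by omega) (by omega)
      rw [e, e1, e2, if_pos (by omega), if_neg (by omega)]
      ext <;> simp <;> ring


/-! ### Images given by a table -/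

/-- Entry of a table of colours and positions. -/
def entry (tab : List (ℕ × ℤ × ℤ)) (r : ℕ) : ℕ × ℤ × ℤ := tab.getD r (0, 0, 0)

/-- The steps to the right and upwards in a table for the linear form `x + β y` modulo `N` keep
colours and change positions accordingly. -/
def TableStep (N β : ℕ) (tab : List (ℕ × ℤ × ℤ)) : Prop :=
  ∀ r < N, (entry tab r).1 ≠ 0 →
    ((entry tab ((r + 1) % N)).1 ≠ 0 →
      (entry tab ((r + 1) % N)).1 = (entry tab r).1 ∧
        (entry tab ((r + 1) % N)).2 = (entry tab r).2 + (1, 0)) ∧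
    ((entry tab ((r + β) % N)).1 ≠ 0 →
      (entry tab ((r + β) % N)).1 = (entry tab r).1 ∧
        (entry tab ((r + β) % N)).2 = (entry tab r).2 + (0, 1))

instance (N β : ℕ) (tab : List (ℕ × ℤ × ℤ)) : Decidable (TableStep N β tab) := by
  unfold TableStep; infer_instance

theorem exists_of_table (N β : ℕ) (hN : 0 < N) (tab : List (ℕ × ℤ × ℤ)) {j k B : ℕ}
    (hstep : TableStep N β tab) (hB : ∀ r < N, (entry tab r).1 < B)
    (hk : ∀ c < B, c ≠ 0 → ((Finset.range N).filter fun r => (entry tab r).1 = c).card ≤ k)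
    (hj : j ≤ ((Finset.range N).filter fun r => (entry tab r).1 ≠ 0).card) :
    ∃ W, maxCC adj4 W ≤ k ∧ (j : ℝ) / N ≤ density W := by
  have hNZ : (0 : ℤ) < N := by exact_mod_cast hN
  have := exists_of_residues {(1, 0), (0, 1)} adj4_dirs 1 β N hNZ
    (fun r => (entry tab r.toNat).1) (fun r => (entry tab r.toNat).2) (1, 0) (by simp)
    (j := j) (k := k) ?_ ?_ ?_
  · simpa using this
  · intro d hd r hr0 hrN
    lift r to ℕ using hr0
    obtain hr : r < N := by exact_mod_cast hrN
    simp only [Finset.mem_insert, Finset.mem_singleton] at hd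
    rcases hd with rfl | rfl
    · have e : ((r : ℤ) + (1 * (1, (0 : ℤ)).1 + β * ((1 : ℤ), (0 : ℤ)).2)) % N
          = (((r + 1) % N : ℕ) : ℤ) := by push_cast; simp
      rw [e, Int.toNat_natCast, Int.toNat_natCast]
      exact fun h => (hstep r hr h).1
    · have e : ((r : ℤ) + (1 * (0, (1 : ℤ)).1 + β * ((0 : ℤ), (1 : ℤ)).2)) % N
          = (((r + β) % N : ℕ) : ℤ) := by push_cast; simp
      rw [e, Int.toNat_natCast, Int.toNat_natCast]
      exact fun h => (hstep r hr h).2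
  · intro c hc
    have hle : ((Finset.Ico (0 : ℤ) N).filter fun r => (entry tab r.toNat).1 = c).card ≤
        ((Finset.range N).filter fun r => (entry tab r).1 = c).card := by
      refine Finset.card_le_card_of_injOn Int.toNat ?_ ?_
      · intro r hr
        simp only [Finset.coe_filter, Finset.mem_Ico, Set.mem_ofPred_eq] at hr
        simp only [Finset.coe_filter, Finset.mem_range, Set.mem_ofPred_eq]
        exact ⟨by omega, hr.2⟩
      · intro r hr r' hr' h
        simp only [Finset.coe_filter, Finset.mem_Ico, Set.mem_ofPred_eq] at hr hr'
        omega
    rcases Nat.lt_or_ge c B with hcB | hcB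
    · exact hle.trans (hk c hcB hc)
    · refine hle.trans ?_
      rw [Finset.card_eq_zero.2 (Finset.filter_eq_empty_iff.2 fun r hr => ?_)]
      · exact Nat.zero_le _
      · have := hB r (Finset.mem_range.1 hr)
        omega
  · refine hj.trans (Finset.card_le_card_of_injOn (fun r : ℕ => (r : ℤ)) ?_ ?_)
    · intro r hr
      simp only [Finset.coe_filter, Finset.mem_range, Set.mem_ofPred_eq] at hr
      simp only [Finset.coe_filter, Finset.mem_Ico, Set.mem_ofPred_eq, Int.toNat_natCast]
      exact ⟨by omega, hr.2⟩
    · intro r _ r' _ h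
      exact Int.ofNat_inj.1 h

/-- Four L-trominoes and a single pixel in a period of 24 pixels. -/
def table24 : List (ℕ × ℤ × ℤ) :=
  [(0, 0, 0), (1, 0, 0), (1, 1, 0), (0, 0, 0), (2, 0, 0), (0, 0, 0), (1, 0, -1),
   (0, 0, 0), (3, 0, 0), (0, 0, 0), (4, 0, 0), (0, 0, 0), (3, -1, -1), (3, 0, -1),
   (0, 0, 0), (4, 0, -1), (4, 1, -1), (0, 0, 0), (0, 0, 0), (5, 0, 0), (0, 0, 0),
   (0, 0, 0), (2, -1, 1), (2, 0, 1)]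

/-- Seven components of sizes 10, 10, 8, 8, 10, 10, 5 in a period of 90 pixels. -/
def table90 : List (ℕ × ℤ × ℤ) :=
  [(1, 0, 0), (0, 0, 0), (2, 0, 0), (2, 1, 0), (2, 2, 0), (0, 0, 0), (3, 0, 0),
   (0, 0, 0), (4, 0, 0), (4, 1, 0), (4, 2, 0), (0, 0, 0), (3, -2, -2), (3, -1, -2),
   (3, 0, -2), (0, 0, 0), (5, 0, 0), (0, 0, 0), (4, 2, -2), (0, 0, 0), (6, 0, 0),
   (0, 0, 0), (5, -2, -2), (5, -1, -2), (5, 0, -2), (5, 1, -2), (0, 0, 0), (6, -1, -2),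
   (6, 0, -2), (6, 1, -2), (6, 2, -2), (0, 0, 0), (0, 0, 0), (7, 0, 0), (7, 1, 0),
   (7, 2, 0), (0, 0, 0), (0, 0, 0), (1, -3, 1), (1, -2, 1), (1, -1, 1), (1, 0, 1),
   (0, 0, 0), (2, 0, 1), (2, 1, 1), (2, 2, 1), (2, 3, 1), (0, 0, 0), (1, -1, -1),
   (0, 0, 0), (4, 1, 1), (0, 0, 0), (2, 1, -1), (0, 0, 0), (3, -1, -1), (3, 0, -1),
   (3, 1, -1), (0, 0, 0), (4, 1, -1), (4, 2, -1), (4, 3, -1), (0, 0, 0), (3, -1, -3),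
   (0, 0, 0), (5, -1, -1), (5, 0, -1), (5, 1, -1), (0, 0, 0), (6, -1, -1), (6, 0, -1),
   (6, 1, -1), (0, 0, 0), (5, -1, -3), (5, 0, -3), (0, 0, 0), (7, 1, 1), (0, 0, 0),
   (6, 0, -3), (6, 1, -3), (0, 0, 0), (1, -2, 2), (1, -1, 2), (0, 0, 0), (7, 1, -1),
   (0, 0, 0), (2, 1, 2), (2, 2, 2), (0, 0, 0), (1, -2, 0), (1, -1, 0)]

theorem exists_density_13_24 : ∃ W, maxCC adj4 W ≤ (3 : ℕ) ∧ (13 / 24 : ℝ) ≤ density W := by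
  have := exists_of_table 24 19 (by norm_num) table24 (j := 13) (k := 3) (B := 6)
    (by decide +kernel) (by decide +kernel) (by decide +kernel) (by decide +kernel)
  exact_mod_cast this

theorem exists_density_61_90 : ∃ W, maxCC adj4 W ≤ (10 : ℕ) ∧ (61 / 90 : ℝ) ≤ density W := by
  have := exists_of_table 90 41 (by norm_num) table90 (j := 61) (k := 10) (B := 8)
    (by decide +kernel) (by decide +kernel) (by decide +kernel) (by decide +kernel)
  exact_mod_cast this

/-! ### Diamonds -/

/-- Images whose 4-components are balls of the `ℓ₁` metric. -/
theorem exists_diamond (n : ℕ) (hn : 1 ≤ n) :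
    ∃ W, maxCC adj4 W ≤ (2 * n ^ 2 - 2 * n + 1 : ℕ) ∧
      ((2 * n ^ 2 - 2 * n + 1 : ℕ) : ℝ) / (2 * n ^ 2 : ℕ) ≤ density W := by
  classical
  have hn0 : (0 : ℤ) < 2 * n := by omega
  have hnn : 2 * n ≤ 2 * n ^ 2 := by nlinarith
  set W : Set (ℤ × ℤ) := {p | du p % (2 * n) ≠ 0 ∧ dw p % (2 * n) ≠ 0} with hW
  refine ⟨W, ?_, ?_⟩
  · have hstep : ∀ a b : ℤ, a % (2 * n) ≠ 0 → b % (2 * n) ≠ 0 → |a - b| ≤ 1 →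
        a / (2 * n) = b / (2 * n) := by
      intro a b ha hb hab
      rw [abs_le] at hab
      have a1 := Int.mul_ediv_add_emod a (2 * n)
      have b1 := Int.mul_ediv_add_emod b (2 * n)
      have a2 := Int.emod_nonneg a hn0.ne'
      have b2 := Int.emod_nonneg b hn0.ne'
      have a3 := Int.emod_lt_of_pos a hn0
      have b3 := Int.emod_lt_of_pos b hn0
      by_contra hne
      rcases lt_or_gt_of_ne hne with h | h
      · have : 2 * (n : ℤ) * (a / (2 * n) + 1) ≤ 2 * n * (b / (2 * n)) :=
          mul_le_mul_of_nonneg_left (by omega) hn0.le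
        rw [mul_add, mul_one] at this
        omega
      · have : 2 * (n : ℤ) * (b / (2 * n) + 1) ≤ 2 * n * (a / (2 * n)) :=
          mul_le_mul_of_nonneg_left (by omega) hn0.le
        rw [mul_add, mul_one] at this
        omega
    refine maxCC_le_of_label (fun p => (du p / (2 * n), dw p / (2 * n)))
      (fun x hx y hy h => ?_)
      -- Pixels are recovered from their two diagonal indices. Pairs of odd sum produce rounded
      -- points, and the filter keeps only pixels inside the cell.
      (fun l => ((Finset.Icc (2 * n * l.1 + 1) (2 * n * l.1 + (2 * n - 1)) ×ˢ
        Finset.Icc (2 * n * l.2 + 1) (2 * n * l.2 + (2 * n - 1))).image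
          fun q : ℤ × ℤ => ((q.1 + q.2) / 2, (q.1 - q.2) / 2)).filter fun p =>
          (2 * n * l.1 + 1 ≤ du p ∧ du p ≤ 2 * n * l.1 + (2 * n - 1)) ∧
          (2 * n * l.2 + 1 ≤ dw p ∧ dw p ≤ 2 * n * l.2 + (2 * n - 1))) ?_ ?_
    · rw [hstep _ _ hx.1 hy.1 (du_adj x y h), hstep _ _ hx.2 hy.2 (dw_adj x y h)]
    · intro x hx
      have hx' : du x % (2 * n) ≠ 0 ∧ dw x % (2 * n) ≠ 0 := hx
      have a1 := Int.mul_ediv_add_emod (du x) (2 * n)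
      have b1 := Int.mul_ediv_add_emod (dw x) (2 * n)
      have a2 := Int.emod_nonneg (du x) hn0.ne'
      have b2 := Int.emod_nonneg (dw x) hn0.ne'
      have a3 := Int.emod_lt_of_pos (du x) hn0
      have b3 := Int.emod_lt_of_pos (dw x) hn0
      rw [Finset.mem_filter, Finset.mem_image]
      refine ⟨⟨(du x, dw x), ?_, ?_⟩, ?_⟩
      · simp only [Finset.mem_product, Finset.mem_Icc]
        omega
      · ext <;> simp only [du, dw] <;> omega
      · dsimp only
        omega
    · intro x _
      have h := two_mul_card_le (C := ((Finset.Icc (2 * n * (du x / (2 * n)) + 1)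
        (2 * n * (du x / (2 * n)) + (2 * n - 1)) ×ˢ Finset.Icc (2 * n * (dw x / (2 * n)) + 1)
        (2 * n * (dw x / (2 * n)) + (2 * n - 1))).image
          fun q : ℤ × ℤ => ((q.1 + q.2) / 2, (q.1 - q.2) / 2)).filter fun p =>
          (2 * n * (du x / (2 * n)) + 1 ≤ du p ∧ du p ≤ 2 * n * (du x / (2 * n)) + (2 * n - 1)) ∧
          (2 * n * (dw x / (2 * n)) + 1 ≤ dw p ∧ dw p ≤ 2 * n * (dw x / (2 * n)) + (2 * n - 1)))
        (by omega) (by omega) (fun p hp => (Finset.mem_filter.1 hp).2)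
      have e : ∀ t : ℤ, t + (2 * n - 1) - (t + 1) + 1 = 2 * (n : ℤ) - 1 := fun t => by ring
      rw [e, e] at h
      zify [hnn]
      linarith
  · set V : Finset (ℤ × ℤ) := Finset.Ico 0 (2 * (n : ℤ)) ×ˢ Finset.Ico 0 (n : ℤ) with hV
    have hVc : V.card = 2 * n ^ 2 := by
      rw [hV, Finset.card_product, Int.card_Ico, Int.card_Ico]
      have h1 : (2 * (n : ℤ) - 0).toNat = 2 * n := by omega
      have h2 : ((n : ℤ) - 0).toNat = n := by omega
      rw [h1, h2]
      ring
    rw [← hVc]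
    refine le_density_of_shifts V (Finset.card_pos.1 (by omega)) fun x => ?_
    have hsplit : (V.filter fun v => x + v ∈ W).card + (V.filter fun v => ¬ x + v ∈ W).card
        = V.card := Finset.card_filter_add_card_filter_not _
    set g1 : ℤ → ℤ × ℤ := fun k => ((-(du x + k)) % (2 * n), k)
    set g2 : ℤ → ℤ × ℤ := fun k => ((-(dw x - k)) % (2 * n), k)
    -- Each of the `n` rows of the window meets each family of black diagonals once. In the row
    -- whose height is divisible by `n` the two black pixels coincide, so at most `2 * n - 1` are
    -- black.
    have hblack : (V.filter fun v => ¬ x + v ∈ W) ⊆ (Finset.Ico 0 (n : ℤ)).image g1 ∪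
        ((Finset.Ico 0 (n : ℤ)).erase ((-x.2) % n)).image g2 := by
      intro v hv
      obtain ⟨hvV, hvW⟩ := Finset.mem_filter.1 hv
      rw [hV, Finset.mem_product, Finset.mem_Ico, Finset.mem_Ico] at hvV
      have hvW' : du (x + v) % (2 * n) = 0 ∨ dw (x + v) % (2 * n) = 0 := by
        by_contra hc
        rw [not_or] at hc
        exact hvW hc
      have hres : ∀ t, (t + v.1) % (2 * n) = 0 → (-t) % (2 * n) = v.1 := by
        intro t ht
        obtain ⟨c, hc⟩ := Int.dvd_of_emod_eq_zero ht
        rw [show -t = v.1 + (2 * n) * (-c) by linear_combination -hc, Int.add_mul_emod_self_left]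
        exact Int.emod_eq_of_lt hvV.1.1 hvV.1.2
      have hu : du (x + v) = du x + v.2 + v.1 := by simp only [du, Prod.fst_add, Prod.snd_add]; ring
      have hw : dw (x + v) = dw x - v.2 + v.1 := by simp only [dw, Prod.fst_add, Prod.snd_add]; ring
      rw [hu, hw] at hvW'
      rw [Finset.mem_union, Finset.mem_image, Finset.mem_image]
      by_cases h1 : (du x + v.2 + v.1) % (2 * n) = 0
      · exact Or.inl ⟨v.2, Finset.mem_Ico.2 hvV.2, Prod.ext (hres _ h1) rfl⟩
      · have h2 := hvW'.resolve_left h1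
        refine Or.inr ⟨v.2, ?_, Prod.ext (hres _ h2) rfl⟩
        rw [Finset.mem_erase, Finset.mem_Ico]
        refine ⟨fun h => h1 ?_, hvV.2⟩
        have h3 : (x.2 + v.2) % n = 0 := by
          rw [h, Int.add_emod_emod, add_neg_cancel, Int.zero_emod]
        obtain ⟨c, hc⟩ := Int.dvd_of_emod_eq_zero h2
        obtain ⟨c', hc'⟩ := Int.dvd_of_emod_eq_zero h3
        refine Int.emod_eq_zero_of_dvd ⟨c + c', ?_⟩
        simp only [du, dw] at hc ⊢
        linear_combination hc + 2 * hc'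
    have hbc := (Finset.card_le_card hblack).trans (Finset.card_union_le _ _)
    have hk0 : (-x.2) % n ∈ Finset.Ico 0 (n : ℤ) := by
      rw [Finset.mem_Ico]
      exact ⟨Int.emod_nonneg _ (by omega), Int.emod_lt_of_pos _ (by omega)⟩
    have c1 : ((Finset.Ico 0 (n : ℤ)).image g1).card ≤ n :=
      Finset.card_image_le.trans (by rw [Int.card_Ico]; omega)
    have c2 : (((Finset.Ico 0 (n : ℤ)).erase ((-x.2) % n)).image g2).card ≤ n - 1 :=
      Finset.card_image_le.trans (by rw [Finset.card_erase_of_mem hk0, Int.card_Ico]; omega)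
    have hgoal : V.card - 2 * n + 1 ≤ (V.filter fun v => x + v ∈ W).card := by omega
    convert hgoal


/-! ### The functions `F₈` and `F₄` -/

theorem le_sSup_image_Icc_iff (f : ℕ → ℝ) {k : ℕ} (hk : 1 ≤ k) (d : ℝ) :
    d ≤ sSup (f '' Set.Icc 1 k) ↔ ∃ j, 1 ≤ j ∧ j ≤ k ∧ d ≤ f j := by
  have hfin : (f '' Set.Icc 1 k).Finite := (Set.finite_Icc 1 k).image f
  have hne : (f '' Set.Icc 1 k).Nonempty := ⟨f 1, 1, ⟨le_rfl, hk⟩, rfl⟩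
  constructor
  · intro h
    obtain ⟨j, hj, hjs⟩ := hne.csSup_mem hfin
    exact ⟨j, hj.1, hj.2, hjs ▸ h⟩
  · rintro ⟨j, h1, h2, h3⟩
    exact h3.trans (le_csSup hfin.bddAbove ⟨j, ⟨h1, h2⟩, rfl⟩)

theorem le_F8_iff {k : ℕ} (hk : 1 ≤ k) (d : ℝ) :
    d ≤ F8 k ↔ ∃ j, 1 ≤ j ∧ j ≤ k ∧ d ≤ f8 j := le_sSup_image_Icc_iff f8 hk d

theorem le_F4_iff {k : ℕ} (hk : 1 ≤ k) (d : ℝ) :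
    d ≤ F4 k ↔ ∃ j, 1 ≤ j ∧ j ≤ k ∧ d ≤ f4 j := le_sSup_image_Icc_iff f4 hk d

theorem div_add_le_div_add {j a b : ℝ} (hj : 0 < j) (ha : 0 ≤ a) (hab : a ≤ b) :
    j / (j + b) ≤ j / (j + a) :=
  div_le_div_of_nonneg_left hj.le (by linarith) (by linarith)

theorem le_f8 {j s : ℕ} (hj : 1 ≤ j) (h : 4 * j ≤ s ^ 2) :
    (j : ℝ) / (j + (s + 1)) ≤ f8 j := by
  have hj' : (0 : ℝ) < j := by exact_mod_cast hj
  have hs : ⌈2 * Real.sqrt (j : ℝ)⌉ ≤ (s : ℤ) := by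
    rw [Int.ceil_le]
    push_cast
    have h' : (4 : ℝ) * j ≤ s ^ 2 := by exact_mod_cast h
    have : Real.sqrt (j : ℝ) ≤ s / 2 := by
      rw [Real.sqrt_le_left (by positivity)]
      linarith
    linarith
  have hs' : (⌈2 * Real.sqrt (j : ℝ)⌉ : ℝ) ≤ s := by exact_mod_cast hs
  rw [f8, add_assoc]
  exact div_add_le_div_add hj' (by linarith [ceil8_nonneg j]) (by linarith)

theorem le_f4 {j s : ℕ} (hj : 1 ≤ j) (h : 8 * j ≤ s ^ 2 + 4) :
    (j : ℝ) / (j + s / 2) ≤ f4 j := by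
  have hj' : (0 : ℝ) < j := by exact_mod_cast hj
  have hs : ⌈2 * Real.sqrt (2 * (j : ℝ) - 1)⌉ ≤ (s : ℤ) := by
    rw [Int.ceil_le]
    push_cast
    have h' : (8 : ℝ) * j ≤ s ^ 2 + 4 := by exact_mod_cast h
    have : Real.sqrt (2 * (j : ℝ) - 1) ≤ s / 2 := by
      rw [Real.sqrt_le_left (by positivity)]
      linarith
    linarith
  have hs' : (⌈2 * Real.sqrt (2 * (j : ℝ) - 1)⌉ : ℝ) ≤ s := by exact_mod_cast hs
  rw [f4]
  exact div_add_le_div_add hj' (by linarith [ceil4_nonneg j]) (by linarith)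

theorem f4_le {j s : ℕ} (hj : 1 ≤ j) (h : (s : ℝ) ^ 2 < 4 * (2 * j - 1)) :
    f4 j ≤ (j : ℝ) / (j + (s + 1) / 2) := by
  have hj' : (0 : ℝ) < j := by exact_mod_cast hj
  have hs : (s : ℤ) + 1 ≤ ⌈2 * Real.sqrt (2 * (j : ℝ) - 1)⌉ := by
    rw [Int.add_one_le_iff, Int.lt_ceil]
    push_cast
    have : (s : ℝ) / 2 < Real.sqrt (2 * (j : ℝ) - 1) := by
      rw [Real.lt_sqrt (by positivity)]
      linarith
    linarith
  have hs' : (s : ℝ) + 1 ≤ (⌈2 * Real.sqrt (2 * (j : ℝ) - 1)⌉ : ℝ) := by exact_mod_cast hs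
  rw [f4]
  exact div_add_le_div_add hj' (by positivity) (by linarith)

/-- For `j = n ^ 2` the bound is at least `n ^ 2 / (n + 1) ^ 2`, which tends to one. -/
theorem exists_le_f8 {d : ℝ} (hd : d < 1) : ∃ j, 1 ≤ j ∧ d ≤ f8 j := by
  obtain ⟨n, hn⟩ := exists_nat_gt (2 / (1 - d))
  have hd' : 0 < 1 - d := by linarith
  rw [div_lt_iff₀ hd'] at hn
  have hn0 : 1 ≤ n := by
    by_contra hc
    have : n = 0 := by omega
    rw [this] at hn
    norm_num at hn
  have hn1 : (1 : ℝ) ≤ n := by exact_mod_cast hn0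
  refine ⟨n ^ 2, by nlinarith, le_trans ?_ (le_f8 (s := 2 * n) (by nlinarith) (by nlinarith))⟩
  push_cast
  rw [le_div_iff₀ (by positivity)]
  nlinarith

theorem exists_le_f4 {d : ℝ} (hd : d < 1) : ∃ j, 1 ≤ j ∧ d ≤ f4 j := by
  obtain ⟨n, hn⟩ := exists_nat_gt (2 / (1 - d))
  have hd' : 0 < 1 - d := by linarith
  rw [div_lt_iff₀ hd'] at hn
  have hn0 : 1 ≤ n := by
    by_contra hc
    have : n = 0 := by omega
    rw [this] at hn
    norm_num at hn
  have hn1 : (1 : ℝ) ≤ n := by exact_mod_cast hn0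
  refine ⟨2 * n ^ 2, by nlinarith, le_trans ?_ (le_f4 (s := 4 * n) (by nlinarith) (by nlinarith))⟩
  push_cast
  rw [le_div_iff₀ (by positivity)]
  nlinarith

theorem isLeast_F8inv {d : ℝ} (hd : d < 1) : IsLeast {k : ℕ | 1 ≤ k ∧ d ≤ F8 k} (F8inv d) := by
  have hne : {k : ℕ | 1 ≤ k ∧ d ≤ F8 k}.Nonempty := by
    obtain ⟨j, hj, hjd⟩ := exists_le_f8 hd
    exact ⟨j, hj, (le_F8_iff hj d).2 ⟨j, hj, le_rfl, hjd⟩⟩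
  exact ⟨Nat.sInf_mem hne, fun k hk => Nat.sInf_le hk⟩

theorem isLeast_F4inv {d : ℝ} (hd : d < 1) : IsLeast {k : ℕ | 1 ≤ k ∧ d ≤ F4 k} (F4inv d) := by
  have hne : {k : ℕ | 1 ≤ k ∧ d ≤ F4 k}.Nonempty := by
    obtain ⟨j, hj, hjd⟩ := exists_le_f4 hd
    exact ⟨j, hj, (le_F4_iff hj d).2 ⟨j, hj, le_rfl, hjd⟩⟩
  exact ⟨Nat.sInf_mem hne, fun k hk => Nat.sInf_le hk⟩

theorem F8inv_le {d : ℝ} {j : ℕ} (hj : 1 ≤ j) (h : d ≤ f8 j) : F8inv d ≤ j :=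
  Nat.sInf_le ⟨hj, (le_F8_iff hj d).2 ⟨j, hj, le_rfl, h⟩⟩

theorem F4inv_le {d : ℝ} {j : ℕ} (hj : 1 ≤ j) (h : d ≤ f4 j) : F4inv d ≤ j :=
  Nat.sInf_le ⟨hj, (le_F4_iff hj d).2 ⟨j, hj, le_rfl, h⟩⟩

theorem one_le_F8inv {d : ℝ} (hd : d < 1) : 1 ≤ F8inv d := (isLeast_F8inv hd).1.1

theorem one_le_F4inv {d : ℝ} (hd : d < 1) : 1 ≤ F4inv d := (isLeast_F4inv hd).1.1

/-- By minimality, the maximum defining `F8` at this point first reaches `d` at its last index. -/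
theorem le_f8_F8inv {d : ℝ} (hd : d < 1) : d ≤ f8 (F8inv d) := by
  obtain ⟨j, h1, h2, h3⟩ := (le_F8_iff (one_le_F8inv hd) d).1 (isLeast_F8inv hd).1.2
  rwa [le_antisymm (F8inv_le h1 h3) h2]

theorem le_f4_F4inv {d : ℝ} (hd : d < 1) : d ≤ f4 (F4inv d) := by
  obtain ⟨j, h1, h2, h3⟩ := (le_F4_iff (one_le_F4inv hd) d).1 (isLeast_F4inv hd).1.2
  rwa [le_antisymm (F4inv_le h1 h3) h2]

/-- Dropping the ceiling with `r = √k` and `q = 1 - d` gives `2 * r + 1 ≤ q * (r + 1) ^ 2`. The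
claim `4 - 6 * q ≤ r ^ 2 * q ^ 2`, multiplied by `(r + 1) ^ 4`, then reduces to the polynomial
inequality `h8`. -/
theorem F8inv_ge {d : ℝ} (hd : d < 1) : 4 / (1 - d) ^ 2 - 6 / (1 - d) ≤ F8inv d := by
  have h := le_f8_F8inv hd
  have h1 := one_le_F8inv hd
  generalize F8inv d = k at *
  have hk : (1 : ℝ) ≤ k := by exact_mod_cast h1
  set r := Real.sqrt (k : ℝ) with hr
  have hr0 : 0 ≤ r := Real.sqrt_nonneg _
  have hrk : r ^ 2 = k := Real.sq_sqrt (by linarith)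
  have hceil : 2 * r ≤ (⌈2 * Real.sqrt (k : ℝ)⌉ : ℝ) := Int.le_ceil _
  have h2 : d ≤ (k : ℝ) / (k + (2 * r + 1)) := by
    refine h.trans ?_
    rw [f8, add_assoc]
    exact div_add_le_div_add (by linarith) (by linarith) (by linarith)
  rw [le_div_iff₀ (by positivity), ← hrk] at h2
  set q := 1 - d with hq
  have hq0 : 0 < q := by linarith
  have h3 : 2 * r + 1 ≤ q * (r + 1) ^ 2 := by
    have : d = 1 - q := by rw [hq]; ring
    rw [this] at h2
    nlinarith
  rw [← hrk]
  have h4 : 4 / q ^ 2 - 6 / q = (4 - 6 * q) / q ^ 2 := by field_simp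
  rw [h4, div_le_iff₀ (by positivity)]
  have ha : 0 < (r + 1) ^ 2 := by positivity
  set a := (r + 1) ^ 2 with hadef
  have h5 : (2 * r + 1) ^ 2 ≤ (q * a) ^ 2 := pow_le_pow_left₀ (by positivity) h3 2
  have h6 : r ^ 2 * (2 * r + 1) ^ 2 ≤ r ^ 2 * (q * a) ^ 2 :=
    mul_le_mul_of_nonneg_left h5 (by positivity)
  have h7 : (2 * r + 1) * a ≤ q * a * a := mul_le_mul_of_nonneg_right h3 ha.le
  have h8 : 4 * a ^ 2 ≤ r ^ 2 * (2 * r + 1) ^ 2 + 6 * ((2 * r + 1) * a) := by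
    rw [hadef]
    nlinarith [mul_nonneg hr0 hr0]
  have h9 : 0 ≤ (r ^ 2 * q ^ 2 + 6 * q - 4) * a ^ 2 := by nlinarith
  have h10 := nonneg_of_mul_nonneg_left h9 (by positivity : 0 < a ^ 2)
  linarith

theorem F4inv_ge {d : ℝ} (hd : d < 1) : 2 / (1 - d) ^ 2 - 4 / (1 - d) ≤ F4inv d := by
  have h := le_f4_F4inv hd
  have h1 := one_le_F4inv hd
  generalize F4inv d = k at *
  have hk : (1 : ℝ) ≤ k := by exact_mod_cast h1
  set r := Real.sqrt (2 * (k : ℝ) - 1) with hr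
  have hr1 : 1 ≤ r := by rw [hr, Real.one_le_sqrt]; linarith
  have hrk : r ^ 2 = 2 * k - 1 := Real.sq_sqrt (by linarith)
  have hceil : 2 * r ≤ (⌈2 * Real.sqrt (2 * (k : ℝ) - 1)⌉ : ℝ) := Int.le_ceil _
  have h2 : d ≤ (k : ℝ) / (k + r) := by
    refine h.trans ?_
    rw [f4]
    exact div_add_le_div_add (by linarith) (by linarith) (by linarith)
  have ha : 0 < (k : ℝ) + r := by linarith
  rw [le_div_iff₀ ha] at h2
  set q := 1 - d with hq
  have hq0 : 0 < q := by linarith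
  have h3 : r ≤ q * (k + r) := by
    have : d = 1 - q := by rw [hq]; ring
    rw [this] at h2
    linarith
  have h4 : 2 / q ^ 2 - 4 / q = (2 - 4 * q) / q ^ 2 := by field_simp
  rw [h4, div_le_iff₀ (by positivity)]
  set a := (k : ℝ) + r with hadef
  have h5 : r ^ 2 ≤ (q * a) ^ 2 := pow_le_pow_left₀ (by positivity) h3 2
  have h6 : k * r ^ 2 ≤ k * (q * a) ^ 2 := mul_le_mul_of_nonneg_left h5 (by positivity)
  have h7 : r * a ≤ q * a * a := mul_le_mul_of_nonneg_right h3 ha.le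
  have h8 : 2 * a ^ 2 ≤ k * r ^ 2 + 4 * (r * a) := by
    rw [hadef]
    nlinarith
  have h9 : 0 ≤ (k * q ^ 2 + 4 * q - 2) * a ^ 2 := by nlinarith
  have h10 := nonneg_of_mul_nonneg_left h9 (by positivity : 0 < a ^ 2)
  linarith

/-! ### Bounds for the guaranteed component size -/

theorem mgcs_le {G : SimpleGraph (ℤ × ℤ)} {d ρ : ℝ} {k : ℕ} (hd : d ≤ ρ)
    (h : ∃ W, maxCC G W ≤ k ∧ ρ ≤ density W) : mgcs G d ≤ k := by
  obtain ⟨W, h1, h2⟩ := h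
  have h3 : mgcs G d ≤ maxCC G W := sInf_le ⟨W, hd.trans h2, rfl⟩
  exact h3.trans h1

theorem le_mgcs {G : SimpleGraph (ℤ × ℤ)} {d : ℝ} {k : ℕ}
    (h : ∀ W, maxCC G W ≤ k → density W < d) : ((k + 1 : ℕ) : ℕ∞) ≤ mgcs G d := by
  refine le_sInf ?_
  rintro _ ⟨W, hW, rfl⟩
  by_contra hc
  rw [not_le] at hc
  have : maxCC G W ≤ k := by
    push_cast at hc
    exact Order.le_of_lt_add_one hc
  exact absurd (h W this) (not_lt.2 hW)

/-- Only finitely many sizes occur, so a single `ρ` strictly below `d` serves all of them; this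
makes the density bound strict. -/
theorem exists_bound_lt (f : ℕ → ℝ) {d : ℝ} (hd : 0 < d) {k : ℕ}
    (h : ∀ j, 1 ≤ j → j ≤ k → f j < d) : ∃ ρ, 0 < ρ ∧ ρ < d ∧ ∀ j, 1 ≤ j → j ≤ k → f j ≤ ρ := by
  induction k with
  | zero => exact ⟨d / 2, by linarith, by linarith, fun j h1 h2 => by omega⟩
  | succ k ih =>
    obtain ⟨ρ, h0, h1, h2⟩ := ih fun j hj hk => h j hj (by omega)
    refine ⟨max ρ (f (k + 1)), lt_max_of_lt_left h0, max_lt h1 (h _ (by omega) le_rfl), ?_⟩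
    intro j hj hjk
    rcases Nat.lt_or_ge j (k + 1) with hlt | hge
    · exact (h2 j hj (by omega)).trans (le_max_left _ _)
    · rw [le_antisymm hjk hge]
      exact le_max_right _ _

theorem le_C8 {d : ℝ} (hd : 0 < d) {k : ℕ} (h : ∀ j, 1 ≤ j → j ≤ k → f8 j < d) :
    ((k + 1 : ℕ) : ℕ∞) ≤ C8 d := by
  obtain ⟨ρ, h0, h1, h2⟩ := exists_bound_lt f8 hd h
  refine le_mgcs fun W hW => ?_
  obtain ⟨K⟩ := nonempty_comps hW
  exact (density_le_of_comps8 K h0.le h2).trans_lt h1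

theorem le_C4 {d : ℝ} (hd : 0 < d) {k : ℕ} (h : ∀ j, 1 ≤ j → j ≤ k → f4 j < d) :
    ((k + 1 : ℕ) : ℕ∞) ≤ C4 d := by
  obtain ⟨ρ, h0, h1, h2⟩ := exists_bound_lt f4 hd h
  refine le_mgcs fun W hW => ?_
  obtain ⟨K⟩ := nonempty_comps hW
  exact (density_le_of_comps4 K h0 h2).trans_lt h1

theorem exists_density_f8 {j : ℕ} (hj : 1 ≤ j) : ∃ W, maxCC adj8 W ≤ j ∧ f8 j ≤ density W := by
  obtain ⟨s, hs⟩ : ∃ s : ℕ, (s : ℤ) = ⌈2 * Real.sqrt (j : ℝ)⌉ :=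
    ⟨_, Int.toNat_of_nonneg (Int.ceil_nonneg (by positivity))⟩
  have hj' : (1 : ℝ) ≤ j := by exact_mod_cast hj
  have hsr : (⌈2 * Real.sqrt (j : ℝ)⌉ : ℝ) = s := by rw [← hs]; simp
  have hle : 2 * Real.sqrt (j : ℝ) ≤ s := hsr ▸ Int.le_ceil _
  have h4 : 4 * j ≤ s ^ 2 := by
    have h1 : (2 * Real.sqrt (j : ℝ)) ^ 2 ≤ (s : ℝ) ^ 2 := pow_le_pow_left₀ (by positivity) hle 2
    rw [mul_pow, Real.sq_sqrt (by positivity)] at h1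
    have : (4 : ℝ) * j ≤ s ^ 2 := by linarith
    exact_mod_cast this
  have hs2 : 2 ≤ s := by nlinarith
  -- The most balanced splitting of `s` into width and height: `4 * j ≤ s ^ 2` gives `j ≤ a * (s -
  -- a)`. Dividing `j - 1` instead of `j` by `a` keeps the last row nonempty.
  set a := s / 2 with ha
  have ha1 : 1 ≤ a := by omega
  have hjle : j ≤ a * (s - a) := by
    rcases Nat.even_or_odd' s with ⟨t, rfl | rfl⟩
    · have e1 : a = t := by omega
      have e2 : 2 * t - t = t := by omega
      rw [e1, e2]
      nlinarith
    · have e1 : a = t := by omega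
      have e2 : 2 * t + 1 - t = t + 1 := by omega
      rw [e1, e2]
      nlinarith
  have hb : (j - 1) / a + 1 ≤ s - a := by
    rw [Nat.succ_le_iff, Nat.div_lt_iff_lt_mul (by omega), mul_comm]
    omega
  have hdecomp : a * ((j - 1) / a) + ((j - 1) % a + 1) = j := by
    have := Nat.div_add_mod (j - 1) a
    omega
  have hmod : (j - 1) % a + 1 ≤ a := Nat.mod_lt _ (by omega)
  obtain ⟨W, h1, h2⟩ := exists_rect8 a ((j - 1) / a) ((j - 1) % a + 1) ha1 hmod
  rw [hdecomp] at h1 h2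
  refine ⟨W, h1, le_trans ?_ h2⟩
  rw [f8, hsr, add_assoc, add_assoc]
  have h5 : a + (j - 1) / a + 1 ≤ s := by omega
  have h6 : ((a + (j - 1) / a + 1 : ℕ) : ℝ) ≤ s := by exact_mod_cast h5
  exact div_add_le_div_add (by linarith) (by positivity) (by linarith)

theorem C8_eq {d : ℝ} (h0 : 0 < d) (h1 : d < 1) : C8 d = F8inv d := by
  have hk := one_le_F8inv h1
  refine le_antisymm (mgcs_le (le_f8_F8inv h1) (exists_density_f8 hk)) ?_
  have := le_C8 h0 (k := F8inv d - 1) fun j hj hjk => by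
    by_contra hc
    have := F8inv_le hj (not_lt.1 hc)
    omega
  rwa [Nat.sub_add_cancel hk] at this

theorem F4inv_le_C4 {d : ℝ} (h0 : 0 < d) (h1 : d < 1) : (F4inv d : ℕ∞) ≤ C4 d := by
  have hk := one_le_F4inv h1
  have := le_C4 h0 (k := F4inv d - 1) fun j hj hjk => by
    by_contra hc
    have := F4inv_le hj (not_lt.1 hc)
    omega
  rwa [Nat.sub_add_cancel hk] at this

/-- Among the component sizes `j ≤ j₀`, where `8 j₀ + 1 = s₀ ^ 2`, the bound `f4` is largest
at `j₀`. -/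
theorem f4_le_of_le {j j₀ s₀ : ℕ} (hj : 1 ≤ j) (hjj : j ≤ j₀) (h : 8 * j₀ + 1 = s₀ ^ 2)
    (hs₀ : 5 ≤ s₀) : f4 j ≤ (j₀ : ℝ) / (j₀ + s₀ / 2) := by
  obtain ⟨s, hs⟩ : ∃ s : ℕ, (s : ℤ) = ⌈2 * Real.sqrt (2 * (j : ℝ) - 1)⌉ :=
    ⟨_, Int.toNat_of_nonneg (Int.ceil_nonneg (by positivity))⟩
  have hj' : (1 : ℝ) ≤ j := by exact_mod_cast hj
  have hsr : (⌈2 * Real.sqrt (2 * (j : ℝ) - 1)⌉ : ℝ) = s := by rw [← hs]; simp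
  have hle : 2 * Real.sqrt (2 * (j : ℝ) - 1) ≤ s := hsr ▸ Int.le_ceil _
  have h8 : 8 * j ≤ s ^ 2 + 4 := by
    have h1 : (2 * Real.sqrt (2 * (j : ℝ) - 1)) ^ 2 ≤ (s : ℝ) ^ 2 :=
      pow_le_pow_left₀ (by positivity) hle 2
    rw [mul_pow, Real.sq_sqrt (by linarith)] at h1
    have : (8 : ℝ) * j ≤ s ^ 2 + 4 := by linarith
    exact_mod_cast this
  have hs2 : 2 ≤ s := by nlinarith
  -- The comparison amounts to `j / s ≤ j₀ / s₀`. It follows from `8 * j ≤ s ^ 2 + 4` when `5 ≤ s <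
  -- s₀`; smaller `s` are checked individually.
  have hkey : j * s₀ ≤ j₀ * s := by
    rcases Nat.lt_or_ge s s₀ with hlt | hge
    · rcases Nat.lt_or_ge s 5 with h5 | h5
      · interval_cases s
        · have : j ≤ 1 := by omega
          nlinarith
        · have : j ≤ 1 := by omega
          nlinarith
        · have : j ≤ 2 := by omega
          nlinarith
      · obtain ⟨t, rfl⟩ : ∃ t, s₀ = s + 1 + t := ⟨s₀ - (s + 1), by omega⟩
        have h9 : 8 * j * (s + 1 + t) ≤ (s ^ 2 + 4) * (s + 1 + t) := Nat.mul_le_mul_right _ h8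
        have h10 : 8 * j₀ * s + s = (s + 1 + t) ^ 2 * s := by rw [← h]; ring
        have h11 : 4 * (s + 1 + t) + s ≤ (s + 1 + t) * s * (1 + t) := by
          have h1 : (s + 1 + t) * 5 ≤ (s + 1 + t) * s := Nat.mul_le_mul_left _ h5
          have h2 : (s + 1 + t) * s * 1 ≤ (s + 1 + t) * s * (1 + t) :=
            Nat.mul_le_mul_left _ (by omega)
          omega
        have h12 : (s + 1 + t) ^ 2 * s = s ^ 2 * (s + 1 + t) + (s + 1 + t) * s * (1 + t) := by ring
        have h13 : (s ^ 2 + 4) * (s + 1 + t) = s ^ 2 * (s + 1 + t) + 4 * (s + 1 + t) := by ring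
        have h14 : 8 * j * (s + 1 + t) = 8 * (j * (s + 1 + t)) := by ring
        have h15 : 8 * j₀ * s = 8 * (j₀ * s) := by ring
        omega
    · exact Nat.mul_le_mul hjj hge
  have hkey' : (j : ℝ) * s₀ ≤ j₀ * s := by exact_mod_cast hkey
  have hj₀ : (1 : ℝ) ≤ j₀ := by exact_mod_cast hj.trans hjj
  rw [f4, hsr, div_le_div_iff₀ (by positivity) (by positivity)]
  linarith

/-- With `n = m + 1`, the left end is the value in `f4_le_of_le` for `j₀ = 2m² + m`, `s₀ = 4m + 1`,
so `k = F4inv d` exceeds `j₀`. The right end is the density of the diamond with `2m² + 2m + 1`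
pixels. In between the ceiling is at least `4m + 2`, and `k / (k + 2m + 1)` is attained by a
diagonal rectangle with sides `2m` and `2m + 2` lacking a few pixels, or by the diamond for the
largest `k`. -/
theorem C4_eq_of_diamond {n : ℕ} (hn : 2 ≤ n) {d : ℝ}
    (hd : d ∈ Set.Ioc ((4 * (n : ℝ) ^ 2 - 6 * n + 2) / (4 * (n : ℝ) ^ 2 - 2 * n - 1))
      ((((n : ℝ) - 1) ^ 2 + (n : ℝ) ^ 2) / (2 * (n : ℝ) ^ 2))) : C4 d = F4inv d := by
  obtain ⟨hd1, hd2⟩ := hd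
  obtain ⟨m, rfl⟩ : ∃ m, n = m + 1 := ⟨n - 1, by omega⟩
  have hm : 1 ≤ m := by omega
  have hm' : (1 : ℝ) ≤ m := by exact_mod_cast hm
  push_cast at hd1 hd2
  have hd1' : (2 * (m : ℝ) ^ 2 + m) / ((2 * (m : ℝ) ^ 2 + m) + (4 * m + 1) / 2) < d := by
    refine lt_of_eq_of_lt ?_ hd1
    have hden : 0 < 4 * ((m : ℝ) + 1) ^ 2 - 2 * ((m : ℝ) + 1) - 1 := by nlinarith
    rw [div_eq_div_iff (by positivity) hden.ne']
    ring
  have hd2' : d ≤ (2 * (m : ℝ) ^ 2 + 2 * m + 1) / ((2 * (m : ℝ) ^ 2 + 2 * m + 1) + (2 * m + 1)) := by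
    refine hd2.trans_eq ?_
    rw [div_eq_div_iff (by positivity) (by positivity)]
    ring
  have hd0 : 0 < d := lt_trans (by positivity) hd1'
  have hdlt : d < 1 := lt_of_le_of_lt hd2' (by rw [div_lt_one (by positivity)]; linarith)
  set k := F4inv d with hkdef
  have hk1 : 1 ≤ k := one_le_F4inv hdlt
  have hdk : d ≤ f4 k := le_f4_F4inv hdlt
  have hklow : 2 * m ^ 2 + m < k := by
    by_contra hc
    have := f4_le_of_le (s₀ := 4 * m + 1) hk1 (not_lt.1 hc) (by ring) (by omega)
    push_cast at this
    linarith
  have hkup : k ≤ 2 * m ^ 2 + 2 * m + 1 := by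
    refine F4inv_le (by omega) (hd2'.trans ?_)
    have := le_f4 (j := 2 * m ^ 2 + 2 * m + 1) (s := 4 * m + 2) (by omega) (by nlinarith)
    push_cast at this
    refine le_trans (le_of_eq ?_) this
    congr 2
    ring
  refine le_antisymm ?_ (F4inv_le_C4 hd0 hdlt)
  have hfk : f4 k ≤ (k : ℝ) / (k + (2 * m + 1)) := by
    have := f4_le (j := k) (s := 4 * m + 1) hk1 (by
      have : 2 * (m : ℝ) ^ 2 + m + 1 ≤ k := by exact_mod_cast hklow
      push_cast
      nlinarith)
    push_cast at this
    refine this.trans (le_of_eq ?_)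
    congr 2
    ring
  refine mgcs_le (hdk.trans hfk) ?_
  rcases eq_or_lt_of_le hkup with hk | hk
  · obtain ⟨W, h1, h2⟩ := exists_diamond (m + 1) (by omega)
    have e1 : 2 * (m + 1) ^ 2 - 2 * (m + 1) + 1 = k := by
      have : 2 * (m + 1) ^ 2 = 2 * m ^ 2 + 2 * m + 2 * (m + 1) := by ring
      omega
    rw [e1] at h1 h2
    refine ⟨W, h1, le_trans (le_of_eq ?_) h2⟩
    rw [hk]
    push_cast
    congr 1
    ring
  · obtain ⟨W, h1, h2⟩ := exists_rect4 m (m + 1) (2 * m ^ 2 + 2 * m - k) hm (by omega) (by omega)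
    have e1 : 2 * m * (m + 1) - (2 * m ^ 2 + 2 * m - k) = k := by
      have : 2 * m * (m + 1) = 2 * m ^ 2 + 2 * m := by ring
      omega
    rw [e1] at h1 h2
    refine ⟨W, h1, le_trans (le_of_eq ?_) h2⟩
    push_cast
    congr 2
    ring

/-- The same scheme with `j₀ = (2m + 1)(m + 1)` and `s₀ = 4m + 3`; here diagonal squares of side `2m
+ 2` with at most `m` pixels removed attain every `k`. -/
theorem C4_eq_of_square {n : ℕ} (hn : 2 ≤ n) {d : ℝ}
    (hd : d ∈ Set.Ioc ((4 * (n : ℝ) ^ 2 - 2 * n) / (4 * (n : ℝ) ^ 2 + 2 * n - 1))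
      ((n : ℝ) / ((n : ℝ) + 1))) : C4 d = F4inv d := by
  obtain ⟨hd1, hd2⟩ := hd
  obtain ⟨m, rfl⟩ : ∃ m, n = m + 1 := ⟨n - 1, by omega⟩
  have hm : 1 ≤ m := by omega
  have hm' : (1 : ℝ) ≤ m := by exact_mod_cast hm
  push_cast at hd1 hd2
  have hd1' : (2 * (m : ℝ) ^ 2 + 3 * m + 1) / ((2 * (m : ℝ) ^ 2 + 3 * m + 1) + (4 * m + 3) / 2)
      < d := by
    refine lt_of_eq_of_lt ?_ hd1
    have hden : 0 < 4 * ((m : ℝ) + 1) ^ 2 + 2 * ((m : ℝ) + 1) - 1 := by nlinarith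
    rw [div_eq_div_iff (by positivity) hden.ne']
    ring
  have hd2' : d ≤ (2 * (m : ℝ) ^ 2 + 4 * m + 2) / ((2 * (m : ℝ) ^ 2 + 4 * m + 2) + (2 * m + 2)) := by
    refine hd2.trans_eq ?_
    rw [div_eq_div_iff (by positivity) (by positivity)]
    ring
  have hd0 : 0 < d := lt_trans (by positivity) hd1'
  have hdlt : d < 1 := lt_of_le_of_lt hd2' (by rw [div_lt_one (by positivity)]; linarith)
  set k := F4inv d with hkdef
  have hk1 : 1 ≤ k := one_le_F4inv hdlt
  have hdk : d ≤ f4 k := le_f4_F4inv hdlt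
  have hklow : 2 * m ^ 2 + 3 * m + 1 < k := by
    by_contra hc
    have := f4_le_of_le (s₀ := 4 * m + 3) hk1 (not_lt.1 hc) (by ring) (by omega)
    push_cast at this
    linarith
  have hkup : k ≤ 2 * m ^ 2 + 4 * m + 2 := by
    refine F4inv_le (by omega) (hd2'.trans ?_)
    have := le_f4 (j := 2 * m ^ 2 + 4 * m + 2) (s := 4 * m + 4) (by omega) (by nlinarith)
    push_cast at this
    refine le_trans (le_of_eq ?_) this
    congr 2
    ring
  refine le_antisymm ?_ (F4inv_le_C4 hd0 hdlt)
  have hfk : f4 k ≤ (k : ℝ) / (k + (2 * m + 2)) := by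
    have := f4_le (j := k) (s := 4 * m + 3) hk1 (by
      have : 2 * (m : ℝ) ^ 2 + 3 * m + 1 + 1 ≤ k := by exact_mod_cast hklow
      push_cast
      nlinarith)
    push_cast at this
    refine this.trans (le_of_eq ?_)
    congr 2
    ring
  refine mgcs_le (hdk.trans hfk) ?_
  obtain ⟨W, h1, h2⟩ := exists_rect4 (m + 1) (m + 1) (2 * m ^ 2 + 4 * m + 2 - k) (by omega)
    (by omega) (by omega)
  have e1 : 2 * (m + 1) * (m + 1) - (2 * m ^ 2 + 4 * m + 2 - k) = k := by
    have : 2 * (m + 1) * (m + 1) = 2 * m ^ 2 + 4 * m + 2 := by ring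
    omega
  rw [e1] at h1 h2
  refine ⟨W, h1, le_trans (le_of_eq ?_) h2⟩
  push_cast
  congr 2
  ring

/-! ### Exact values of `C4` on the first intervals. -/

/-- Upper bounds for the first values of `f4`. -/
theorem f4_le_of_small {k : ℕ} {ρ : ℝ} (s : ℕ → ℕ)
    (h : ∀ j, 1 ≤ j → j ≤ k → (s j : ℝ) ^ 2 < 4 * (2 * j - 1) ∧
      (j : ℝ) / (j + (s j + 1) / 2) ≤ ρ) : ∀ j, 1 ≤ j → j ≤ k → f4 j ≤ ρ :=
  fun j hj hjk => (f4_le hj (h j hj hjk).1).trans (h j hj hjk).2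

theorem C4_eq_one {d : ℝ} (hd : d ∈ Set.Ioc (0 : ℝ) (1 / 2)) : C4 d = 1 := by
  refine le_antisymm ?_ ?_
  · obtain ⟨W, h1, h2⟩ := exists_diamond 1 le_rfl
    exact_mod_cast mgcs_le (k := 1) (ρ := 1 / 2) hd.2 ⟨W, by simpa using h1, by simpa using h2⟩
  · have := le_C4 hd.1 (k := 0) fun j h1 h2 => by omega
    simpa using this

theorem C4_eq_three {d : ℝ} (hd : d ∈ Set.Ioc (1 / 2 : ℝ) (13 / 24)) : C4 d = 3 := by
  refine le_antisymm ?_ ?_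
  · exact_mod_cast mgcs_le hd.2 exists_density_13_24
  -- The listed numbers are the largest integers `s` with `s ^ 2 < 4 * (2 * j - 1)`, so `s + 1` is
  -- the ceiling in `f4`.
  · have hf := f4_le_of_small (k := 2) (ρ := 1 / 2) (fun j => if j = 1 then 1 else 3) (by
      intro j h1 h2; interval_cases j <;> norm_num)
    have := le_C4 (by linarith [hd.1]) (k := 2) fun j h1 h2 => (hf j h1 h2).trans_lt hd.1
    exact_mod_cast this

theorem C4_eq_four {d : ℝ} (hd : d ∈ Set.Ioc (13 / 24 : ℝ) (4 / 7)) : C4 d = 4 := by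
  refine le_antisymm ?_ ?_
  · obtain ⟨W, h1, h2⟩ := exists_rect4 1 2 0 (by norm_num) (by norm_num) (by norm_num)
    norm_num at h1 h2
    exact_mod_cast mgcs_le (k := 4) hd.2 ⟨W, h1, h2⟩
  · have := le_mgcs (G := adj4) (d := d) (k := 3) fun W hW => by
      obtain ⟨K⟩ := nonempty_comps hW
      exact (density_le_of_comps_three K).trans_lt hd.1
    exact_mod_cast this

theorem C4_eq_five {d : ℝ} (hd : d ∈ Set.Ioc (4 / 7 : ℝ) (5 / 8)) : C4 d = 5 := by
  refine le_antisymm ?_ ?_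
  · obtain ⟨W, h1, h2⟩ := exists_diamond 2 (by norm_num)
    norm_num at h1 h2
    exact_mod_cast mgcs_le (k := 5) hd.2 ⟨W, h1, h2⟩
  · have hf := f4_le_of_small (k := 4) (ρ := 4 / 7)
      (fun j => if j = 1 then 1 else if j = 2 then 3 else if j = 3 then 4 else 5) (by
      intro j h1 h2; interval_cases j <;> norm_num)
    have := le_C4 (by linarith [hd.1]) (k := 4) fun j h1 h2 => (hf j h1 h2).trans_lt hd.1
    exact_mod_cast this

theorem C4_eq_seven {d : ℝ} (hd : d ∈ Set.Ioc (5 / 8 : ℝ) (7 / 11)) : C4 d = 7 := by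
  refine le_antisymm ?_ ?_
  · obtain ⟨W, h1, h2⟩ := exists_rect4 2 2 1 (by norm_num) (by norm_num) (by norm_num)
    norm_num at h1 h2
    exact_mod_cast mgcs_le (k := 7) hd.2 ⟨W, h1, h2⟩
  · have := le_mgcs (G := adj4) (d := d) (k := 6) fun W hW => by
      obtain ⟨K⟩ := nonempty_comps hW
      exact (density_le_of_comps_six K).trans_lt hd.1
    exact_mod_cast this

theorem C4_eq_eight {d : ℝ} (hd : d ∈ Set.Ioc (7 / 11 : ℝ) (2 / 3)) : C4 d = 8 := by
  refine le_antisymm ?_ ?_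
  · obtain ⟨W, h1, h2⟩ := exists_rect4 2 2 0 (by norm_num) (by norm_num) (by norm_num)
    norm_num at h1 h2
    exact_mod_cast mgcs_le (k := 8) hd.2 ⟨W, h1, h2⟩
  · have hf := f4_le_of_small (k := 7) (ρ := 7 / 11)
      (fun j => if j = 1 then 1 else if j = 2 then 3 else if j = 3 then 4 else
        if j ≤ 5 then 5 else if j = 6 then 6 else 7) (by
      intro j h1 h2; interval_cases j <;> norm_num)
    have := le_C4 (by linarith [hd.1]) (k := 7) fun j h1 h2 => (hf j h1 h2).trans_lt hd.1
    exact_mod_cast this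

theorem C4_eq_ten {d : ℝ} (hd : d ∈ Set.Ioc (2 / 3 : ℝ) (61 / 90)) : C4 d = 10 := by
  refine le_antisymm ?_ ?_
  · exact_mod_cast mgcs_le hd.2 exists_density_61_90
  · have hf := f4_le_of_small (k := 9) (ρ := 2 / 3)
      (fun j => if j = 1 then 1 else if j = 2 then 3 else if j = 3 then 4 else
        if j ≤ 5 then 5 else if j = 6 then 6 else if j ≤ 8 then 7 else 8) (by
      intro j h1 h2; interval_cases j <;> norm_num)
    have := le_C4 (by linarith [hd.1]) (k := 9) fun j h1 h2 => (hf j h1 h2).trans_lt hd.1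
    exact_mod_cast this

end BinaryImage

theorem corollary1p2 :
    (∀ d ∈ Set.Ioo (0 : ℝ) 1,
      -- the minima defining `F₈⁻¹(d)` and `F₄⁻¹(d)` exist
      (IsLeast {k : ℕ | 1 ≤ k ∧ d ≤ BinaryImage.F8 k} (BinaryImage.F8inv d) ∧
        IsLeast {k : ℕ | 1 ≤ k ∧ d ≤ BinaryImage.F4 k} (BinaryImage.F4inv d)) ∧
      (BinaryImage.C8 d = (BinaryImage.F8inv d : ℕ∞) ∧
        4 / (1 - d) ^ 2 - 6 / (1 - d) ≤ (BinaryImage.F8inv d : ℝ)) ∧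
      ((BinaryImage.F4inv d : ℕ∞) ≤ BinaryImage.C4 d ∧
        2 / (1 - d) ^ 2 - 4 / (1 - d) ≤ (BinaryImage.F4inv d : ℝ))) ∧
    -- exact values of `C₄`
    (∀ d ∈ Set.Ioc (0 : ℝ) (1 / 2), BinaryImage.C4 d = 1) ∧
    (∀ d ∈ Set.Ioc (1 / 2 : ℝ) (13 / 24), BinaryImage.C4 d = 3) ∧
    (∀ d ∈ Set.Ioc (13 / 24 : ℝ) (4 / 7), BinaryImage.C4 d = 4) ∧
    (∀ d ∈ Set.Ioc (4 / 7 : ℝ) (5 / 8), BinaryImage.C4 d = 5) ∧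
    (∀ d ∈ Set.Ioc (5 / 8 : ℝ) (7 / 11), BinaryImage.C4 d = 7) ∧
    (∀ d ∈ Set.Ioc (7 / 11 : ℝ) (2 / 3), BinaryImage.C4 d = 8) ∧
    (∀ d ∈ Set.Ioc (2 / 3 : ℝ) (61 / 90), BinaryImage.C4 d = 10) ∧
    (∀ n : ℕ, 2 ≤ n →
      ∀ d ∈ Set.Ioc ((4 * (n : ℝ) ^ 2 - 6 * n + 2) / (4 * (n : ℝ) ^ 2 - 2 * n - 1))
          ((((n : ℝ) - 1) ^ 2 + (n : ℝ) ^ 2) / (2 * (n : ℝ) ^ 2)),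
        BinaryImage.C4 d = (BinaryImage.F4inv d : ℕ∞)) ∧
    (∀ n : ℕ, 2 ≤ n →
      ∀ d ∈ Set.Ioc ((4 * (n : ℝ) ^ 2 - 2 * n) / (4 * (n : ℝ) ^ 2 + 2 * n - 1))
          ((n : ℝ) / ((n : ℝ) + 1)),
        BinaryImage.C4 d = (BinaryImage.F4inv d : ℕ∞)) := by
  refine ⟨fun d hd => ⟨⟨BinaryImage.isLeast_F8inv hd.2, BinaryImage.isLeast_F4inv hd.2⟩,
    ⟨BinaryImage.C8_eq hd.1 hd.2, BinaryImage.F8inv_ge hd.2⟩,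
    BinaryImage.F4inv_le_C4 hd.1 hd.2, BinaryImage.F4inv_ge hd.2⟩,
    fun d hd => BinaryImage.C4_eq_one hd, fun d hd => BinaryImage.C4_eq_three hd,
    fun d hd => BinaryImage.C4_eq_four hd, fun d hd => BinaryImage.C4_eq_five hd,
    fun d hd => BinaryImage.C4_eq_seven hd, fun d hd => BinaryImage.C4_eq_eight hd,
    fun d hd => BinaryImage.C4_eq_ten hd,
    fun n hn d hd => BinaryImage.C4_eq_of_diamond hn hd,
    fun n hn d hd => BinaryImage.C4_eq_of_square hn hd⟩
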